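/- Let $n\ge 1$ and $k\ge 0$ be integers. (For $k\ge n$ the algebras with index $k+1$ below are zero, so the case of interest is $0\le k<n$.) **The algebra $\mathcal B_l(n,k)$.** An I-state is a $k$-element subset $\mathbf x\subset\{0,\dots,n\}$; it is a left I-state if $n\notin\mathbf x$. Put $v_i^{\mathbf x}=|\mathbf x\cap\{i,\dots,n\}|$ for $1\le i\le n$. Let $\mathcal B_0(n,k)$ be the $\mathbb Z[U_1,\dots,U_n]$-algebra that is free as a module on elements $f_{\mathbf x,\mathbf y}$ ($\mathbf x,\mathbf y$ I-states), with $f_{\mathbf x,\mathbf y}f_{\mathbf y,\mathbf z}=\prod_iU_i^{g_i}f_{\mathbf x,\mathbf z}$, $g_i=\tfrac12\big(|v_i^{\mathbf y}-v_i^{\mathbf z}|-|v_i^{\mathbf x}-v_i^{\mathbf z}|+|v_i^{\mathbf x}-v_i^{\mathbf y}|\big)$, and all other products $f_{\mathbf x,\mathbf y}f_{\mathbf y',\mathbf z}$ ($\mathbf y\neq\mathbf y'$) equal to $0$. Put $\mathbf I_{\mathbf x}=f_{\mathbf x,\mathbf x}$, let $R_i$ be the sum of all $f_{\mathbf x,\mathbf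 x\setminus\{i-1\}\cup\{i\}}$ with $\mathbf x\cap\{i-1,i\}=\{i-1\}$, and $L_i$ the sum of all $f_{\mathbf x,\mathbf x\setminus\{i\}\cup\{i-1\}}$ with $\mathbf x\cap\{i-1,i\}=\{i\}$. Then $\mathcal B(n,k)$ is the quotient of $\mathcal B_0(n,k)$ by the two-sided ideal generated by $R_{i-1}R_i$ and $L_iL_{i-1}$ ($2\le i\le n$) and by $U_i\mathbf I_{\mathbf x}$ for $1\le i\le n$ and $\mathbf x\cap\{i-1,i\}=\varnothing$, and $\mathcal B_l(n,k)=e\,\mathcal B(n,k)\,e$ with $e=\sum_{n\notin\mathbf x}\mathbf I_{\mathbf x}$. It is graded by $\deg f_{\mathbf x,\mathbf y}=\sum_i|v_i^{\mathbf x}-v_i^{\mathbf y}|$, $\deg U_i=2$. **The algebra $\mathcal A^{\mathbb Z}_{n,k}$.** Let $D_{n,k}$ be the set of sequences of length $n$ with $k$ symbols $\wedge$ and $n-k$ symbols $\vee$. It is identified with the set of left I-states: $\mathbf x$ corresponds to the sequence with the symbols $\wedge$ in the positions $a+1$, $a\in\mathbf x$. For $\lambda\in D_{n,k}$ let $\vee_j^\lambda$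 be the position of the $j$-th symbol $\vee$, let $b_i^\lambda-1$ be the number of symbols $\wedge$ strictly to the right of position $i$, and let $R_\lambda=R/(h_{b_1^\lambda}(x_1),h_{b_2^\lambda}(x_1,x_2),\dots,h_{b_n^\lambda}(x_1,\dots,x_n))$, where $R=\mathbb Z[x_1,\dots,x_n]$ and $h_d$ is the complete homogeneous symmetric polynomial of degree $d$. The sequences $\lambda,\mu$ are too far if $\vee_j^\mu\ge\vee_{j+1}^\lambda$ or $\vee_j^\lambda\ge\vee_{j+1}^\mu$ for some $1\le j\le n-k-1$. Let $\mathcal W_{\lambda,\mu}\subset\operatorname{Hom}_R(R_\lambda,R_\mu)$ be everything if $\lambda,\mu$ are too far, and otherwise the $R$-submodule generated by the maps $1\mapsto(x_{\alpha(j)}x_{\alpha(j)+1}\cdots x_{\beta(j)})\prod_ix_i^{\max(b_i^\mu-b_i^\lambda,0)}$ for $1\le j\le n-k$, where $\alpha(j)=\max(\vee_j^\lambda,\vee_j^\mu)$, $\beta(j)=\min(\vee_{j+1}^\lambda,\vee_{j+1}^\mu)-1$ for $j<n-k$ and $\beta(n-k)=n$. Then $$\mathcal A^{\mathbb Z}_{n,k}=\bigoplus_{\lambda,\mu\in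 D_{n,k}}\operatorname{Hom}_R(R_\lambda,R_\mu)/\mathcal W_{\lambda,\mu},$$ a ring under composition, graded by $\deg(1\mapsto p)=2\deg p+\sum_i(b_i^\lambda-b_i^\mu)$ for $1\mapsto p$ from $R_\lambda$ to $R_\mu$. **The homomorphism $\Xi$.** There is a homomorphism of graded rings $\Xi\colon\mathcal B_l(n,k)\to\mathcal A^{\mathbb Z}_{n,k}$, linear over $\mathbb Z[U_1,\dots,U_n]$ with $U_i$ acting as $x_i$, that sends $f_{\mathbf x,\mathbf y}$ to the class of $R_\lambda\to R_\mu$, $1\mapsto\prod_ix_i^{\max(v_i^{\mathbf x}-v_i^{\mathbf y},0)}$, where $\mu,\lambda$ correspond to $\mathbf x,\mathbf y$. Restriction of an action along $\Xi$ is called inflation; projection of a right $\mathcal B_l(n,k)$-action means applying $-\otimes_{\mathcal B_l(n,k)}\mathcal A^{\mathbb Z}_{n,k}$. **The bimodules.** In $\mathcal A^{\mathbb Z}_{n,k}$ let $e^\vee_k$ be the sum of the identities $\mathbf 1_\lambda$ over the sequences $\lambda$ with first symbol $\vee$, and in $\mathcal B_l(n,k)$ let $e_k^\vee=\sum_{0\notin\mathbf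 x}\mathbf I_{\mathbf x}$. Changing the first symbol from $\wedge$ to $\vee$ does not change $R_\lambda$; hence sending the class of a morphism $R_{\wedge\lambda}\to R_{\wedge\mu}$ to the class of the same morphism $R_{\vee\lambda}\to R_{\vee\mu}$, and the components at other pairs of sequences to $0$, gives a ring homomorphism $\Psi\colon\mathcal A^{\mathbb Z}_{n,k+1}\to e_k^\vee\mathcal A^{\mathbb Z}_{n,k}e_k^\vee$. Similarly, $f_{\mathbf x,\mathbf y}\mapsto f_{\mathbf x\setminus\{0\},\mathbf y\setminus\{0\}}$ if $0\in\mathbf x\cap\mathbf y$, and $f_{\mathbf x,\mathbf y}\mapsto0$ otherwise, gives a ring homomorphism $\Psi'\colon\mathcal B_l(n,k+1)\to e_k^\vee\mathcal B_l(n,k)e_k^\vee$, linear over $\mathbb Z[U_1,\dots,U_n]$. Let $\mathbf F_k^S=\mathcal A^{\mathbb Z}_{n,k}e_k^\vee$, with right $\mathcal A^{\mathbb Z}_{n,k+1}$-action through $\Psi$, let $\mathbf F_k^{OSz}=\mathcal B_l(n,k)e_k^\vee$, with right $\mathcal B_l(n,k+1)$-action through $\Psi'$, and let $$\mathbf E'_k=\operatorname{Hom}_{\mathcal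 A^{\mathbb Z}_{n,k}}(\mathbf F^S_k,\mathcal A^{\mathbb Z}_{n,k}),\qquad\mathbf E''_k=\operatorname{Hom}_{\mathcal B_l(n,k)}(\mathbf F_k^{OSz},\mathcal B_l(n,k))$$ be the left duals (homomorphisms of left modules), which are graded bimodules with the actions $(t\varphi)(f)=\varphi(ft)$ and $(\varphi s)(f)=\varphi(f)s$. **Theorem.** The graded $(\mathcal B_l(n,k+1),\mathcal A^{\mathbb Z}_{n,k})$-bimodules ${}_{\mathrm{infl}}(\mathbf E'_k)$, the inflation of the left action of $\mathbf E'_k$ along $\Xi\colon\mathcal B_l(n,k+1)\to\mathcal A^{\mathbb Z}_{n,k+1}$, and $(\mathbf E''_k)_{\mathrm{pr}}=\mathbf E''_k\otimes_{\mathcal B_l(n,k)}\mathcal A^{\mathbb Z}_{n,k}$, the projection of the right action of $\mathbf E''_k$, are isomorphic by an isomorphism that preserves degrees. Consequently the functors $\mathcal E'_k=\mathbf E'_k\otimes-$ and $\mathcal E''_k=\mathbf E''_k\otimes-$ intertwine the inflation functors: there are isomorphisms of left $\mathcal B_l(n,k+1)$-modules $$\mathrm{infl}\big(\mathbf E'_k\otimes_{\mathcal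 A^{\mathbb Z}_{n,k}}M\big)\;\cong\;\mathbf E''_k\otimes_{\mathcal B_l(n,k)}\mathrm{infl}(M)$$ for all left $\mathcal A^{\mathbb Z}_{n,k}$-modules $M$, natural in $M$, which preserve degrees for every graded module $M$. -/

import Mathlib

/-!
Conventions. The lines (variables) `1, …, n` are numbered `0, …, n - 1`, that is, `i : Fin n` stands
for the line `i + 1`, which lies between the positions `i` and `i + 1` of an I-state. A
`∧∨`-sequence of length `n` with `k` symbols `∧` is encoded by the set of the (0-based) positions of
its symbols `∧`, a `k`-element subset of `{0, …, n - 1}`; this is also the left I-state that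
corresponds to it. The symbols `∨` are the elements of the complement, the holes. The `∨` with index
`j + 1` is the hole with index `j`; the next hole after the last symbol `∨` is `n`.
-/

namespace BordSart

open MvPolynomial in
theorem hsymm_option_succ {σ : Type*} [Fintype σ] [DecidableEq σ] (d : ℕ) :
    hsymm (Option σ) ℤ (d + 1) =
      X none * hsymm (Option σ) ℤ d + rename some (hsymm σ ℤ (d + 1)) := by
  unfold hsymm
  rw [← Equiv.sum_comp (symOptionSuccEquiv (α := σ) (n := d)).symm, Fintype.sum_sum_type,
    Finset.mul_sum, map_sum]
  congr 1
  · refine Finset.sum_congr rfl fun s _ => ?_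
    simp [symOptionSuccEquiv, Sym.coe_cons]
  · refine Finset.sum_congr rfl fun s _ => ?_
    simp [symOptionSuccEquiv, map_multiset_prod]

section Step
open Polynomial
variable {S : Type*} [CommRing S]

theorem mem_map_C_iff_map {J : Ideal S} {p : S[X]} :
    p ∈ J.map (C : S →+* S[X]) ↔ p.map (Ideal.Quotient.mk J) = 0 := by
  rw [Ideal.mem_map_C_iff, Polynomial.ext_iff]
  simp [Ideal.Quotient.eq_zero_iff_mem]

theorem monic_cancel {J : Ideal S} {f p : S[X]} (hf : f.Monic)
    (h : p * f ∈ J.map (C : S →+* S[X])) : p ∈ J.map (C : S →+* S[X]) := by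
  rw [mem_map_C_iff_map] at h ⊢
  rw [Polynomial.map_mul] at h
  exact ((hf.map _).mul_left_eq_zero_iff).1 h

theorem mem_sup_span {K : Ideal S[X]} {f p : S[X]} :
    p ∈ K ⊔ Ideal.span {f} ↔ ∃ s, p - s * f ∈ K := by
  rw [sup_comm, Ideal.mem_span_singleton_sup]
  constructor
  · rintro ⟨a, b, hb, rfl⟩
    exact ⟨a, by simpa using hb⟩
  · rintro ⟨s, hs⟩
    exact ⟨s, _, hs, by ring⟩

theorem mod_mod {f : S[X]} (hf : f.Monic) (q : S[X]) : q %ₘ f %ₘ f = q %ₘ f := by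
  nontriviality S
  exact (Polynomial.modByMonic_eq_self_iff hf).2 (Polynomial.degree_modByMonic_lt _ hf)

theorem mem_of_mem_sup_of_mod {J : Ideal S} {f r : S[X]} (hf : f.Monic) (hr : r %ₘ f = r)
    (h : r ∈ J.map (C : S →+* S[X]) ⊔ Ideal.span {f}) : r ∈ J.map (C : S →+* S[X]) := by
  obtain ⟨s, hs⟩ := mem_sup_span.1 h
  rw [mem_map_C_iff_map] at hs ⊢
  rw [← hr, Polynomial.map_modByMonic _ hf]
  rw [Polynomial.map_sub, sub_eq_zero, Polynomial.map_mul] at hs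
  rw [hs]
  exact Polynomial.mul_self_modByMonic (hf.map _)

/-- `χ` presents `(J' : J)` as `(χ) + J'`, and `(J' : χ)` as `M`. -/
structure ColonData (J J' M : Ideal S) (χ : S) : Prop where
  mul_mem : ∀ z ∈ M, χ * z ∈ J'
  mem_of_mul : ∀ z, χ * z ∈ J' → z ∈ M
  gen : ∀ q, (∀ h ∈ J, h * q ∈ J') → ∃ s, q - χ * s ∈ J'

variable {J J' M : Ideal S} {χ : S}

theorem ColonData.mem_C (H : ColonData J J' M χ) {p : S[X]} :
    C χ * p ∈ J'.map (C : S →+* S[X]) ↔ p ∈ M.map (C : S →+* S[X]) := by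
  simp only [Ideal.mem_map_C_iff, coeff_C_mul]
  exact ⟨fun h n => H.mem_of_mul _ (h n), fun h n => H.mul_mem _ (h n)⟩

theorem ColonData.cancel (H : ColonData J J' M χ) {f' p : S[X]} (hf' : f'.Monic)
    (h : C χ * p ∈ J'.map (C : S →+* S[X]) ⊔ Ideal.span {f'}) :
    ∃ s, p - s * f' ∈ M.map (C : S →+* S[X]) := by
  obtain ⟨s, hs⟩ := mem_sup_span.1 h
  have h1 : s * f' ∈ (J' ⊔ Ideal.span {χ}).map (C : S →+* S[X]) := by
    have h2 : C χ * p ∈ (J' ⊔ Ideal.span {χ}).map (C : S →+* S[X]) :=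
      Ideal.mul_mem_right _ _ (Ideal.mem_map_of_mem _
        (Ideal.mem_sup_right (Ideal.mem_span_singleton_self χ)))
    have h3 := Ideal.map_mono (f := (C : S →+* S[X])) (le_sup_left : J' ≤ J' ⊔ Ideal.span {χ}) hs
    simpa using sub_mem h2 h3
  have h4 := monic_cancel hf' h1
  rw [Ideal.map_sup, Ideal.map_span, Set.image_singleton] at h4
  obtain ⟨s', hs'⟩ := mem_sup_span.1 h4
  refine ⟨s', H.mem_C.1 ?_⟩
  have : C χ * (p - s' * f') = (C χ * p - s * f') + (s - s' * C χ) * f' := by ring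
  rw [this]
  exact add_mem hs (Ideal.mul_mem_right _ _ hs')

theorem ColonData.reduce (H : ColonData J J' M χ) {f' q : S[X]} (hf' : f'.Monic)
    (h : ∀ x ∈ J.map (C : S →+* S[X]), x * q ∈ J'.map (C : S →+* S[X]) ⊔ Ideal.span {f'}) :
    ∃ p, q - C χ * p ∈ J'.map (C : S →+* S[X]) ⊔ Ideal.span {f'} := by
  have key : ∀ t, ∃ s, (q %ₘ f').coeff t - χ * s ∈ J' := by
    intro t
    apply H.gen
    intro x hx
    have h1 := h (C x) (Ideal.mem_map_of_mem _ hx)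
    have h2 : C x * (q %ₘ f') ∈ J'.map (C : S →+* S[X]) := by
      apply mem_of_mem_sup_of_mod hf'
      · rw [← smul_eq_C_mul, Polynomial.smul_modByMonic, mod_mod hf']
      · have h3 : C x * (q %ₘ f') = C x * q - (C x * (q /ₘ f')) * f' := by
          rw [Polynomial.modByMonic_eq_sub_mul_div]; ring
        rw [h3]
        exact sub_mem h1 (Ideal.mem_sup_right (Ideal.mul_mem_left _ _
          (Ideal.mem_span_singleton_self f')))
    simpa using Ideal.mem_map_C_iff.1 h2 t
  choose s hs using key
  refine ⟨∑ t ∈ Finset.range ((q %ₘ f').natDegree + 1), monomial t (s t), ?_⟩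
  have h5 : q %ₘ f' - C χ * ∑ t ∈ Finset.range ((q %ₘ f').natDegree + 1), monomial t (s t)
      ∈ J'.map (C : S →+* S[X]) := by
    rw [Ideal.mem_map_C_iff]
    intro t
    simp only [coeff_sub, coeff_C_mul, finsetSum_coeff, coeff_monomial, Finset.sum_ite_eq',
      Finset.mem_range]
    split_ifs with ht
    · exact hs t
    · rw [coeff_eq_zero_of_natDegree_lt (by omega)]
      simp
  have h6 : q - C χ * ∑ t ∈ Finset.range ((q %ₘ f').natDegree + 1), monomial t (s t)
      = (q %ₘ f' - C χ * ∑ t ∈ Finset.range ((q %ₘ f').natDegree + 1), monomial t (s t))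
        + (q /ₘ f') * f' := by
    rw [Polynomial.modByMonic_eq_sub_mul_div]; ring
  rw [h6]
  exact add_mem (Ideal.mem_sup_left h5) (Ideal.mem_sup_right (Ideal.mul_mem_left _ _
          (Ideal.mem_span_singleton_self f')))

theorem ColonData.stepA (H : ColonData J J' M χ) (f : S[X]) {f' : S[X]} (hf' : f'.Monic) :
    ColonData (J.map (C : S →+* S[X]) ⊔ Ideal.span {f}) (J'.map (C : S →+* S[X]) ⊔ Ideal.span {f'})
      (M.map (C : S →+* S[X]) ⊔ Ideal.span {f'}) (C χ) where
  mul_mem z hz := by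
    obtain ⟨s, hs⟩ := mem_sup_span.1 hz
    refine mem_sup_span.2 ⟨C χ * s, ?_⟩
    have := H.mem_C.2 hs
    rwa [mul_sub, ← mul_assoc] at this
  mem_of_mul z hz := mem_sup_span.2 (H.cancel hf' hz)
  gen q hq := H.reduce hf' fun x hx => hq x (Ideal.mem_sup_left hx)

theorem ColonData.stepB (H : ColonData J J' M χ) {f f' : S[X]} (hf : f.Monic) (hf' : f'.Monic)
    {d : ℕ} (hd : f' - X ^ d * f ∈ M.map (C : S →+* S[X])) :
    ColonData (J.map (C : S →+* S[X]) ⊔ Ideal.span {f}) (J'.map (C : S →+* S[X]) ⊔ Ideal.span {f'})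
      (M.map (C : S →+* S[X]) ⊔ Ideal.span {f}) (C χ * X ^ d) where
  mul_mem z hz := by
    obtain ⟨s, hs⟩ := mem_sup_span.1 hz
    refine mem_sup_span.2 ⟨C χ * s, ?_⟩
    have : C χ * X ^ d * z - C χ * s * f'
        = C χ * (X ^ d * (z - s * f) - s * (f' - X ^ d * f)) := by ring
    rw [this]
    exact H.mem_C.2 (sub_mem (Ideal.mul_mem_left _ _ hs) (Ideal.mul_mem_left _ _ hd))
  mem_of_mul z hz := by
    rw [mul_assoc] at hz
    obtain ⟨s, hs⟩ := H.cancel hf' hz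
    refine mem_sup_span.2 ⟨s, monic_cancel (monic_X_pow d) ?_⟩
    have : (z - s * f) * X ^ d = (X ^ d * z - s * f') + s * (f' - X ^ d * f) := by ring
    rw [this]
    exact add_mem hs (Ideal.mul_mem_left _ _ hd)
  gen q hq := by
    obtain ⟨p, hp⟩ := H.reduce hf' fun x hx => hq x (Ideal.mem_sup_left hx)
    have h1 : C χ * (f * p) ∈ J'.map (C : S →+* S[X]) ⊔ Ideal.span {f'} := by
      have h2 := hq f (Ideal.mem_sup_right (Ideal.mem_span_singleton_self f))
      have h3 := sub_mem h2 (Ideal.mul_mem_left _ f hp)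
      have h4 : f * q - f * (q - C χ * p) = C χ * (f * p) := by ring
      rwa [h4] at h3
    obtain ⟨s, hs⟩ := H.cancel hf' h1
    have h5 : p - s * X ^ d ∈ M.map (C : S →+* S[X]) := by
      apply monic_cancel hf
      have : (p - s * X ^ d) * f = (f * p - s * f') + s * (f' - X ^ d * f) := by ring
      rw [this]
      exact add_mem hs (Ideal.mul_mem_left _ _ hd)
    refine ⟨s, ?_⟩
    have : q - C χ * X ^ d * s = (q - C χ * p) + C χ * (p - s * X ^ d) := by ring
    rw [this]
    exact add_mem hp (Ideal.mem_sup_left (H.mem_C.2 h5))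

end Step

/-! ### The ideals -/

open MvPolynomial

/-- The polynomial ring `ℤ[x_1, …, x_n]`, also written `ℤ[U_1, …, U_n]`. -/
abbrev Pol (n : ℕ) := MvPolynomial (Fin n) ℤ

/-- The complete homogeneous symmetric polynomial `h_d(x_1, …, x_{i+1})` in the variables up to line `i`. -/
noncomputable def hPart (n d : ℕ) (i : Fin n) : Pol n :=
  rename (Fin.castLE i.2 : Fin (i + 1) → Fin n) (hsymm (Fin (i + 1)) ℤ d)

/-- The ideal generated by the polynomials `h_{b_i}(x_1, …, x_i)`. -/
noncomputable def Ib (n : ℕ) (b : ℕ → ℕ) : Ideal (Pol n) :=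
  Ideal.span (Set.range fun i : Fin n => hPart n (b i) i)

/-- The monomial with exponents `e`. -/
noncomputable def mon (n : ℕ) (e : ℕ → ℕ) : Pol n := ∏ i : Fin n, X i ^ e i

/-- Splitting off the last variable. -/
noncomputable def lastEquiv (n : ℕ) : Pol (n + 1) ≃ₐ[ℤ] Polynomial (Pol n) :=
  (renameEquiv ℤ finSuccEquivLast).trans (optionEquivLeft ℤ (Fin n))

theorem lastEquiv_rename (n : ℕ) (p : Pol n) :
    lastEquiv n (rename Fin.castSucc p) = Polynomial.C p := by
  have : ((lastEquiv n : Pol (n+1) →ₐ[ℤ] Polynomial (Pol n)).comp (rename Fin.castSucc))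
      = (IsScalarTower.toAlgHom ℤ (Pol n) (Polynomial (Pol n))) := by
    ext i
    simp [lastEquiv]
  exact DFunLike.congr_fun this p

theorem lastEquiv_X_last (n : ℕ) : lastEquiv n (X (Fin.last n)) = Polynomial.X := by
  simp [lastEquiv]

theorem lastEquiv_X_castSucc (n : ℕ) (i : Fin n) :
    lastEquiv n (X i.castSucc) = Polynomial.C (X i) := by
  simp [lastEquiv]

/-- The complete symmetric polynomial as a polynomial in the last variable. -/
noncomputable def hE (n d : ℕ) : Polynomial (Pol n) := lastEquiv n (hsymm (Fin (n + 1)) ℤ d)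

theorem hE_zero (n : ℕ) : hE n 0 = 1 := by simp [hE]

theorem hE_succ (n d : ℕ) :
    hE n (d + 1) = Polynomial.X * hE n d + Polynomial.C (hsymm (Fin n) ℤ (d + 1)) := by
  have h : ∀ d, hE n d = optionEquivLeft ℤ (Fin n) (hsymm (Option (Fin n)) ℤ d) := by
    intro d
    rw [hE, lastEquiv, AlgEquiv.trans_apply, renameEquiv_apply, rename_hsymm]
  rw [h, h, hsymm_option_succ, map_add, map_mul, optionEquivLeft_X_none]
  congr 1
  have : ((optionEquivLeft ℤ (Fin n) : _ →ₐ[ℤ] Polynomial (Pol n)).comp (rename some))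
      = (IsScalarTower.toAlgHom ℤ (Pol n) (Polynomial (Pol n))) := by
    ext i
    simp
  exact DFunLike.congr_fun this _

theorem hE_monic_natDegree (n d : ℕ) : (hE n d).Monic ∧ (hE n d).natDegree = d := by
  induction d with
  | zero => simp [hE_zero]
  | succ d ih =>
    obtain ⟨h1, h2⟩ := ih
    have h3 : (Polynomial.X * hE n d).Monic := Polynomial.monic_X.mul h1
    have h4 : (Polynomial.X * hE n d).natDegree = d + 1 := by
      rw [Polynomial.natDegree_X_mul h1.ne_zero, h2]
    have h5 : (Polynomial.C (hsymm (Fin n) ℤ (d + 1))).degree < (Polynomial.X * hE n d).degree := by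
      rw [Polynomial.degree_eq_natDegree h3.ne_zero, h4]
      exact lt_of_le_of_lt Polynomial.degree_C_le (by exact_mod_cast Nat.succ_pos d)
    rw [hE_succ]
    refine ⟨h3.add_of_left h5, ?_⟩
    rw [Polynomial.natDegree_add_eq_left_of_degree_lt h5, h4]

theorem hPart_castSucc (n d : ℕ) (i : Fin n) :
    hPart (n + 1) d i.castSucc = rename Fin.castSucc (hPart n d i) := by
  unfold hPart
  rw [rename_rename]
  rfl

theorem hPart_last (n d : ℕ) : hPart (n + 1) d (Fin.last n) = hsymm (Fin (n + 1)) ℤ d := by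
  unfold hPart
  exact rename_id_apply _

theorem map_Ib_succ (n : ℕ) (b : ℕ → ℕ) :
    (Ib (n + 1) b).map (lastEquiv n : Pol (n + 1) →+* Polynomial (Pol n)) =
      (Ib n b).map (Polynomial.C : Pol n →+* _) ⊔ Ideal.span {hE n (b n)} := by
  unfold Ib
  rw [Ideal.map_span, Ideal.map_span, ← Ideal.span_union]
  congr 1
  ext p
  simp only [Set.mem_image, Set.mem_range, exists_exists_eq_and, Set.mem_union,
    Set.mem_singleton_iff]
  constructor
  · rintro ⟨i, rfl⟩
    induction i using Fin.lastCases with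
    | last => right; simp [hPart_last, hE]
    | cast i => left; exact ⟨i, by simp [hPart_castSucc, lastEquiv_rename]⟩
  · rintro (⟨i, rfl⟩ | rfl)
    · exact ⟨i.castSucc, by simp [hPart_castSucc, lastEquiv_rename]⟩
    · exact ⟨Fin.last n, by simp [hPart_last, hE]⟩

theorem mem_Ib_succ {n : ℕ} {b : ℕ → ℕ} {p : Pol (n + 1)} :
    p ∈ Ib (n + 1) b ↔ lastEquiv n p ∈
      (Ib n b).map (Polynomial.C : Pol n →+* _) ⊔ Ideal.span {hE n (b n)} := by
  rw [← map_Ib_succ]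
  constructor
  · exact fun h => Ideal.mem_map_of_mem _ h
  · intro h
    obtain ⟨q, hq, h⟩ := (Ideal.mem_map_iff_of_surjective _ (lastEquiv n).surjective).1 h
    rwa [← (lastEquiv n).injective h]

theorem hsymm_mem_Ib {b : ℕ → ℕ} (hb : ∀ i, b i ≤ b (i + 1) + 1) (n a : ℕ)
    (ha : ∀ i, i + 1 = n → b i ≤ a) (h0 : n = 0 → 1 ≤ a) : hsymm (Fin n) ℤ a ∈ Ib n b := by
  induction n generalizing a with
  | zero =>
    obtain ⟨a, rfl⟩ : ∃ a', a = a' + 1 := ⟨a - 1, by have := h0 rfl; omega⟩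
    have : hsymm (Fin 0) ℤ (a + 1) = 0 := by
      unfold hsymm
      exact Finset.sum_eq_zero fun s _ => by
        exact isEmptyElim s
    rw [this]; exact zero_mem _
  | succ n ih =>
    rw [mem_Ib_succ]
    change hE n a ∈ _
    obtain ⟨d, rfl⟩ := Nat.exists_eq_add_of_le (ha n rfl)
    clear ha h0
    induction d with
    | zero => exact Ideal.mem_sup_right (Ideal.mem_span_singleton_self _)
    | succ d ihd =>
      rw [← add_assoc, hE_succ]
      refine add_mem (Ideal.mul_mem_left _ _ ihd) (Ideal.mem_sup_left (Ideal.mem_map_of_mem _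
        (ih _ ?_ (by omega))))
      rintro i rfl
      have := hb i
      omega

theorem hE_sub_mem {b : ℕ → ℕ} (hb : ∀ i, b i ≤ b (i + 1) + 1) (n β d : ℕ) (h : b n ≤ β) :
    hE n (β + d) - Polynomial.X ^ d * hE n β ∈ (Ib n b).map (Polynomial.C : Pol n →+* _) := by
  induction d with
  | zero => simp
  | succ d ih =>
    rw [← add_assoc, hE_succ]
    have h1 : hsymm (Fin n) ℤ (β + d + 1) ∈ Ib n b := by
      apply hsymm_mem_Ib hb
      · rintro i rfl
        have := hb i
        omega
      · omega
    have h2 : Polynomial.X * hE n (β + d) + Polynomial.C (hsymm (Fin n) ℤ (β + d + 1))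
        - Polynomial.X ^ (d + 1) * hE n β
        = Polynomial.X * (hE n (β + d) - Polynomial.X ^ d * hE n β)
          + Polynomial.C (hsymm (Fin n) ℤ (β + d + 1)) := by ring
    rw [h2]
    exact add_mem (Ideal.mul_mem_left _ _ ih) (Ideal.mem_map_of_mem _ h1)

theorem lastEquiv_mon (n : ℕ) (e : ℕ → ℕ) :
    lastEquiv n (mon (n + 1) e) = Polynomial.C (mon n e) * Polynomial.X ^ e n := by
  simp [mon, Fin.prod_univ_castSucc, lastEquiv_X_castSucc, lastEquiv_X_last]

theorem colonData_Ib {b b' : ℕ → ℕ} (hb : ∀ i, b i ≤ b (i + 1) + 1)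
    (hb' : ∀ i, b' i ≤ b' (i + 1) + 1) (n : ℕ) :
    ColonData (Ib n b) (Ib n b') (Ib n fun i => min (b i) (b' i)) (mon n fun i => b' i - b i) := by
  induction n with
  | zero => 
    have : ∀ b, Ib 0 b = ⊥ := fun b => by simp [Ib, Set.range_eq_empty]
    simp only [this]
    refine ⟨?_, ?_, ?_⟩
    · simp
    · simp [mon]
    · intro q _
      exact ⟨q, by simp [mon]⟩
  | succ n ih =>
    have hm : ∀ i, min (b i) (b' i) ≤ min (b (i + 1)) (b' (i + 1)) + 1 := fun i => by
      have := hb i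
      have := hb' i
      omega
    have key : ColonData ((Ib n b).map (Polynomial.C : Pol n →+* _) ⊔ Ideal.span {hE n (b n)})
      ((Ib n b').map (Polynomial.C : Pol n →+* _) ⊔ Ideal.span {hE n (b' n)})
      ((Ib n fun i => min (b i) (b' i)).map (Polynomial.C : Pol n →+* _) ⊔
        Ideal.span {hE n (min (b n) (b' n))})
      (Polynomial.C (mon n fun i => b' i - b i) * Polynomial.X ^ (b' n - b n)) := by
      rcases le_total (b' n) (b n) with h | h
      · rw [Nat.sub_eq_zero_of_le h, pow_zero, mul_one, min_eq_right h]
        exact ih.stepA _ (hE_monic_natDegree _ _).1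
      · rw [min_eq_left h]
        refine ih.stepB (hE_monic_natDegree _ _).1 (hE_monic_natDegree _ _).1 ?_
        have := hE_sub_mem hm n (b n) (b' n - b n) (min_le_left _ _)
        rwa [Nat.add_sub_cancel' h] at this
    refine ⟨fun z hz => ?_, fun z hz => ?_, fun q hq => ?_⟩
    · rw [mem_Ib_succ] at hz ⊢
      rw [map_mul, lastEquiv_mon]
      exact key.mul_mem _ hz
    · rw [mem_Ib_succ] at hz ⊢
      rw [map_mul, lastEquiv_mon] at hz
      exact key.mem_of_mul _ hz
    · obtain ⟨s, hs⟩ := key.gen (lastEquiv n q) fun x hx => by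
        have := hq ((lastEquiv n).symm x) (by rw [mem_Ib_succ]; simpa using hx)
        rw [mem_Ib_succ] at this
        simpa using this
      refine ⟨(lastEquiv n).symm s, ?_⟩
      rw [mem_Ib_succ, map_sub, map_mul, lastEquiv_mon]
      simpa using hs

theorem Ib_mono {b c : ℕ → ℕ} (hc : ∀ i, c i ≤ c (i + 1) + 1) (h : ∀ i, c i ≤ b i) (n : ℕ) :
    Ib n b ≤ Ib n c := by
  induction n with
  | zero => simp [Ib, Set.range_eq_empty]
  | succ n ih =>
    intro p hp
    rw [mem_Ib_succ] at hp ⊢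
    have h1 : hE n (b n) ∈ (Ib n c).map (Polynomial.C : Pol n →+* _) ⊔ Ideal.span {hE n (c n)} := ?_
    · have h2 : (Ib n b).map (Polynomial.C : Pol n →+* _) ⊔ Ideal.span {hE n (b n)} ≤
          (Ib n c).map (Polynomial.C : Pol n →+* _) ⊔ Ideal.span {hE n (c n)} :=
        sup_le ((Ideal.map_mono ih).trans le_sup_left) ((Ideal.span_singleton_le_iff_mem _).2 h1)
      exact h2 hp
    have := hsymm_mem_Ib hc (n + 1) (b n) (fun i hi => by
      obtain rfl : i = n := by omega
      exact h i) (by omega)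
    rwa [mem_Ib_succ] at this

theorem mon_mul_mem {b b' : ℕ → ℕ} (hb : ∀ i, b i ≤ b (i + 1) + 1)
    (hb' : ∀ i, b' i ≤ b' (i + 1) + 1) {n : ℕ} {p : Pol n} (hp : p ∈ Ib n b) :
    mon n (fun i => b' i - b i) * p ∈ Ib n b' :=
  (colonData_Ib hb hb' n).mul_mem _ (Ib_mono (fun i => by
      have := hb i
      have := hb' i
      omega) (fun i => min_le_left _ _) n hp)

/-! ### States -/

open Finset in
/-- `v_i^x`: the number of elements of `x` to the right of line `i`. -/
def wt (x : Finset ℕ) (i : ℕ) : ℕ := #{a ∈ x | i < a}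

/-- The sequence `b` of a `∧∨`-sequence: `b_i - 1` is the number of symbols `∧` strictly to the
right of the symbol at `i`. -/
def bseq (x : Finset ℕ) (i : ℕ) : ℕ := wt x i + 1

/-- The `j`-th natural number (from `j = 0`) not in `x`: the position of the `j`-th symbol `∨`. -/
noncomputable def hole (x : Finset ℕ) (j : ℕ) : ℕ := Nat.nth (fun a => a ∉ x) j

theorem wt_step (x : Finset ℕ) (i : ℕ) : wt x i ≤ wt x (i + 1) + 1 := by
  unfold wt
  have : {a ∈ x | i < a} ⊆ insert (i + 1) {a ∈ x | i + 1 < a} := by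
    intro a
    simp only [Finset.mem_filter, Finset.mem_insert]
    rintro ⟨h1, h2⟩
    by_cases h : a = i + 1
    · exact Or.inl h
    · exact Or.inr ⟨h1, by omega⟩
  exact (Finset.card_le_card this).trans (Finset.card_insert_le _ _)

theorem bseq_step (x : Finset ℕ) (i : ℕ) : bseq x i ≤ bseq x (i + 1) + 1 :=
  Nat.succ_le_succ (wt_step x i)

/-- The number of holes of `x` in `{0, …, i}`. -/
def hc (x : Finset ℕ) (i : ℕ) : ℕ := Nat.count (fun a => a ∉ x) (i + 1)

theorem hc_add (x : Finset ℕ) (i : ℕ) : hc x i + x.card = wt x i + (i + 1) := by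
  have h1 : (Finset.filter (fun a => a ∉ x) (Finset.range (i + 1))).card +
      (Finset.filter (fun a => a ∈ x) (Finset.range (i + 1))).card = i + 1 := by
    rw [add_comm, Finset.card_filter_add_card_filter_not, Finset.card_range]
  have h2 : (Finset.filter (fun a => i < a) x).card +
      (Finset.filter (fun a => ¬ i < a) x).card = x.card :=
    Finset.card_filter_add_card_filter_not _
  have h3 : Finset.filter (fun a => ¬ i < a) x =
      Finset.filter (fun a => a ∈ x) (Finset.range (i + 1)) := by
    ext a
    simp only [Finset.mem_filter, Finset.mem_range]
    constructor
    · rintro ⟨h, h'⟩; exact ⟨by omega, h⟩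
    · rintro ⟨h, h'⟩; exact ⟨h', by omega⟩
  unfold hc wt
  rw [Nat.count_eq_card_filter_range, ← h2, h3]
  omega

theorem holes_infinite (x : Finset ℕ) : (Set.ofPred fun a => a ∉ x).Infinite :=
  x.finite_toSet.infinite_compl

theorem hole_le_iff (x : Finset ℕ) (i j : ℕ) : hole x j ≤ i ↔ j < hc x i := by
  unfold hole hc
  rw [← not_lt, ← Nat.succ_le_iff, ← Nat.count_le_iff_le_nth (holes_infinite x), not_le]

theorem hole_lt_hole_succ (x : Finset ℕ) (j : ℕ) : hole x j < hole x (j + 1) :=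
  Nat.nth_strictMono (holes_infinite x) (Nat.lt_succ_self j)

/-- the interval between the `j`-th and the next holes -/
theorem mem_interval_iff (x y : Finset ℕ) (i j : ℕ) :
    (max (hole x j) (hole y j) ≤ i ∧ i < min (hole x (j + 1)) (hole y (j + 1))) ↔
      hc x i = j + 1 ∧ hc y i = j + 1 := by
  have h1 := hole_le_iff x i j
  have h2 := hole_le_iff y i j
  have h3 := hole_le_iff x i (j + 1)
  have h4 := hole_le_iff y i (j + 1)
  rw [max_le_iff, lt_min_iff, ← not_le, ← not_le, h1, h2, h3, h4]
  omega

/-- The exponents `max (v_i^x - v_i^y) 0` (truncated subtraction). -/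
def cexp (x y : Finset ℕ) (i : ℕ) : ℕ := wt x i - wt y i

/-- The exponents in `f_{x,y} f_{y,z} = U^g f_{x,z}`:
`g_i = (|v_i^y - v_i^z| + |v_i^x - v_i^y| - |v_i^x - v_i^z|) / 2`, which is a natural number
(see `gexp_add`). -/
def gexp (x y z : Finset ℕ) (i : ℕ) : ℕ :=
  (((wt y i : ℤ) - wt z i).natAbs + ((wt x i : ℤ) - wt y i).natAbs
    - ((wt x i : ℤ) - wt z i).natAbs) / 2

theorem gexp_add (x y z : Finset ℕ) (i : ℕ) :
    gexp x y z i + cexp x z i = cexp x y i + cexp y z i := by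
  unfold gexp cexp
  omega

/-- The states are too far: for two consecutive symbols `∨` (there are `n - k` of them), the later one
of one of the sequences is not to the right of the earlier one of the other sequence. -/
def TooFar (n k : ℕ) (x y : Finset ℕ) : Prop :=
  ∃ j, j + 1 < n - k ∧ (hole y (j + 1) ≤ hole x j ∨ hole x (j + 1) ≤ hole y j)

open MvPolynomial in
/-- The product of the variables on the generating interval with index `j`, from the right-hand one of
the two `j`-th holes to the left-hand one of the two next holes. -/
noncomputable def pInt (n : ℕ) (x y : Finset ℕ) (j : ℕ) : Pol n :=
  ∏ i ∈ Finset.univ.filter (fun i : Fin n =>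
    max (hole x j) (hole y j) ≤ (i : ℕ) ∧ (i : ℕ) < min (hole x (j + 1)) (hole y (j + 1))), X i

theorem mon_mul (n : ℕ) (e f : ℕ → ℕ) : mon n e * mon n f = mon n (fun i => e i + f i) := by
  simp [mon, Finset.prod_mul_distrib, pow_add]

theorem mon_dvd_mon {n : ℕ} {e f : ℕ → ℕ} (h : ∀ i < n, e i ≤ f i) : mon n e ∣ mon n f :=
  Finset.prod_dvd_prod_of_dvd _ _ fun i _ => pow_dvd_pow _ (h i i.2)

theorem pInt_eq_mon (n : ℕ) (x y : Finset ℕ) (j : ℕ) :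
    pInt n x y j = mon n (fun i => if hc x i = j + 1 ∧ hc y i = j + 1 then 1 else 0) := by
  unfold pInt mon
  rw [Finset.prod_filter]
  refine Finset.prod_congr rfl fun i _ => ?_
  simp only [mem_interval_iff]
  split_ifs <;> simp

theorem pInt_comm (n : ℕ) (x y : Finset ℕ) (j : ℕ) : pInt n x y j = pInt n y x j := by
  simp only [pInt_eq_mon, and_comm]

/-- closure of generating intervals under composition -/
theorem pInt_dvd_right {k : ℕ} {x y z : Finset ℕ} (hx : x.card = k) (hy : y.card = k)
    (hz : z.card = k) (n j : ℕ) : pInt n x z j ∣ mon n (gexp x y z) * pInt n x y j := by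
  rw [pInt_eq_mon, pInt_eq_mon, mon_mul]
  refine mon_dvd_mon fun i _ => ?_
  have h1 := hc_add x i
  have h2 := hc_add y i
  have h3 := hc_add z i
  unfold gexp
  split_ifs <;> omega

theorem pInt_dvd_left {k : ℕ} {x y z : Finset ℕ} (hx : x.card = k) (hy : y.card = k)
    (hz : z.card = k) (n j : ℕ) : pInt n x z j ∣ mon n (gexp x y z) * pInt n y z j := by
  rw [pInt_eq_mon, pInt_eq_mon, mon_mul]
  refine mon_dvd_mon fun i _ => ?_
  have h1 := hc_add x i
  have h2 := hc_add y i
  have h3 := hc_add z i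
  unfold gexp
  split_ifs <;> omega

theorem TooFar.exists_pInt {n k : ℕ} {x y : Finset ℕ} (h : TooFar n k x y) :
    ∃ j < n - k, pInt n x y j = 1 := by
  obtain ⟨j, hj, h⟩ := h
  refine ⟨j, by omega, ?_⟩
  unfold pInt
  rw [Finset.filter_false_of_mem, Finset.prod_empty]
  intro i _
  have h1 := hole_lt_hole_succ x j
  have h2 := hole_lt_hole_succ y j
  omega

/-! ### Sartori's algebra -/

/-- The left I-states `V_l(n,k)`, that is, the `∧∨`-sequences of length `n` with `k` symbols `∧`. -/
abbrev Vl (n k : ℕ) : Type := {x : Finset ℕ // x ∈ Finset.powersetCard k (Finset.range n)}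

/-- `R_b = R / (h_{b_1}(x_1), h_{b_2}(x_1, x_2), …, h_{b_n}(x_1, …, x_n))`. -/
abbrev Rb (n : ℕ) (x : Finset ℕ) : Type := Pol n ⧸ Ib n (bseq x)

/-- The homomorphism `R_λ → R_μ`, `1 ↦ ∏ x_i ^ max (b_i^μ - b_i^λ) 0`. -/
noncomputable def homMon (n : ℕ) (l m : Finset ℕ) : Rb n l →ₗ[Pol n] Rb n m :=
  Submodule.mapQ _ _ (LinearMap.mulLeft (Pol n) (mon n (cexp m l))) fun p hp => by
    have := mon_mul_mem (bseq_step l) (bseq_step m) hp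
    have h : (fun i => bseq m i - bseq l i) = cexp m l := funext fun i => by simp [bseq, cexp]
    rwa [h] at this

theorem Rb_smul {n : ℕ} {x : Finset ℕ} (p : Pol n) (q : Rb n x) :
    p • q = Ideal.Quotient.mk _ p * q := by
  obtain ⟨q, rfl⟩ := Ideal.Quotient.mk_surjective q
  rfl

theorem homMon_mk (n : ℕ) (l m : Finset ℕ) (p : Pol n) :
    homMon n l m (Ideal.Quotient.mk _ p) = Ideal.Quotient.mk _ (mon n (cexp m l) * p) := rfl

theorem Rb_hom_ext {n : ℕ} {l : Finset ℕ} {M : Type*} [AddCommGroup M] [Module (Pol n) M]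
    {f g : Rb n l →ₗ[Pol n] M} (h : f 1 = g 1) : f = g := by
  refine LinearMap.ext fun q => ?_
  obtain ⟨p, rfl⟩ := Ideal.Quotient.mk_surjective q
  have : (Ideal.Quotient.mk (Ib n (bseq l)) p) = p • (1 : Rb n l) := by
    rw [← map_one (Ideal.Quotient.mk _)]
    change _ = Ideal.Quotient.mk (Ib n (bseq l)) (p * 1)
    rw [mul_one]
  rw [this, map_smul, map_smul, h]

theorem homMon_one (n : ℕ) (l m : Finset ℕ) :
    homMon n l m 1 = Ideal.Quotient.mk _ (mon n (cexp m l)) := by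
  rw [← map_one (Ideal.Quotient.mk _), homMon_mk, mul_one]

theorem exists_smul_homMon {n : ℕ} {l m : Finset ℕ} (f : Rb n l →ₗ[Pol n] Rb n m) :
    ∃ p : Pol n, f = p • homMon n l m := by
  obtain ⟨q, hq⟩ := Ideal.Quotient.mk_surjective (f 1)
  obtain ⟨s, hs⟩ := (colonData_Ib (bseq_step l) (bseq_step m) n).gen q fun h hh => by
    rw [← Ideal.Quotient.eq_zero_iff_mem, map_mul, hq]
    have h1 : h • f 1 = 0 := by
      rw [← map_smul]
      have : h • (1 : Rb n l) = Ideal.Quotient.mk _ h := by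
        rw [← map_one (Ideal.Quotient.mk _)]
        change Ideal.Quotient.mk (Ib n (bseq l)) (h * 1) = _
        rw [mul_one]
      rw [this, Ideal.Quotient.eq_zero_iff_mem.2 hh, map_zero]
    rw [← h1, Rb_smul]
  refine ⟨s, Rb_hom_ext ?_⟩
  rw [LinearMap.smul_apply, homMon_one, ← hq, Rb_smul, ← map_mul, Ideal.Quotient.eq]
  convert hs using 2
  rw [mul_comm]
  congr 2
  funext i
  simp [bseq, cexp]

theorem homMon_comp (n : ℕ) (x y z : Finset ℕ) :
    homMon n y x ∘ₗ homMon n z y = mon n (gexp x y z) • homMon n z x := by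
  refine Rb_hom_ext ?_
  rw [LinearMap.comp_apply, homMon_one, homMon_mk, LinearMap.smul_apply, homMon_one,
    Rb_smul, ← map_mul, mon_mul, mon_mul]
  simp only [gexp_add]

open Classical in
/-- The submodule of illicit morphisms `R_λ → R_μ`: all of them if the sequences are too far, and
otherwise the span of the `1 ↦ (∏ of the generating interval j) * ∏ x_i ^ max (b_i^μ - b_i^λ) 0`. -/
noncomputable def Wα (n k : ℕ) (l m : Finset ℕ) : Submodule (Pol n) (Rb n l →ₗ[Pol n] Rb n m) :=
  if TooFar n k l m then ⊤
  else Submodule.span (Pol n) {f | ∃ j < n - k, f = pInt n l m j • homMon n l m}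

theorem Wα_eq (n k : ℕ) (l m : Finset ℕ) :
    Wα n k l m = Submodule.span (Pol n) {f | ∃ j < n - k, f = pInt n l m j • homMon n l m} := by
  unfold Wα
  split_ifs with h
  · symm
    rw [eq_top_iff]
    rintro f -
    obtain ⟨j, hj, h⟩ := h.exists_pInt
    obtain ⟨p, rfl⟩ := exists_smul_homMon f
    exact Submodule.smul_mem _ _ (Submodule.subset_span ⟨j, hj, by rw [h, one_smul]⟩)
  · rfl

theorem smul_homMon_mem {n k : ℕ} {l m : Finset ℕ} {p : Pol n} {j : ℕ} (hj : j < n - k)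
    (h : pInt n l m j ∣ p) : p • homMon n l m ∈ Wα n k l m := by
  rw [Wα_eq]
  obtain ⟨q, rfl⟩ := h
  rw [mul_comm, mul_smul]
  exact Submodule.smul_mem _ _ (Submodule.subset_span ⟨j, hj, rfl⟩)

theorem Wα_comp_right {n k : ℕ} {x y z : Finset ℕ} (hx : x.card = k) (hy : y.card = k)
    (hz : z.card = k) {f : Rb n z →ₗ[Pol n] Rb n y} (hf : f ∈ Wα n k z y)
    (g : Rb n y →ₗ[Pol n] Rb n x) : g ∘ₗ f ∈ Wα n k z x := by
  obtain ⟨p, rfl⟩ := exists_smul_homMon g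
  rw [Wα_eq] at hf
  induction hf using Submodule.span_induction with
  | mem f hf =>
    obtain ⟨j, hj, rfl⟩ := hf
    rw [LinearMap.comp_smul, LinearMap.smul_comp, homMon_comp, smul_smul, smul_smul]
    refine smul_homMon_mem hj ?_
    rw [pInt_comm n z x, pInt_comm n z y]
    refine (pInt_dvd_left hx hy hz n j).trans ⟨p, by ring⟩
  | zero => rw [LinearMap.comp_zero]; exact zero_mem _
  | add f g _ _ hf hg => rw [LinearMap.comp_add]; exact add_mem hf hg
  | smul r f _ hf => rw [LinearMap.comp_smul]; exact Submodule.smul_mem _ _ hf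

theorem Wα_comp_left {n k : ℕ} {x y z : Finset ℕ} (hx : x.card = k) (hy : y.card = k)
    (hz : z.card = k) {f : Rb n y →ₗ[Pol n] Rb n x} (hf : f ∈ Wα n k y x)
    (g : Rb n z →ₗ[Pol n] Rb n y) : f ∘ₗ g ∈ Wα n k z x := by
  obtain ⟨p, rfl⟩ := exists_smul_homMon g
  rw [Wα_eq] at hf
  induction hf using Submodule.span_induction with
  | mem f hf =>
    obtain ⟨j, hj, rfl⟩ := hf
    rw [LinearMap.comp_smul, LinearMap.smul_comp, homMon_comp, smul_smul, smul_smul]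
    refine smul_homMon_mem hj ?_
    rw [pInt_comm n z x, pInt_comm n y x]
    refine (pInt_dvd_right hx hy hz n j).trans ⟨p, by ring⟩
  | zero => rw [LinearMap.zero_comp]; exact zero_mem _
  | add f g _ _ hf hg => rw [LinearMap.add_comp]; exact add_mem hf hg
  | smul r f _ hf => rw [LinearMap.smul_comp]; exact Submodule.smul_mem _ _ hf

theorem Vl.card {n k : ℕ} (x : Vl n k) : x.1.card = k := (Finset.mem_powersetCard.1 x.2).2

/-- The algebra `⊕ Hom_R(R_λ, R_μ)` over all pairs of sequences, as endomorphism ring of `⊕ R_λ`. -/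
def SoergelEnd (n k : ℕ) : Type :=
  Module.End (Pol n) ((l : Vl n k) → Rb n l.1)

noncomputable instance (n k : ℕ) : Ring (SoergelEnd n k) :=
  inferInstanceAs (Ring (Module.End (Pol n) ((l : Vl n k) → Rb n l.1)))

/-- The component `R_λ → R_μ` of an element of `⊕ Hom(R_λ, R_μ)`. -/
noncomputable def comp {n k : ℕ} (a : SoergelEnd n k) (l m : Vl n k) :
    Rb n l.1 →ₗ[Pol n] Rb n m.1 :=
  LinearMap.proj m ∘ₗ (a : Module.End (Pol n) ((l : Vl n k) → Rb n l.1)) ∘ₗ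
    LinearMap.single (Pol n) (fun l : Vl n k => Rb n l.1) l

theorem comp_mul {n k : ℕ} (a b : SoergelEnd n k) (l m : Vl n k) :
    comp (a * b) l m = ∑ v, comp a v m ∘ₗ comp b l v := by
  have key : ∀ (a b : Module.End (Pol n) ((l : Vl n k) → Rb n l.1)),
      (LinearMap.proj m ∘ₗ (a * b) ∘ₗ LinearMap.single (Pol n) (fun l : Vl n k => Rb n l.1) l :
        Rb n l.1 →ₗ[Pol n] Rb n m.1) = ∑ v, comp a v m ∘ₗ comp b l v := by
    intro a b
    refine LinearMap.ext fun r => ?_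
    simp only [comp, LinearMap.comp_apply, Module.End.mul_apply, LinearMap.sum_apply,
      LinearMap.proj_apply]
    conv_lhs => rw [← Finset.univ_sum_single (b _)]
    rw [map_sum, Finset.sum_apply]
    rfl
  exact key a b

theorem comp_add {n k : ℕ} (a b : SoergelEnd n k) (l m : Vl n k) :
    comp (a + b) l m = comp a l m + comp b l m := by
  refine LinearMap.ext fun r => ?_
  rfl

theorem comp_zero {n k : ℕ} (l m : Vl n k) : comp (0 : SoergelEnd n k) l m = 0 := rfl

/-- The two-sided ideal of the elements with illicit components. -/
noncomputable def illicit (n k : ℕ) : Ideal (SoergelEnd n k) where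
  carrier := {a | ∀ l m : Vl n k, comp a l m ∈ Wα n k l.1 m.1}
  zero_mem' l m := by rw [comp_zero]; exact zero_mem _
  add_mem' {a b} ha hb l m := by rw [comp_add]; exact add_mem (ha l m) (hb l m)
  smul_mem' a b hb l m := by
    rw [smul_eq_mul, comp_mul]
    exact sum_mem fun v _ => Wα_comp_right m.card v.card l.card (hb l v) _

instance (n k : ℕ) : (illicit n k).IsTwoSided where
  mul_mem_of_left {a} b ha l m := by
    rw [comp_mul]
    exact sum_mem fun v _ => Wα_comp_left m.card v.card l.card (ha v m) _

/-- Sartori's algebra over the integers, `⊕ Hom(R_λ, R_μ) / illicit morphisms`. -/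
def SarAlg (n k : ℕ) : Type := SoergelEnd n k ⧸ illicit n k

noncomputable instance (n k : ℕ) : Ring (SarAlg n k) :=
  inferInstanceAs (Ring (SoergelEnd n k ⧸ illicit n k))

/-- The quotient homomorphism. -/
noncomputable def SarAlg.mk (n k : ℕ) : SoergelEnd n k →+* SarAlg n k :=
  Ideal.Quotient.mk (illicit n k)



/-- The element of `⊕ Hom(R_λ, R_μ)` with given components. -/
noncomputable def ofComp {n k : ℕ} (f : (l m : Vl n k) → Rb n l.1 →ₗ[Pol n] Rb n m.1) :
    SoergelEnd n k :=
  (LinearMap.pi fun m => ∑ l, f l m ∘ₗ LinearMap.proj l :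
    ((l : Vl n k) → Rb n l.1) →ₗ[Pol n] ((l : Vl n k) → Rb n l.1))

theorem comp_ofComp {n k : ℕ} (f : (l m : Vl n k) → Rb n l.1 →ₗ[Pol n] Rb n m.1) (l m : Vl n k) :
    comp (ofComp f) l m = f l m := by
  refine LinearMap.ext fun r => ?_
  simp only [comp, ofComp, LinearMap.comp_apply, LinearMap.proj_apply, LinearMap.pi_apply,
    LinearMap.sum_apply]
  rw [Finset.sum_eq_single l]
  · simp
  · intro b _ hb
    simp [hb]
  · simp

theorem SoergelEnd.ext_comp {n k : ℕ} {a b : SoergelEnd n k}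
    (h : ∀ l m, comp a l m = comp b l m) : a = b := by
  refine LinearMap.pi_ext' fun l => LinearMap.ext fun r => funext fun m => ?_
  exact LinearMap.congr_fun (h l m) r

theorem SarAlg.mk_eq_zero {n k : ℕ} {a : SoergelEnd n k} :
    SarAlg.mk n k a = 0 ↔ ∀ l m : Vl n k, comp a l m ∈ Wα n k l.1 m.1 :=
  Ideal.Quotient.eq_zero_iff_mem

/-! ### The algebra of Ozsváth and Szabó -/

/-- The I-states: the `k`-element subsets of `{0, …, n}`. -/
abbrev IState (n k : ℕ) : Type := {x : Finset ℕ // x ∈ Finset.powersetCard k (Finset.range (n + 1))}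

theorem IState.card {n k : ℕ} (x : IState n k) : x.1.card = k := (Finset.mem_powersetCard.1 x.2).2

/-- The algebra without relations: it is free over `ℤ[U_1, …, U_n]` on the arrows `f_{x,y}`, and an
element is given by its coefficients. -/
def B0 (n k : ℕ) : Type := IState n k → IState n k → Pol n

noncomputable instance (n k : ℕ) : AddCommGroup (B0 n k) :=
  inferInstanceAs (AddCommGroup (IState n k → IState n k → Pol n))

noncomputable instance (n k : ℕ) : Mul (B0 n k) where
  mul a b := fun x z => ∑ y : IState n k, mon n (gexp x.1 y.1 z.1) * (a x y * b y z)

noncomputable instance (n k : ℕ) : One (B0 n k) where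
  one := fun x y => if x = y then 1 else 0

theorem B0.mul_apply {n k : ℕ} (a b : B0 n k) (x z : IState n k) :
    (a * b) x z = ∑ y : IState n k, mon n (gexp x.1 y.1 z.1) * (a x y * b y z) := rfl

theorem B0.one_apply {n k : ℕ} (x y : IState n k) : (1 : B0 n k) x y = if x = y then 1 else 0 := rfl

theorem B0.add_apply {n k : ℕ} (a b : B0 n k) (x y : IState n k) :
    (a + b) x y = a x y + b x y := rfl

theorem B0.zero_apply {n k : ℕ} (x y : IState n k) : (0 : B0 n k) x y = 0 := rfl

theorem B0.ext {n k : ℕ} {a b : B0 n k} (h : ∀ x y, a x y = b x y) : a = b :=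
  funext fun x => funext fun y => h x y

theorem gexp_self_left (x y : Finset ℕ) : gexp x x y = fun _ => 0 := by
  funext i; unfold gexp; omega

theorem gexp_self_right (x y : Finset ℕ) : gexp x y y = fun _ => 0 := by
  funext i; unfold gexp; omega

theorem gexp_assoc (x y z w : Finset ℕ) (i : ℕ) :
    gexp x z w i + gexp x y z i = gexp x y w i + gexp y z w i := by
  unfold gexp; omega

theorem mon_zero (n : ℕ) : mon n (fun _ => 0) = 1 := by simp [mon]

noncomputable instance (n k : ℕ) : Ring (B0 n k) where
  __ := (inferInstance : AddCommGroup (B0 n k))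
  left_distrib a b c := B0.ext fun x z => by
    simp only [B0.mul_apply, B0.add_apply, mul_add, Finset.sum_add_distrib]
  right_distrib a b c := B0.ext fun x z => by
    simp only [B0.mul_apply, B0.add_apply, mul_add, add_mul, Finset.sum_add_distrib]
  zero_mul a := B0.ext fun x z => by simp [B0.mul_apply, B0.zero_apply]
  mul_zero a := B0.ext fun x z => by simp [B0.mul_apply, B0.zero_apply]
  mul_assoc a b c := B0.ext fun x w => by
    simp only [B0.mul_apply, Finset.mul_sum, Finset.sum_mul]
    rw [Finset.sum_comm]
    refine Finset.sum_congr rfl fun y _ => Finset.sum_congr rfl fun z _ => ?_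
    have h1 : mon n (gexp x.1 z.1 w.1) * mon n (gexp x.1 y.1 z.1) =
        mon n (gexp x.1 y.1 w.1) * mon n (gexp y.1 z.1 w.1) := by
      rw [mon_mul, mon_mul]; simp only [gexp_assoc]
    linear_combination (a x y * b y z * c z w) * h1
  one_mul a := B0.ext fun x z => by
    simp [B0.mul_apply, B0.one_apply, gexp_self_left, mon_zero]
  mul_one a := B0.ext fun x z => by
    simp [B0.mul_apply, B0.one_apply, gexp_self_right, mon_zero]

/-- The element `p f_{x,y}`. -/
noncomputable def B0.E {n k : ℕ} (x y : IState n k) (p : Pol n) : B0 n k :=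
  fun x' y' => if x' = x ∧ y' = y then p else 0

open Classical in
/-- The sum of the idempotents `I_x = f_{x,x}` of the states `x` satisfying `P`. -/
noncomputable def B0.diag {n k : ℕ} (P : Finset ℕ → Prop) : B0 n k :=
  fun x y => if x = y ∧ P x.1 then 1 else 0

/-- The sum of the `f_{x, x \ {s} ∪ {t}}` over the states `x` with `s ∈ x` and `t ∉ x`. Thus `R_{i+1}` is
`move i (i + 1)`, and `L_{i+1}` is `move (i + 1) i`. -/
noncomputable def B0.move {n k : ℕ} (s t : ℕ) : B0 n k :=
  fun x y => if s ∈ x.1 ∧ t ∉ x.1 ∧ y.1 = insert t (x.1.erase s) then 1 else 0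

/-- The relations `R_{i+1} R_{i+2} = 0`, `L_{i+2} L_{i+1} = 0`, and `U_{i+1} I_x = 0` if `x` contains
neither of the two positions next to the line. -/
def bordRel (n k : ℕ) : Set (B0 n k) :=
  {r | ∃ i : ℕ, i + 1 < n ∧ (r = B0.move i (i + 1) * B0.move (i + 1) (i + 2) ∨
      r = B0.move (i + 2) (i + 1) * B0.move (i + 1) i)} ∪
  {r | ∃ (i : Fin n) (x : IState n k), (i : ℕ) ∉ x.1 ∧ (i : ℕ) + 1 ∉ x.1 ∧
      r = B0.E x x (MvPolynomial.X i)}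

/-- The two-sided ideal generated by the relations. -/
noncomputable def bordIdeal (n k : ℕ) : Ideal (B0 n k) := (TwoSidedIdeal.span (bordRel n k)).asIdeal

instance (n k : ℕ) : (bordIdeal n k).IsTwoSided := by unfold bordIdeal; infer_instance

/-- The algebra `B(n,k)` of Ozsváth and Szabó. -/
def BAlg (n k : ℕ) : Type := B0 n k ⧸ bordIdeal n k

noncomputable instance (n k : ℕ) : Ring (BAlg n k) :=
  inferInstanceAs (Ring (B0 n k ⧸ bordIdeal n k))

/-- The quotient homomorphism. -/
noncomputable def BAlg.mk (n k : ℕ) : B0 n k →+* BAlg n k := Ideal.Quotient.mk (bordIdeal n k)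

theorem BAlg.mk_surjective (n k : ℕ) : Function.Surjective (BAlg.mk n k) :=
  Ideal.Quotient.mk_surjective

theorem BAlg.mk_eq_zero {n k : ℕ} {a : B0 n k} : BAlg.mk n k a = 0 ↔ a ∈ bordIdeal n k :=
  Ideal.Quotient.eq_zero_iff_mem

theorem mem_bordIdeal_of_rel {n k : ℕ} {a : B0 n k} (h : a ∈ bordRel n k) : a ∈ bordIdeal n k :=
  TwoSidedIdeal.subset_span h

/-- an additive function killing the multiples of the relations descends -/
theorem le_of_rel {n k : ℕ} (K : TwoSidedIdeal (B0 n k)) (h : bordRel n k ⊆ K) {a : B0 n k}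
    (ha : a ∈ bordIdeal n k) : a ∈ K := TwoSidedIdeal.span_le.2 h ha

theorem B0.diag_mul {n k : ℕ} (P : Finset ℕ → Prop) (a : B0 n k) (x y : IState n k)
    [Decidable (P x.1)] : (B0.diag P * a : B0 n k) x y = if P x.1 then a x y else 0 := by
  rw [B0.mul_apply, Finset.sum_eq_single x]
  · simp [B0.diag, gexp_self_left, mon_zero]
  · intro b _ hb
    simp [B0.diag, hb.symm]
  · simp

theorem B0.mul_diag {n k : ℕ} (P : Finset ℕ → Prop) (a : B0 n k) (x y : IState n k)
    [Decidable (P y.1)] : (a * B0.diag P : B0 n k) x y = if P y.1 then a x y else 0 := by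
  rw [B0.mul_apply, Finset.sum_eq_single y]
  · simp [B0.diag, gexp_self_right, mon_zero]
  · intro b _ hb
    simp [B0.diag, hb]
  · simp

theorem B0.diag_idem {n k : ℕ} (P : Finset ℕ → Prop) :
    B0.diag P * B0.diag P = (B0.diag P : B0 n k) := by
  classical
  refine B0.ext fun x y => ?_
  rw [B0.diag_mul]
  by_cases h : P x.1 <;> simp [B0.diag, h]

/-- `∑_{n ∉ x} I_x` -/
noncomputable def leftIdem (n k : ℕ) : BAlg n k := BAlg.mk n k (B0.diag fun x => n ∉ x)

theorem leftIdem_idem (n k : ℕ) : IsIdempotentElem (leftIdem n k) := by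
  unfold IsIdempotentElem leftIdem
  rw [← map_mul, B0.diag_idem]

/-- The algebra `B_l(n,k) = e B(n,k) e`, where `e` is the sum of the `I_x` with `n ∉ x`. -/
def Bl (n k : ℕ) : Type := (leftIdem_idem n k).Corner

noncomputable instance (n k : ℕ) : Ring (Bl n k) :=
  inferInstanceAs (Ring (leftIdem_idem n k).Corner)

/-- The inclusion of `B_l(n,k)` into `B(n,k)`. -/
def Bl.val {n k : ℕ} (b : Bl n k) : BAlg n k := Subtype.val b

theorem Bl.val_mul {n k : ℕ} (a b : Bl n k) : (a * b).val = a.val * b.val := rfl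
theorem Bl.val_add {n k : ℕ} (a b : Bl n k) : (a + b).val = a.val + b.val := rfl
theorem Bl.val_zero {n k : ℕ} : (0 : Bl n k).val = 0 := rfl
theorem Bl.val_one {n k : ℕ} : (1 : Bl n k).val = leftIdem n k := rfl
theorem Bl.val_injective {n k : ℕ} : Function.Injective (Bl.val (n := n) (k := k)) :=
  Subtype.val_injective
theorem Bl.left_mul_val {n k : ℕ} (a : Bl n k) : leftIdem n k * a.val = a.val :=
  congrArg Bl.val (one_mul a)
theorem Bl.val_mul_left {n k : ℕ} (a : Bl n k) : a.val * leftIdem n k = a.val :=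
  congrArg Bl.val (mul_one a)

/-- The element `e b e`. -/
noncomputable def Bl.of {n k : ℕ} (b : BAlg n k) : Bl n k := ⟨leftIdem n k * b * leftIdem n k, b, rfl⟩

theorem Bl.val_of {n k : ℕ} (b : BAlg n k) : (Bl.of b).val = leftIdem n k * b * leftIdem n k := rfl

/-! ### The homomorphism to Sartori's algebra -/

theorem hc_mono (x : Finset ℕ) {i j : ℕ} (h : i ≤ j) : hc x i ≤ hc x j :=
  Nat.count_monotone _ (by omega)

theorem hc_succ (x : Finset ℕ) (i : ℕ) : hc x (i + 1) = hc x i + if i + 1 ∉ x then 1 else 0 :=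
  Nat.count_succ _ _

theorem wt_insert_erase {x : Finset ℕ} {s t : ℕ} (hs : s ∈ x) (ht : t ∉ x) (i : ℕ) :
    wt (insert t (x.erase s)) i + (if i < s then 1 else 0) =
      wt x i + (if i < t then 1 else 0) := by
  unfold wt
  have hx : x = insert s (x.erase s) := (Finset.insert_erase hs).symm
  have hs' : s ∉ x.erase s := Finset.notMem_erase s x
  have ht' : t ∉ x.erase s := fun h => ht (Finset.mem_of_mem_erase h)
  generalize x.erase s = y at *
  subst hx
  rw [Finset.filter_insert, Finset.filter_insert]
  split_ifs <;> simp [Finset.card_insert_of_notMem, hs', ht']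

theorem card_insert_erase {x : Finset ℕ} {s t : ℕ} (hs : s ∈ x) (ht : t ∉ x) :
    (insert t (x.erase s)).card = x.card := by
  rw [Finset.card_insert_of_notMem (fun h => ht (Finset.mem_of_mem_erase h)),
    Finset.card_erase_add_one hs]

theorem IState.hc_last {n k : ℕ} (x : IState n k) : hc x.1 n + k = n + 1 := by
  have h := hc_add x.1 n
  rw [x.card] at h
  have : wt x.1 n = 0 := by
    unfold wt
    rw [Finset.card_eq_zero, Finset.filter_eq_empty_iff]
    intro a ha
    have := Finset.mem_range.1 ((Finset.mem_powersetCard.1 x.2).1 ha)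
    omega
  omega

/-- the ideal of the generating intervals between `x` and `y` -/
noncomputable def intIdeal (n k : ℕ) (x y : Finset ℕ) : Ideal (Pol n) :=
  Ideal.span {p | ∃ j < n - k, p = pInt n x y j}

theorem pInt_mem_intIdeal {n k : ℕ} {x y : Finset ℕ} {j : ℕ} (hj : j < n - k) :
    pInt n x y j ∈ intIdeal n k x y := Ideal.subset_span ⟨j, hj, rfl⟩

theorem mul_mem_intIdeal {n k : ℕ} {x y x' y' : Finset ℕ} {c p : Pol n}
    (h : ∀ j, pInt n x' y' j ∣ c * pInt n x y j) (hp : p ∈ intIdeal n k x y) :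
    c * p ∈ intIdeal n k x' y' := by
  have : intIdeal n k x y ≤ Submodule.comap (LinearMap.mulLeft (Pol n) c) (intIdeal n k x' y') := by
    refine Ideal.span_le.2 ?_
    rintro p ⟨j, hj, rfl⟩
    exact Ideal.mem_of_dvd (intIdeal n k x' y') (h j) (pInt_mem_intIdeal hj)
  exact this hp

theorem B0.neg_apply {n k : ℕ} (a : B0 n k) (x y : IState n k) : (-a) x y = -(a x y) := rfl

/-- The elements whose coefficients are divisible into generating intervals; they form an ideal that
contains the relations. -/
def illicitSet (n k : ℕ) : Set (B0 n k) := {a | ∀ x y, a x y ∈ intIdeal n k x.1 y.1}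

theorem illicitSet_mul_left {n k : ℕ} (a : B0 n k) {b : B0 n k} (hb : b ∈ illicitSet n k) :
    a * b ∈ illicitSet n k := by
  intro x z
  rw [B0.mul_apply]
  refine sum_mem fun y _ => ?_
  rw [mul_left_comm]
  exact Ideal.mul_mem_left _ _
    (mul_mem_intIdeal (fun j => pInt_dvd_left x.card y.card z.card n j) (hb y z))

theorem illicitSet_mul_right {n k : ℕ} {a : B0 n k} (b : B0 n k) (ha : a ∈ illicitSet n k) :
    a * b ∈ illicitSet n k := by
  intro x z
  rw [B0.mul_apply]
  refine sum_mem fun y _ => ?_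
  rw [← mul_assoc]
  exact Ideal.mul_mem_right _ _
    (mul_mem_intIdeal (fun j => pInt_dvd_right x.card y.card z.card n j) (ha x y))

theorem illicitSet_zero (n k : ℕ) : (0 : B0 n k) ∈ illicitSet n k := fun x y => by
  rw [B0.zero_apply]; exact zero_mem _

theorem illicitSet_add {n k : ℕ} {a b : B0 n k} (ha : a ∈ illicitSet n k)
    (hb : b ∈ illicitSet n k) : a + b ∈ illicitSet n k := fun x y => by
  rw [B0.add_apply]; exact add_mem (ha x y) (hb x y)

theorem illicitSet_neg {n k : ℕ} {a : B0 n k} (ha : a ∈ illicitSet n k) :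
    -a ∈ illicitSet n k := fun x y => by
  rw [B0.neg_apply]; exact neg_mem (ha x y)

/-- The ideal formed by `illicitSet`. -/
noncomputable def illicitB (n k : ℕ) : TwoSidedIdeal (B0 n k) :=
  TwoSidedIdeal.mk' (illicitSet n k) (illicitSet_zero n k) illicitSet_add illicitSet_neg
    (illicitSet_mul_left _) (illicitSet_mul_right _)

theorem mem_illicitB {n k : ℕ} {a : B0 n k} : a ∈ illicitB n k ↔
    ∀ x y, a x y ∈ intIdeal n k x.1 y.1 := by
  unfold illicitB
  rw [TwoSidedIdeal.mem_mk']
  exact Iff.rfl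

theorem pInt_eq_one {n : ℕ} {x y : Finset ℕ} {j : ℕ}
    (h : ∀ i, hc x i = j + 1 → hc y i = j + 1 → False) : pInt n x y j = 1 := by
  rw [pInt_eq_mon]
  have : (fun i => if hc x i = j + 1 ∧ hc y i = j + 1 then 1 else 0) = fun _ => 0 :=
    funext fun i => if_neg fun ⟨h1, h2⟩ => h i h1 h2
  rw [this, mon_zero]

theorem mem_of_pInt_eq_one {n k : ℕ} {x y : Finset ℕ} {j : ℕ} (hj : j < n - k)
    (h : pInt n x y j = 1) (p : Pol n) : p ∈ intIdeal n k x y :=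
  Ideal.mem_of_dvd _ (h ▸ one_dvd p) (pInt_mem_intIdeal hj)

theorem move_mul_move {n k : ℕ} (s t u v : ℕ) (x z : IState n k)
    (h : (B0.move s t * B0.move u v : B0 n k) x z ≠ 0) :
    ∃ y : IState n k, s ∈ x.1 ∧ t ∉ x.1 ∧ y.1 = insert t (x.1.erase s) ∧
      u ∈ y.1 ∧ v ∉ y.1 ∧ z.1 = insert v (y.1.erase u) := by
  rw [B0.mul_apply] at h
  obtain ⟨y, _, hy⟩ := Finset.exists_ne_zero_of_sum_ne_zero h
  refine ⟨y, ?_⟩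
  unfold B0.move at hy
  by_contra hc
  apply hy
  split_ifs with h1 h2
  · exact absurd ⟨h1.1, h1.2.1, h1.2.2, h2⟩ hc
  all_goals simp

theorem hc_le_last {n k i : ℕ} (x : IState n k) (h : i ≤ n) : hc x.1 i + k ≤ n + 1 := by
  have := hc_mono x.1 h
  have := x.hc_last
  omega

theorem bordRel_le_illicitB (n k : ℕ) : bordRel n k ⊆ illicitB n k := by
  rintro a (⟨i, hi, rfl | rfl⟩ | ⟨i, x, h1, h2, rfl⟩)
  · refine mem_illicitB.2 fun x z => ?_
    by_cases h : (B0.move i (i + 1) * B0.move (i + 1) (i + 2) : B0 n k) x z = 0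
    · rw [h]; exact zero_mem _
    obtain ⟨y, h1, h2, h3, h4, h5, h6⟩ := move_mul_move _ _ _ _ x z h
    have hw := wt_insert_erase h1 h2
    rw [← h3] at hw
    have hw' := wt_insert_erase h4 h5
    rw [← h6] at hw'
    have h7 : i + 2 ∉ x.1 := by
      intro h7
      apply h5
      rw [h3]
      exact Finset.mem_insert_of_mem (Finset.mem_erase.2 ⟨by omega, h7⟩)
    have e1 := hc_succ x.1 i
    have e2 := hc_succ x.1 (i + 1)
    rw [if_pos h2] at e1
    rw [if_pos h7] at e2
    have e3 := hc_le_last x (show i + 1 + 1 ≤ n by omega)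
    refine mem_of_pInt_eq_one (j := hc x.1 i) (by omega) (pInt_eq_one ?_) _
    intro l g1 g2
    have l1 : i < l := by
      by_contra h
      have := hc_mono x.1 (show l ≤ i by omega)
      omega
    have l2 : l < i + 1 + 1 := by
      by_contra h
      have := hc_mono x.1 (show i + 1 + 1 ≤ l by omega)
      omega
    obtain rfl : l = i + 1 := by omega
    have a1 := hw (i + 1)
    have a2 := hw' (i + 1)
    have a3 := hc_add x.1 (i + 1)
    have a4 := hc_add z.1 (i + 1)
    rw [x.card] at a3
    rw [z.card] at a4
    split_ifs at a1 a2 <;> omega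
  · refine mem_illicitB.2 fun x z => ?_
    by_cases h : (B0.move (i + 2) (i + 1) * B0.move (i + 1) i : B0 n k) x z = 0
    · rw [h]; exact zero_mem _
    obtain ⟨y, h1, h2, h3, h4, h5, h6⟩ := move_mul_move _ _ _ _ x z h
    have hw := wt_insert_erase h1 h2
    rw [← h3] at hw
    have hw' := wt_insert_erase h4 h5
    rw [← h6] at hw'
    have h7 : i ∉ x.1 := by
      intro h7
      apply h5
      rw [h3]
      exact Finset.mem_insert_of_mem (Finset.mem_erase.2 ⟨by omega, h7⟩)
    have e1 := hc_succ x.1 i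
    rw [if_pos h2] at e1
    have e3 := hc_le_last x (show i + 1 ≤ n by omega)
    have a1 := hw i
    have a2 := hw' i
    have a3 := hc_add x.1 i
    have a4 := hc_add z.1 i
    rw [x.card] at a3
    rw [z.card] at a4
    have e4 : hc x.1 i = hc z.1 i + 1 := by split_ifs at a1 a2 <;> omega
    have e5 : ∀ l < i, hc x.1 l < hc x.1 i := by
      intro l hl
      have := hc_mono x.1 (show l ≤ i - 1 by omega)
      have := hc_succ x.1 (i - 1)
      rw [show i - 1 + 1 = i by omega, if_pos h7] at this
      omega
    refine mem_of_pInt_eq_one (j := hc z.1 i) (by omega) (pInt_eq_one ?_) _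
    intro l g1 g2
    have l1 : i ≤ l := by
      by_contra h
      have := e5 l (by omega)
      omega
    have l2 : l < i + 1 := by
      by_contra h
      have := hc_mono x.1 (show i + 1 ≤ l by omega)
      omega
    obtain rfl : l = i := by omega
    omega
  · refine mem_illicitB.2 fun x' y' => ?_
    unfold B0.E
    split_ifs with h
    swap
    · exact zero_mem _
    obtain ⟨h3, h4⟩ := h
    subst h4
    obtain rfl := h3
    have e1 := hc_succ x'.1 i
    rw [if_pos h2] at e1
    have e3 := hc_le_last x' (show (i : ℕ) + 1 ≤ n from i.2)
    have e5 : ∀ l < (i : ℕ), hc x'.1 l < hc x'.1 i := by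
      intro l hl
      have := hc_mono x'.1 (show l ≤ i - 1 by omega)
      have := hc_succ x'.1 (i - 1)
      rw [show (i : ℕ) - 1 + 1 = i by omega, if_pos h1] at this
      omega
    have e6 : 0 < hc x'.1 i := by
      unfold hc
      rw [Nat.count_succ, if_pos h1]
      omega
    have e7 : pInt n x'.1 x'.1 (hc x'.1 i - 1) ∣ X i := by
      have : (X i : Pol n) = mon n (fun j => if j = i then 1 else 0) := by
        unfold mon
        rw [Finset.prod_eq_single i]
        · simp
        · intro b _ hb
          beta_reduce
          rw [if_neg (fun h => hb (Fin.ext h)), pow_zero]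
        · simp
      rw [this, pInt_eq_mon]
      refine mon_dvd_mon fun j _ => ?_
      split_ifs with g1 g2 <;> try omega
      exfalso
      rcases Nat.lt_or_gt_of_ne g2 with g | g
      · have := e5 j g; omega
      · have := hc_mono x'.1 (show (i : ℕ) + 1 ≤ j from g); omega
    exact Ideal.mem_of_dvd _ e7 (pInt_mem_intIdeal (by omega))

theorem Vl.mem_istate {n k : ℕ} (l : Vl n k) :
    l.1 ∈ Finset.powersetCard k (Finset.range (n + 1)) :=
  Finset.powersetCard_mono (Finset.range_mono (Nat.le_succ n)) l.2

/-- A left I-state as an I-state. -/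
def Vl.incl {n k : ℕ} (l : Vl n k) : IState n k := ⟨l.1, l.mem_istate⟩

theorem Vl.incl_injective {n k : ℕ} : Function.Injective (Vl.incl (n := n) (k := k)) :=
  fun _ _ h => Subtype.ext (congrArg (fun z : IState n k => z.1) h)

theorem Vl.range_incl {n k : ℕ} (x : IState n k) : (∃ l : Vl n k, l.incl = x) ↔ n ∉ x.1 := by
  have hx := Finset.mem_powersetCard.1 x.2
  constructor
  · rintro ⟨l, rfl⟩ h
    exact absurd (Finset.mem_range.1 ((Finset.mem_powersetCard.1 l.2).1 h)) (lt_irrefl _)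
  · intro h
    refine ⟨⟨x.1, Finset.mem_powersetCard.2 ⟨fun a ha => ?_, hx.2⟩⟩, rfl⟩
    have h1 := Finset.mem_range.1 (hx.1 ha)
    have h2 : a ≠ n := fun h' => h (h' ▸ ha)
    exact Finset.mem_range.2 (by omega)

/-- sums over the states without `n` -/
theorem sum_incl {n k : ℕ} {M : Type*} [AddCommMonoid M] (f : IState n k → M)
    (h : ∀ x : IState n k, n ∈ x.1 → f x = 0) : ∑ l : Vl n k, f l.incl = ∑ x, f x := by
  refine Fintype.sum_of_injective Vl.incl Vl.incl_injective _ _ (fun x hx => ?_) fun l => rfl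
  by_contra h'
  refine hx ((Vl.range_incl x).2 fun h'' => h' (h x h''))

/-- Additive maps out of the quotient. -/
noncomputable def BAlg.lift {n k : ℕ} {S : Type*} [AddCommGroup S] (f : B0 n k →+ S)
    (h0 : ∀ a ∈ bordIdeal n k, f a = 0) : BAlg n k →+ S :=
  (BAlg.mk n k).toAddMonoidHom.liftOfSurjective (BAlg.mk_surjective n k)
    ⟨f, fun a ha => h0 a (BAlg.mk_eq_zero.1 ha)⟩

theorem BAlg.lift_mk {n k : ℕ} {S : Type*} [AddCommGroup S] (f : B0 n k →+ S)
    (h0 : ∀ a ∈ bordIdeal n k, f a = 0) (a : B0 n k) : BAlg.lift f h0 (BAlg.mk n k a) = f a :=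
  (BAlg.mk n k).toAddMonoidHom.liftOfRightInverse_comp_apply _
    (Function.rightInverse_surjInv (BAlg.mk_surjective n k))
    ⟨f, fun a ha => h0 a (BAlg.mk_eq_zero.1 ha)⟩ a

/-- maps out of the corner -/
noncomputable def Bl.lift {n k : ℕ} {S : Type*} [Ring S] (f : B0 n k →+ S)
    (h0 : ∀ a ∈ bordIdeal n k, f a = 0)
    (hmul : ∀ a b, f (a * B0.diag (fun x => n ∉ x) * b) = f a * f b) : Bl n k →ₙ+* S where
  toFun b := BAlg.lift f h0 b.val
  map_mul' a b := by
    obtain ⟨a', ha⟩ := BAlg.mk_surjective n k a.val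
    obtain ⟨b', hb⟩ := BAlg.mk_surjective n k b.val
    have h1 : (a * b).val = BAlg.mk n k (a' * B0.diag (fun x => n ∉ x) * b') := by
      rw [map_mul, map_mul, ha, hb]
      change _ = a.val * leftIdem n k * b.val
      rw [Bl.val_mul_left, Bl.val_mul]
    rw [h1, ← ha, ← hb, BAlg.lift_mk, BAlg.lift_mk, BAlg.lift_mk, hmul]
  map_zero' := by rw [Bl.val_zero, map_zero]
  map_add' a b := by rw [Bl.val_add, map_add]

theorem Bl.lift_apply {n k : ℕ} {S : Type*} [Ring S] (f : B0 n k →+ S)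
    (h0 : ∀ a ∈ bordIdeal n k, f a = 0)
    (hmul : ∀ a b, f (a * B0.diag (fun x => n ∉ x) * b) = f a * f b) (b : Bl n k) (a : B0 n k)
    (h : b.val = BAlg.mk n k a) : Bl.lift f h0 hmul b = f a := by
  change BAlg.lift f h0 b.val = f a
  rw [h, BAlg.lift_mk]

/-- The element with components `a_{μ,λ} • (1 ↦ ∏ x_i ^ max (v_i^μ - v_i^λ) 0) : R_λ → R_μ`. -/
noncomputable def xiMat {n k : ℕ} (a : B0 n k) : SoergelEnd n k :=
  ofComp fun l m => a m.incl l.incl • homMon n l.1 m.1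

theorem comp_xiMat {n k : ℕ} (a : B0 n k) (l m : Vl n k) :
    comp (xiMat a) l m = a m.incl l.incl • homMon n l.1 m.1 := comp_ofComp _ l m

/-- The `ℤ[U_1, …, U_n]`-linear map that sends `f_{x,y}` to
`1 ↦ ∏ x_i ^ max (v_i^x - v_i^y) 0 : R_y → R_x`, before passing to the quotient. -/
noncomputable def xi0 (n k : ℕ) : B0 n k →+ SarAlg n k where
  toFun a := SarAlg.mk n k (xiMat a)
  map_zero' := by
    rw [SarAlg.mk_eq_zero]
    intro l m
    rw [comp_xiMat, B0.zero_apply, zero_smul]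
    exact zero_mem _
  map_add' a b := by
    rw [← map_add]
    congr 1
    refine SoergelEnd.ext_comp fun l m => ?_
    rw [comp_add, comp_xiMat, comp_xiMat, comp_xiMat, B0.add_apply, add_smul]

theorem xi0_apply {n k : ℕ} (a : B0 n k) : xi0 n k a = SarAlg.mk n k (xiMat a) := rfl

theorem B0.mul_diag_mul {n k : ℕ} (P : Finset ℕ → Prop) (a b : B0 n k) (x z : IState n k)
    [DecidablePred P] : (a * B0.diag P * b : B0 n k) x z =
      ∑ y : IState n k, if P y.1 then mon n (gexp x.1 y.1 z.1) * (a x y * b y z) else 0 := by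
  rw [B0.mul_apply]
  refine Finset.sum_congr rfl fun y _ => ?_
  rw [B0.mul_diag]
  split_ifs
  · rfl
  · rw [zero_mul, mul_zero]

theorem comp_xi0_mul {n k : ℕ} (a b : B0 n k) (l m v : Vl n k) :
    comp (xiMat a) v m ∘ₗ comp (xiMat b) l v =
      (mon n (gexp m.1 v.1 l.1) * (a m.incl v.incl * b v.incl l.incl)) • homMon n l.1 m.1 := by
  rw [comp_xiMat, comp_xiMat, LinearMap.comp_smul, LinearMap.smul_comp, homMon_comp, smul_smul,
    smul_smul]
  congr 1
  ring

theorem Vl.not_mem_incl {n k : ℕ} (v : Vl n k) : n ∉ v.incl.1 := (Vl.range_incl _).1 ⟨v, rfl⟩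

theorem xiMat_mul {n k : ℕ} (a b : B0 n k) :
    xiMat (a * B0.diag (fun x => n ∉ x) * b) = xiMat a * xiMat b := by
  refine SoergelEnd.ext_comp fun l m => ?_
  rw [comp_mul, comp_xiMat, Finset.sum_congr rfl fun v _ => comp_xi0_mul a b l m v,
    ← Finset.sum_smul, B0.mul_diag_mul, ← sum_incl _ fun x hx => if_neg (not_not.2 hx)]
  congr 1
  exact Finset.sum_congr rfl fun v _ => if_pos v.not_mem_incl

theorem xi0_mul (n k : ℕ) (a b : B0 n k) :
    xi0 n k (a * B0.diag (fun x => n ∉ x) * b) = xi0 n k a * xi0 n k b := by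
  rw [xi0_apply, xi0_apply, xi0_apply, xiMat_mul, map_mul]

theorem xi0_eq_zero (n k : ℕ) (a : B0 n k) (h : a ∈ bordIdeal n k) : xi0 n k a = 0 := by
  have h1 := mem_illicitB.1 (le_of_rel _ (bordRel_le_illicitB n k) h)
  rw [xi0_apply]
  refine SarAlg.mk_eq_zero.2 fun l m => ?_
  rw [comp_xiMat]
  have h2 := h1 m.incl l.incl
  generalize a m.incl l.incl = p at h2
  change p ∈ Submodule.span _ _ at h2
  induction h2 using Submodule.span_induction with
  | mem p hp =>
    obtain ⟨j, hj, rfl⟩ := hp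
    exact smul_homMon_mem hj (by rw [pInt_comm]; exact dvd_rfl)
  | zero => rw [zero_smul]; exact zero_mem _
  | add p q _ _ hp hq => rw [add_smul]; exact add_mem hp hq
  | smul r p _ hp => rw [smul_eq_mul, mul_smul]; exact Submodule.smul_mem _ _ hp

theorem homMon_self (n : ℕ) (l : Finset ℕ) : homMon n l l = LinearMap.id := by
  refine Rb_hom_ext ?_
  rw [homMon_one, show cexp l l = fun _ => 0 from funext fun i => by simp [cexp], mon_zero]
  rfl

theorem comp_one {n k : ℕ} (l m : Vl n k) :
    comp (1 : SoergelEnd n k) l m = if h : l = m then h ▸ LinearMap.id else 0 := by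
  split_ifs with h
  · subst h
    refine LinearMap.ext fun r => ?_
    change (Pi.single l r : (l : Vl n k) → Rb n l.1) l = r
    simp
  · refine LinearMap.ext fun r => ?_
    change (Pi.single l r : (l : Vl n k) → Rb n l.1) m = 0
    simp [Ne.symm h]

theorem xi0_one (n k : ℕ) : xi0 n k (B0.diag fun x => n ∉ x) = 1 := by
  rw [xi0_apply, ← map_one (SarAlg.mk n k)]
  congr 1
  refine SoergelEnd.ext_comp fun l m => ?_
  rw [comp_xiMat, comp_one]
  unfold B0.diag
  split_ifs with h1 h2 h2
  · subst h2
    rw [one_smul, homMon_self]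
  · exact absurd (Vl.incl_injective h1.1).symm h2
  · exact absurd ⟨by rw [h2], (Vl.range_incl _).1 ⟨m, rfl⟩⟩ h1
  · rw [zero_smul]

/-- The homomorphism `Ξ : B_l(n,k) → A_{n,k}`, `U_i ↦ x_i`, which sends `f_{x,y}` to the class of
`1 ↦ ∏ x_i ^ max (v_i^x - v_i^y) 0 : R_y → R_x` (see `Xi_apply`). -/
noncomputable def Xi (n k : ℕ) : Bl n k →+* SarAlg n k where
  __ := Bl.lift (xi0 n k) (xi0_eq_zero n k) (xi0_mul n k)
  map_one' := by
    change Bl.lift (xi0 n k) (xi0_eq_zero n k) (xi0_mul n k) 1 = 1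
    rw [Bl.lift_apply _ _ _ 1 (B0.diag fun x => n ∉ x) Bl.val_one, xi0_one]

theorem Xi_apply {n k : ℕ} (b : Bl n k) (a : B0 n k) (h : b.val = BAlg.mk n k a) :
    Xi n k b = SarAlg.mk n k (xiMat a) :=
  Bl.lift_apply (xi0 n k) (xi0_eq_zero n k) (xi0_mul n k) b a h

/-! ### Adding the element 0 -/

/-- the states of `IState n k` that do not contain `0` -/
abbrev NoZero (n k : ℕ) : Type := {x : IState n k // 0 ∉ x.1}

/-- The state `x ∪ {0}`. -/
def NoZero.ins {n k : ℕ} (x : NoZero n k) : IState n (k + 1) :=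
  ⟨insert 0 x.1.1, by
    have h := Finset.mem_powersetCard.1 x.1.2
    refine Finset.mem_powersetCard.2 ⟨Finset.insert_subset (by simp) h.1, ?_⟩
    rw [Finset.card_insert_of_notMem x.2, h.2]⟩

theorem NoZero.ins_injective {n k : ℕ} : Function.Injective (NoZero.ins (n := n) (k := k)) := by
  intro x y h
  have h1 : insert 0 x.1.1 = insert 0 y.1.1 := congrArg (fun z : IState n (k + 1) => z.1) h
  apply Subtype.ext
  apply Subtype.ext
  rw [← Finset.erase_insert x.2, h1, Finset.erase_insert y.2]

theorem NoZero.zero_mem_ins {n k : ℕ} (x : NoZero n k) : 0 ∈ x.ins.1 := Finset.mem_insert_self _ _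

theorem NoZero.exists_ins {n k : ℕ} (y : IState n (k + 1)) (h : 0 ∈ y.1) :
    ∃ x : NoZero n k, x.ins = y := by
  have hy := Finset.mem_powersetCard.1 y.2
  refine ⟨⟨⟨y.1.erase 0, Finset.mem_powersetCard.2
    ⟨(Finset.erase_subset _ _).trans hy.1, ?_⟩⟩, Finset.notMem_erase _ _⟩, ?_⟩
  · rw [Finset.card_erase_of_mem h, hy.2]; rfl
  · exact Subtype.ext (Finset.insert_erase h)

theorem wt_insert_zero (x : Finset ℕ) (i : ℕ) : wt (insert 0 x) i = wt x i := by
  unfold wt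
  rw [Finset.filter_insert, if_neg (by omega)]

theorem gexp_insert_zero (x y z : Finset ℕ) :
    gexp (insert 0 x) (insert 0 y) (insert 0 z) = gexp x y z := by
  funext i
  unfold gexp
  rw [wt_insert_zero, wt_insert_zero, wt_insert_zero]

/-- The map that sends `f_{x,y}` to `f_{x \ {0}, y \ {0}}` if `0 ∈ x` and `0 ∈ y`, and to `0` otherwise. -/
noncomputable def psi0 {n k : ℕ} (a : B0 n (k + 1)) : B0 n k := fun x y =>
  if h : 0 ∉ x.1 ∧ 0 ∉ y.1 then a (NoZero.ins ⟨x, h.1⟩) (NoZero.ins ⟨y, h.2⟩) else 0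

theorem psi0_apply {n k : ℕ} (a : B0 n (k + 1)) (x y : NoZero n k) :
    psi0 a x.1 y.1 = a x.ins y.ins := dif_pos ⟨x.2, y.2⟩

theorem psi0_apply_eq_zero {n k : ℕ} (a : B0 n (k + 1)) {x y : IState n k}
    (h : ¬(0 ∉ x.1 ∧ 0 ∉ y.1)) : psi0 a x y = 0 := dif_neg h

theorem psi0_ext {n k : ℕ} {a : B0 n (k + 1)} {b : B0 n k}
    (h : ∀ x y : NoZero n k, a x.ins y.ins = b x.1 y.1)
    (h' : ∀ x y : IState n k, ¬(0 ∉ x.1 ∧ 0 ∉ y.1) → b x y = 0) : psi0 a = b := by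
  refine B0.ext fun x y => ?_
  by_cases hxy : 0 ∉ x.1 ∧ 0 ∉ y.1
  · exact (psi0_apply a ⟨x, hxy.1⟩ ⟨y, hxy.2⟩).trans (h _ _)
  · rw [psi0_apply_eq_zero a hxy, h' x y hxy]

theorem psi0_add {n k : ℕ} (a b : B0 n (k + 1)) : psi0 (a + b) = psi0 a + psi0 b := by
  refine psi0_ext (fun x y => ?_) fun x y h => ?_
  · rw [B0.add_apply, B0.add_apply, psi0_apply, psi0_apply]
  · rw [B0.add_apply, psi0_apply_eq_zero a h, psi0_apply_eq_zero b h, add_zero]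

theorem psi0_zero {n k : ℕ} : psi0 (0 : B0 n (k + 1)) = 0 :=
  psi0_ext (fun _ _ => rfl) fun _ _ _ => rfl

theorem sum_noZero {n k : ℕ} {M : Type*} [AddCommMonoid M] (f : IState n k → M)
    (h : ∀ x : IState n k, 0 ∈ x.1 → f x = 0) : ∑ x, f x = ∑ x : NoZero n k, f x.1 := by
  symm
  refine Fintype.sum_of_injective Subtype.val Subtype.val_injective _ _ (fun x hx => ?_) fun _ => rfl
  by_contra h'
  exact hx ⟨⟨x, fun h'' => h' (h x h'')⟩, rfl⟩

theorem sum_ins {n k : ℕ} {M : Type*} [AddCommMonoid M] (f : IState n (k + 1) → M)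
    (h : ∀ x : IState n (k + 1), 0 ∉ x.1 → f x = 0) : ∑ x, f x = ∑ x : NoZero n k, f x.ins := by
  symm
  refine Fintype.sum_of_injective NoZero.ins NoZero.ins_injective _ _ (fun x hx => ?_) fun _ => rfl
  by_contra h'
  exact hx (NoZero.exists_ins x (not_not.1 fun h'' => h' (h x h'')))

theorem psi0_mul_diag_mul {n k : ℕ} (a b : B0 n (k + 1)) :
    psi0 (a * B0.diag (fun x => 0 ∈ x) * b) = psi0 a * psi0 b := by
  refine psi0_ext (fun x z => ?_) fun x z h => ?_
  · rw [B0.mul_diag_mul, B0.mul_apply, sum_ins _ fun y hy => if_neg hy, sum_noZero]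
    · refine Finset.sum_congr rfl fun y _ => ?_
      rw [if_pos y.zero_mem_ins, psi0_apply, psi0_apply]
      congr 2
      exact gexp_insert_zero _ _ _
    · intro y hy
      rw [psi0_apply_eq_zero a fun h => h.2 hy, zero_mul, mul_zero]
  · rw [B0.mul_apply]
    refine Finset.sum_eq_zero fun y _ => ?_
    by_cases hx : 0 ∉ x.1
    · rw [psi0_apply_eq_zero b fun h' => h ⟨hx, h'.2⟩, mul_zero, mul_zero]
    · rw [psi0_apply_eq_zero a fun h' => hx h'.1, zero_mul, mul_zero]

theorem B0.E_mul_E {n k : ℕ} (x y z : IState n k) (p q : Pol n) :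
    (B0.E x y p * B0.E y z q : B0 n k) = B0.E x z (mon n (gexp x.1 y.1 z.1) * (p * q)) := by
  refine B0.ext fun x' z' => ?_
  rw [B0.mul_apply, Finset.sum_eq_single y]
  · unfold B0.E
    by_cases hx : x' = x
    · by_cases hz : z' = z
      · subst hx hz; simp
      · simp [hz]
    · simp [hx]
  · intro w _ hw
    unfold B0.E
    simp [hw]
  · simp

/-- The coefficient of `f_{x,y}`. -/
noncomputable def B0.entry {n k : ℕ} (x y : IState n k) : B0 n k →+ Pol n where
  toFun a := a x y
  map_zero' := rfl
  map_add' _ _ := rfl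

theorem B0.sum_apply {n k : ℕ} {ι : Type*} (s : Finset ι) (f : ι → B0 n k) (x y : IState n k) :
    (∑ i ∈ s, f i) x y = ∑ i ∈ s, f i x y := map_sum (B0.entry x y) f s

theorem B0.eq_sum_E {n k : ℕ} (a : B0 n k) : a = ∑ x, ∑ y, B0.E x y (a x y) := by
  refine B0.ext fun x' y' => ?_
  rw [B0.sum_apply, Finset.sum_eq_single x', B0.sum_apply, Finset.sum_eq_single y']
  · simp [B0.E]
  · intro b _ hb; simp [B0.E, hb.symm]
  · simp
  · intro b _ hb
    rw [B0.sum_apply]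
    exact Finset.sum_eq_zero fun y _ => by simp [B0.E, hb.symm]
  · simp

theorem B0.E_zero {n k : ℕ} (x y : IState n k) : B0.E x y 0 = 0 :=
  B0.ext fun _ _ => ite_self _

theorem mem_bordIdeal_of_E {n k : ℕ} {a : B0 n k} (h : ∀ x y, B0.E x y (a x y) ∈ bordIdeal n k) :
    a ∈ bordIdeal n k := by
  rw [B0.eq_sum_E a]
  exact sum_mem fun x _ => sum_mem fun y _ => h x y

theorem bordIdeal_mul_left {n k : ℕ} (a : B0 n k) {b : B0 n k} (h : b ∈ bordIdeal n k) :
    a * b ∈ bordIdeal n k := Ideal.mul_mem_left _ _ h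

theorem bordIdeal_mul_right {n k : ℕ} {a : B0 n k} (b : B0 n k) (h : a ∈ bordIdeal n k) :
    a * b ∈ bordIdeal n k := Ideal.IsTwoSided.mul_mem_of_left _ h

theorem zero_lt_hc {x : Finset ℕ} (h : 0 ∉ x) (i : ℕ) : 0 < hc x i := by
  have h1 : hc x 0 = 1 := by
    unfold hc
    rw [Nat.count_succ, if_pos h, Nat.count_zero]
  have := hc_mono x (Nat.zero_le i)
  omega

/-- the interval to the left of the second hole -/
theorem hole_one_mem {n k : ℕ} (x : IState n k) (h0 : 0 ∉ x.1) (hn : hole x.1 1 ≤ n) :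
    B0.E x x (mon n fun i => if i < hole x.1 1 then 1 else 0) ∈ bordIdeal n k := by
  have hl : hole x.1 1 ∉ x.1 := by
    unfold hole
    exact Nat.nth_mem_of_infinite (holes_infinite x.1) 1
  have hpos : 0 < hole x.1 1 := (Nat.zero_le _).trans_lt (hole_lt_hole_succ x.1 0)
  have hX : (X (⟨0, by omega⟩ : Fin n) : Pol n) = mon n (fun j => if j = 0 then 1 else 0) := by
    unfold mon
    rw [Finset.prod_eq_single (⟨0, by omega⟩ : Fin n)]
    · simp
    · intro b _ hb
      beta_reduce
      rw [if_neg (fun h => hb (Fin.ext h)), pow_zero]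
    · simp
  have hr : ∀ z : IState n k, 0 ∉ z.1 → 1 ∉ z.1 →
      B0.E z z (mon n (fun j => if j = 0 then 1 else 0)) ∈ bordIdeal n k := fun z h h' =>
    mem_bordIdeal_of_rel (Or.inr ⟨⟨0, by omega⟩, z, h, h', by rw [hX]⟩)
  by_cases h1 : 1 ∈ x.1
  · let y : IState n k := ⟨insert (hole x.1 1) (x.1.erase 1), by
      have h := Finset.mem_powersetCard.1 x.2
      refine Finset.mem_powersetCard.2 ⟨Finset.insert_subset (Finset.mem_range.2 (by omega))
        ((Finset.erase_subset _ _).trans h.1), ?_⟩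
      rw [card_insert_erase h1 hl, h.2]⟩
    have hy0 : 0 ∉ y.1 := by
      intro h
      rcases Finset.mem_insert.1 h with h | h
      · omega
      · exact h0 (Finset.mem_of_mem_erase h)
    have hy1 : 1 ∉ y.1 := by
      intro h
      rcases Finset.mem_insert.1 h with h | h
      · exact hl (h ▸ h1)
      · exact Finset.notMem_erase _ _ h
    have := bordIdeal_mul_right (B0.E y x 1) (bordIdeal_mul_left (B0.E x y 1) (hr y hy0 hy1))
    rw [B0.E_mul_E, B0.E_mul_E, mul_one, one_mul, mon_mul, mon_mul] at this
    convert this using 3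
    funext i
    have hw := wt_insert_erase h1 hl i
    change wt y.1 i + _ = _ at hw
    rw [gexp_self_right]
    beta_reduce
    have h2 : hole x.1 1 ≠ 1 := fun h => hl (h.symm ▸ h1)
    unfold gexp
    split_ifs at hw ⊢ <;> omega
  · have h2 : hole x.1 1 = 1 := by
      have : hole x.1 1 ≤ 1 := by
        rw [hole_le_iff, hc_succ, if_pos h1]
        have := zero_lt_hc h0 0
        omega
      omega
    rw [h2]
    convert hr x h0 h1 using 4
    split_ifs <;> omega

theorem B0.E_mem_left {n k : ℕ} {x z : IState n k} {p q : Pol n} (hpq : p ∣ q)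
    (h : B0.E x x p ∈ bordIdeal n k) : B0.E x z q ∈ bordIdeal n k := by
  obtain ⟨r, rfl⟩ := hpq
  have := bordIdeal_mul_right (B0.E x z r) h
  rwa [B0.E_mul_E, gexp_self_left, mon_zero, one_mul] at this

theorem B0.E_mem_right {n k : ℕ} {x z : IState n k} {p q : Pol n} (hpq : p ∣ q)
    (h : B0.E z z p ∈ bordIdeal n k) : B0.E x z q ∈ bordIdeal n k := by
  obtain ⟨r, rfl⟩ := hpq
  have := bordIdeal_mul_left (B0.E x z r) h
  rwa [B0.E_mul_E, gexp_self_right, mon_zero, one_mul, mul_comm] at this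

theorem hc_eq_one {x : Finset ℕ} (h0 : 0 ∉ x) (i : ℕ) : hc x i = 1 ↔ i < hole x 1 := by
  have h1 := hole_le_iff x i 1
  have h2 := zero_lt_hc h0 i
  omega

theorem B0.E_pInt_mem {n k : ℕ} {x z : IState n k} (hx : 0 ∉ x.1) (hz : 0 ∉ z.1) (hk : k + 1 ≤ n)
    {q : Pol n} (hq : pInt n x.1 z.1 0 ∣ q) : B0.E x z q ∈ bordIdeal n k := by
  have hl : ∀ y : IState n k, hole y.1 1 ≤ n := fun y => by
    rw [hole_le_iff]
    have := y.hc_last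
    omega
  have e : pInt n x.1 z.1 0 =
      mon n fun i => if i < hole x.1 1 ∧ i < hole z.1 1 then 1 else 0 := by
    rw [pInt_eq_mon]
    simp only [zero_add, hc_eq_one hx, hc_eq_one hz]
  rw [e] at hq
  rcases le_total (hole x.1 1) (hole z.1 1) with h | h
  · refine B0.E_mem_left ((mon_dvd_mon fun i _ => ?_).trans hq) (hole_one_mem x hx (hl x))
    split_ifs <;> omega
  · refine B0.E_mem_right ((mon_dvd_mon fun i _ => ?_).trans hq) (hole_one_mem z hz (hl z))
    split_ifs <;> omega

/-- passing through a state without `0` costs the interval to the left of the second hole -/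
theorem pInt_zero_dvd {k : ℕ} {x y z : Finset ℕ} (hx : x.card = k) (hy : y.card = k + 1)
    (hz : z.card = k) (hy0 : 0 ∉ y) (n : ℕ) :
    pInt n x z 0 ∣ mon n (gexp (insert 0 x) y (insert 0 z)) := by
  rw [pInt_eq_mon]
  refine mon_dvd_mon fun i _ => ?_
  have h1 := hc_add x i
  have h2 := hc_add y i
  have h3 := hc_add z i
  have h4 := zero_lt_hc hy0 i
  unfold gexp
  rw [wt_insert_zero, wt_insert_zero]
  split_ifs <;> omega

theorem psi0_mul_diag_mul_mem {n k : ℕ} (a b : B0 n (k + 1)) :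
    psi0 (a * B0.diag (fun x => 0 ∉ x) * b) ∈ bordIdeal n k := by
  refine mem_bordIdeal_of_E fun x z => ?_
  by_cases h : 0 ∉ x.1 ∧ 0 ∉ z.1
  · rw [psi0_apply _ ⟨x, h.1⟩ ⟨z, h.2⟩, B0.mul_diag_mul]
    by_cases hy : ∃ y : IState n (k + 1), 0 ∉ y.1
    · refine B0.E_pInt_mem h.1 h.2 ?_ (Finset.dvd_sum fun y _ => ?_)
      · obtain ⟨y, hy⟩ := hy
        have h1 := y.hc_last
        have h2 := zero_lt_hc hy n
        omega
      · split_ifs with hy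
        · exact dvd_zero _
        · exact (pInt_zero_dvd x.card y.card z.card hy n).trans (dvd_mul_right _ _)
    · rw [Finset.sum_eq_zero fun y _ => if_neg fun hy' => hy ⟨y, hy'⟩, B0.E_zero]
      exact zero_mem _
  · rw [psi0_apply_eq_zero _ h, B0.E_zero]
    exact zero_mem _

theorem diag_zero_add {n k : ℕ} :
    B0.diag (fun x => 0 ∈ x) + B0.diag (fun x => 0 ∉ x) = (1 : B0 n k) := by
  refine B0.ext fun x y => ?_
  rw [B0.add_apply, B0.one_apply]
  unfold B0.diag
  by_cases h : x = y <;> by_cases h' : 0 ∈ x.1 <;> simp [h, h']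
  all_goals simp_all

/-- The map `psi0`, which is multiplicative modulo the relations. -/
noncomputable def psi1 (n k : ℕ) : B0 n (k + 1) →ₙ+* BAlg n k where
  toFun a := BAlg.mk n k (psi0 a)
  map_zero' := by rw [psi0_zero, map_zero]
  map_add' a b := by rw [psi0_add, map_add]
  map_mul' a b := by
    have h : a * b = a * B0.diag (fun x => 0 ∈ x) * b + a * B0.diag (fun x => 0 ∉ x) * b := by
      rw [← add_mul, ← mul_add, diag_zero_add, mul_one]
    rw [h, psi0_add, map_add, psi0_mul_diag_mul, map_mul,
      BAlg.mk_eq_zero.2 (psi0_mul_diag_mul_mem a b), add_zero]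

theorem psi1_apply {n k : ℕ} (a : B0 n (k + 1)) : psi1 n k a = BAlg.mk n k (psi0 a) := rfl

theorem psi0_move {n k s t : ℕ} (hs : 1 ≤ s) (ht : 1 ≤ t) :
    psi0 (B0.move s t : B0 n (k + 1)) = B0.diag (fun x => 0 ∉ x) * (B0.move s t : B0 n k) := by
  have h0 : ∀ x z : IState n k, 0 ∉ x.1 → z.1 = insert t (x.1.erase s) → 0 ∉ z.1 := by
    intro x z hx hz h
    rw [hz] at h
    rcases Finset.mem_insert.1 h with h | h
    · omega
    · exact hx (Finset.mem_of_mem_erase h)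
  refine psi0_ext (fun x z => ?_) fun x z h => ?_
  · rw [B0.diag_mul, if_pos x.2]
    unfold B0.move
    congr 1
    have e1 : s ∈ x.ins.1 ↔ s ∈ x.1.1 := by
      change s ∈ insert 0 x.1.1 ↔ _
      rw [Finset.mem_insert]
      exact or_iff_right (by omega)
    have e2 : t ∈ x.ins.1 ↔ t ∈ x.1.1 := by
      change t ∈ insert 0 x.1.1 ↔ _
      rw [Finset.mem_insert]
      exact or_iff_right (by omega)
    have e3 : z.ins.1 = insert t (x.ins.1.erase s) ↔ z.1.1 = insert t (x.1.1.erase s) := by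
      change insert 0 z.1.1 = insert t ((insert 0 x.1.1).erase s) ↔ _
      rw [Finset.erase_insert_of_ne (by omega), Finset.insert_comm]
      constructor
      · intro h
        have hn : 0 ∉ insert t (x.1.1.erase s) := by
          intro h
          rcases Finset.mem_insert.1 h with h | h
          · omega
          · exact x.2 (Finset.mem_of_mem_erase h)
        rw [← Finset.erase_insert z.2, h, Finset.erase_insert hn]
      · rintro h
        rw [h]
    rw [e1, e2, e3]
  · rw [B0.diag_mul]
    split_ifs with hx
    · rfl
    · unfold B0.move
      rw [if_neg]
      rintro ⟨-, -, h'⟩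
      exact h ⟨hx, h0 x z hx h'⟩

theorem psi0_move_zero_left {n k t : ℕ} (ht : 1 ≤ t) :
    psi0 (B0.move 0 t : B0 n (k + 1)) = 0 := by
  refine psi0_ext (fun x z => ?_) fun _ _ _ => rfl
  unfold B0.move
  rw [if_neg]
  · rfl
  rintro ⟨-, -, h⟩
  have h1 := z.zero_mem_ins
  rw [h] at h1
  rcases Finset.mem_insert.1 h1 with h1 | h1
  · omega
  · exact Finset.notMem_erase _ _ h1

theorem psi0_move_zero_right {n k s : ℕ} : psi0 (B0.move s 0 : B0 n (k + 1)) = 0 := by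
  refine psi0_ext (fun x z => ?_) fun _ _ _ => rfl
  unfold B0.move
  rw [if_neg]
  · rfl
  rintro ⟨-, h, -⟩
  exact h x.zero_mem_ins

theorem diag_move_diag {n k s t : ℕ} (ht : 1 ≤ t) (a : B0 n k) :
    B0.diag (fun x => 0 ∉ x) * (B0.move s t : B0 n k) * (B0.diag (fun x => 0 ∉ x) * a) =
      B0.diag (fun x => 0 ∉ x) * (B0.move s t * a) := by
  have : B0.diag (fun x => 0 ∉ x) * (B0.move s t : B0 n k) * B0.diag (fun x => 0 ∉ x) =
      B0.diag (fun x => 0 ∉ x) * (B0.move s t : B0 n k) := by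
    refine B0.ext fun x y => ?_
    rw [B0.mul_diag, B0.diag_mul]
    by_cases h2 : 0 ∈ x.1
    · rw [if_neg (not_not.2 h2), ite_self]
    · rw [if_pos h2]
      by_cases h1 : 0 ∈ y.1
      · rw [if_neg (not_not.2 h1)]
        unfold B0.move
        rw [if_neg]
        rintro ⟨-, -, h⟩
        rw [h] at h1
        rcases Finset.mem_insert.1 h1 with h1 | h1
        · omega
        · exact h2 (Finset.mem_of_mem_erase h1)
      · rw [if_pos h1]
  rw [← mul_assoc, this, mul_assoc]

theorem psi1_rel {n k : ℕ} : bordRel n (k + 1) ⊆ TwoSidedIdeal.ker (psi1 n k) := by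
  have hmem : ∀ a : B0 n k, a ∈ bordRel n k →
      BAlg.mk n k (B0.diag (fun x => 0 ∉ x) * a) = 0 := fun a ha =>
    BAlg.mk_eq_zero.2 (bordIdeal_mul_left _ (mem_bordIdeal_of_rel ha))
  rintro a (⟨i, hi, rfl | rfl⟩ | ⟨i, x, h1, h2, rfl⟩)
  all_goals refine (TwoSidedIdeal.mem_ker _).2 ?_
  · rw [map_mul]
    rcases Nat.eq_zero_or_pos i with rfl | h
    · rw [psi1_apply (B0.move 0 _), psi0_move_zero_left (by omega), map_zero, zero_mul]
    · rw [psi1_apply, psi1_apply, psi0_move h (by omega), psi0_move (by omega) (by omega), ← map_mul,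
        diag_move_diag (by omega)]
      exact hmem _ (Or.inl ⟨i, hi, Or.inl rfl⟩)
  · rw [map_mul]
    rcases Nat.eq_zero_or_pos i with rfl | h
    · rw [psi1_apply (B0.move (0 + 1) 0), psi0_move_zero_right, map_zero, mul_zero]
    · rw [psi1_apply, psi1_apply, psi0_move (by omega) h, psi0_move (by omega) (by omega), ← map_mul,
        diag_move_diag (by omega)]
      exact hmem _ (Or.inl ⟨i, hi, Or.inr rfl⟩)
  · rw [psi1_apply]
    by_cases h0 : 0 ∈ x.1
    · obtain ⟨x, rfl⟩ := NoZero.exists_ins x h0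
      have : psi0 (B0.E x.ins x.ins (X i) : B0 n (k + 1)) = B0.E x.1 x.1 (X i) := by
        refine psi0_ext (fun y z => ?_) fun y z h => ?_
        · unfold B0.E
          simp only [NoZero.ins_injective.eq_iff, Subtype.ext_iff]
        · unfold B0.E
          rw [if_neg]
          rintro ⟨rfl, rfl⟩
          exact h ⟨x.2, x.2⟩
      rw [this]
      refine BAlg.mk_eq_zero.2 (mem_bordIdeal_of_rel (Or.inr ⟨i, x.1, fun h => h1 ?_, fun h => h2 ?_,
        rfl⟩))
      · exact Finset.mem_insert_of_mem h
      · exact Finset.mem_insert_of_mem h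
    · have : psi0 (B0.E x x (X i) : B0 n (k + 1)) = 0 := by
        refine psi0_ext (fun y z => ?_) fun y z h => rfl
        unfold B0.E
        rw [if_neg]
        · rfl
        rintro ⟨h, -⟩
        exact h0 (h ▸ y.zero_mem_ins)
      rw [this, map_zero]

theorem psi1_eq_zero {n k : ℕ} {a : B0 n (k + 1)} (ha : a ∈ bordIdeal n (k + 1)) :
    psi1 n k a = 0 := (TwoSidedIdeal.mem_ker _).1 (le_of_rel _ psi1_rel ha)

/-- The map induced by `psi1`, as an additive map. -/
noncomputable def psi2Add (n k : ℕ) : BAlg n (k + 1) →+ BAlg n k :=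
  BAlg.lift (psi1 n k).toAddMonoidHom fun a ha => (psi1_eq_zero ha : psi1 n k a = 0)

theorem psi2Add_mk {n k : ℕ} (a : B0 n (k + 1)) :
    psi2Add n k (BAlg.mk n (k + 1) a) = psi1 n k a := BAlg.lift_mk _ _ a

/-- The homomorphism `B(n,k+1) → B(n,k)` induced by `psi0`. -/
noncomputable def psi2 (n k : ℕ) : BAlg n (k + 1) →ₙ+* BAlg n k where
  __ := psi2Add n k
  map_mul' a b := by
    obtain ⟨a, rfl⟩ := BAlg.mk_surjective n (k + 1) a
    obtain ⟨b, rfl⟩ := BAlg.mk_surjective n (k + 1) b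
    change psi2Add n k _ = psi2Add n k _ * psi2Add n k _
    rw [← map_mul, psi2Add_mk, psi2Add_mk, psi2Add_mk, map_mul]

theorem psi2_mk {n k : ℕ} (a : B0 n (k + 1)) :
    psi2 n k (BAlg.mk n (k + 1) a) = BAlg.mk n k (psi0 a) := psi2Add_mk a

theorem psi0_diag {n k : ℕ} : psi0 (B0.diag (fun x => n ∉ x) : B0 n (k + 1)) =
    B0.diag fun x => n ∉ insert 0 x ∧ 0 ∉ x := by
  refine psi0_ext (fun x y => ?_) fun x y h => ?_
  · unfold B0.diag
    congr 1
    rw [NoZero.ins_injective.eq_iff, Subtype.ext_iff]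
    change (_ ∧ n ∉ insert 0 x.1.1) = _
    simp [x.2]
  · unfold B0.diag
    rw [if_neg]
    rintro ⟨rfl, h'⟩
    exact h ⟨h'.2, h'.2⟩

theorem B0.diag_mul_diag {n k : ℕ} (P Q : Finset ℕ → Prop) :
    (B0.diag P * B0.diag Q : B0 n k) = B0.diag fun x => P x ∧ Q x := by
  classical
  refine B0.ext fun x y => ?_
  rw [B0.diag_mul]
  unfold B0.diag
  by_cases h : P x.1 <;> simp [h]

theorem leftIdem_mul_psi2 {n k : ℕ} :
    leftIdem n k * psi2 n k (leftIdem n (k + 1)) = psi2 n k (leftIdem n (k + 1)) := by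
  unfold leftIdem
  rw [psi2_mk, ← map_mul, psi0_diag, B0.diag_mul_diag]
  congr 2
  funext x
  simp only [Finset.mem_insert]
  apply propext
  tauto

theorem psi2_mul_leftIdem {n k : ℕ} :
    psi2 n k (leftIdem n (k + 1)) * leftIdem n k = psi2 n k (leftIdem n (k + 1)) := by
  unfold leftIdem
  rw [psi2_mk, ← map_mul, psi0_diag, B0.diag_mul_diag]
  congr 2
  funext x
  simp only [Finset.mem_insert]
  apply propext
  tauto

theorem leftIdem_psi2_leftIdem {n k : ℕ} (b : Bl n (k + 1)) :
    leftIdem n k * psi2 n k b.val * leftIdem n k = psi2 n k b.val := by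
  have h1 : psi2 n k b.val = leftIdem n k * psi2 n k b.val := by
    rw [← Bl.left_mul_val b, map_mul, ← mul_assoc, leftIdem_mul_psi2]
  rw [← h1, ← Bl.val_mul_left b, map_mul, mul_assoc, psi2_mul_leftIdem]

/-- The homomorphism `B_l(n,k+1) → B_l(n,k)`, `b ↦ Ψ'(e^∧ b e^∧)`, with values in `e^∨ B_l(n,k) e^∨`. It
sends `f_{x,y}` to `f_{x \ {0}, y \ {0}}` if `0 ∈ x` and `0 ∈ y`, and to `0` otherwise. It is not unital:
`1 ↦ e^∨` (see `PsiOSz_one`). -/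
noncomputable def PsiOSz (n k : ℕ) : Bl n (k + 1) →ₙ+* Bl n k where
  toFun b := Bl.of (psi2 n k b.val)
  map_zero' := Bl.val_injective <| by
    rw [Bl.val_of, Bl.val_zero, Bl.val_zero, map_zero, mul_zero, zero_mul]
  map_add' a b := Bl.val_injective <| by
    simp only [Bl.val_of, Bl.val_add, leftIdem_psi2_leftIdem, map_add, mul_add, add_mul]
  map_mul' a b := Bl.val_injective <| by
    simp only [Bl.val_mul, Bl.val_of, leftIdem_psi2_leftIdem, map_mul]
    rw [← map_mul, ← Bl.val_mul, leftIdem_psi2_leftIdem, Bl.val_mul, map_mul]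

theorem PsiOSz_val {n k : ℕ} (b : Bl n (k + 1)) : (PsiOSz n k b).val = psi2 n k b.val :=
  leftIdem_psi2_leftIdem b

/-! ### Adding a first symbol on Sartori's side -/

/-- The sequences whose first symbol is `∨`. -/
abbrev FirstVee (n k : ℕ) : Type := {l : Vl n k // 0 ∉ l.1 ∧ 0 < n}

/-- The sequence with the first symbol `∨` changed to `∧`. -/
def FirstVee.ins {n k : ℕ} (x : FirstVee n k) : Vl n (k + 1) :=
  ⟨insert 0 x.1.1, by
    have h := Finset.mem_powersetCard.1 x.1.2
    refine Finset.mem_powersetCard.2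
      ⟨Finset.insert_subset (Finset.mem_range.2 x.2.2) h.1, ?_⟩
    rw [Finset.card_insert_of_notMem x.2.1, h.2]⟩

theorem FirstVee.ins_injective {n k : ℕ} : Function.Injective (FirstVee.ins (n := n) (k := k)) := by
  intro x y h
  have h1 : insert 0 x.1.1 = insert 0 y.1.1 := congrArg (fun z : Vl n (k + 1) => z.1) h
  apply Subtype.ext
  apply Subtype.ext
  rw [← Finset.erase_insert x.2.1, h1, Finset.erase_insert y.2.1]

theorem FirstVee.zero_mem_ins {n k : ℕ} (x : FirstVee n k) : 0 ∈ x.ins.1 :=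
  Finset.mem_insert_self _ _

theorem FirstVee.exists_ins {n k : ℕ} (y : Vl n (k + 1)) (h : 0 ∈ y.1) :
    ∃ x : FirstVee n k, x.ins = y := by
  have hy := Finset.mem_powersetCard.1 y.2
  refine ⟨⟨⟨y.1.erase 0, Finset.mem_powersetCard.2
    ⟨(Finset.erase_subset _ _).trans hy.1, ?_⟩⟩, Finset.notMem_erase _ _,
      Finset.mem_range.1 (hy.1 h)⟩, ?_⟩
  · rw [Finset.card_erase_of_mem h, hy.2]; rfl
  · exact Subtype.ext (Finset.insert_erase h)

theorem bseq_insert_zero (x : Finset ℕ) : bseq (insert 0 x) = bseq x := by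
  funext i
  unfold bseq
  rw [wt_insert_zero]

/-- The sequence `b` does not depend on the first symbol, so neither does `R_b`. -/
noncomputable def insEquiv (n : ℕ) (x : Finset ℕ) : Rb n x ≃ₗ[Pol n] Rb n (insert 0 x) :=
  Submodule.quotEquivOfEq _ _ (by rw [bseq_insert_zero])

theorem insEquiv_mk (n : ℕ) (x : Finset ℕ) (p : Pol n) :
    insEquiv n x (Ideal.Quotient.mk _ p) = Ideal.Quotient.mk _ p := rfl

theorem insEquiv_symm_mk (n : ℕ) (x : Finset ℕ) (p : Pol n) :
    (insEquiv n x).symm (Ideal.Quotient.mk _ p) = Ideal.Quotient.mk _ p := rfl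

/-- The identification of `Hom(R_{∧λ}, R_{∧μ})` with `Hom(R_{∨λ}, R_{∨μ})`. -/
noncomputable def insConj (n : ℕ) (x y : Finset ℕ) :
    (Rb n (insert 0 x) →ₗ[Pol n] Rb n (insert 0 y)) →ₗ[Pol n] (Rb n x →ₗ[Pol n] Rb n y) where
  toFun f := ((insEquiv n y).symm : _ →ₗ[Pol n] _) ∘ₗ f ∘ₗ (insEquiv n x : _ →ₗ[Pol n] _)
  map_add' f g := by rw [LinearMap.add_comp, LinearMap.comp_add]
  map_smul' r f := by rw [LinearMap.smul_comp, LinearMap.comp_smul]; rfl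

theorem insConj_apply {n : ℕ} {x y : Finset ℕ} (f : Rb n (insert 0 x) →ₗ[Pol n] Rb n (insert 0 y)) :
    insConj n x y f =
      ((insEquiv n y).symm : _ →ₗ[Pol n] _) ∘ₗ f ∘ₗ (insEquiv n x : _ →ₗ[Pol n] _) := rfl

theorem insConj_comp {n : ℕ} {x y z : Finset ℕ}
    (g : Rb n (insert 0 y) →ₗ[Pol n] Rb n (insert 0 z))
    (f : Rb n (insert 0 x) →ₗ[Pol n] Rb n (insert 0 y)) :
    insConj n x z (g ∘ₗ f) = insConj n y z g ∘ₗ insConj n x y f := by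
  refine LinearMap.ext fun r => ?_
  simp only [insConj_apply, LinearMap.comp_apply, LinearEquiv.coe_coe, LinearEquiv.apply_symm_apply]

theorem cexp_insert_zero (x y : Finset ℕ) : cexp (insert 0 x) (insert 0 y) = cexp x y := by
  funext i
  unfold cexp
  rw [wt_insert_zero, wt_insert_zero]

theorem insConj_homMon (n : ℕ) (x y : Finset ℕ) :
    insConj n x y (homMon n (insert 0 x) (insert 0 y)) = homMon n x y := by
  refine Rb_hom_ext ?_
  rw [homMon_one, insConj_apply, LinearMap.comp_apply, LinearMap.comp_apply, LinearEquiv.coe_coe,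
    LinearEquiv.coe_coe, ← map_one (Ideal.Quotient.mk _), insEquiv_mk, homMon_mk, insEquiv_symm_mk,
    cexp_insert_zero, mul_one]

/-- The identification of `Hom(R_{∧λ}, R_{∧μ})` with `Hom(R_{∨λ}, R_{∨μ})`. -/
noncomputable def FirstVee.conj {n k : ℕ} (l m : FirstVee n k) :
    (Rb n l.ins.1 →ₗ[Pol n] Rb n m.ins.1) →ₗ[Pol n] (Rb n l.1.1 →ₗ[Pol n] Rb n m.1.1) :=
  insConj n l.1.1 m.1.1

theorem FirstVee.conj_comp {n k : ℕ} {l v m : FirstVee n k}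
    (g : Rb n v.ins.1 →ₗ[Pol n] Rb n m.ins.1) (f : Rb n l.ins.1 →ₗ[Pol n] Rb n v.ins.1) :
    l.conj m (g ∘ₗ f) = v.conj m g ∘ₗ l.conj v f := insConj_comp g f

theorem FirstVee.conj_homMon {n k : ℕ} (l m : FirstVee n k) :
    l.conj m (homMon n l.ins.1 m.ins.1) = homMon n l.1.1 m.1.1 := insConj_homMon n _ _

open Classical in
/-- The components between the sequences starting with `∧`, with this first symbol changed to `∨`; the
other components are dropped. -/
noncomputable def psiMat {n k : ℕ} (a : SoergelEnd n (k + 1)) : SoergelEnd n k :=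
  ofComp fun l m =>
    if h : (0 ∉ l.1 ∧ 0 < n) ∧ (0 ∉ m.1 ∧ 0 < n) then
      FirstVee.conj ⟨l, h.1⟩ ⟨m, h.2⟩ (comp a (FirstVee.ins ⟨l, h.1⟩) (FirstVee.ins ⟨m, h.2⟩))
    else 0

theorem comp_psiMat {n k : ℕ} (a : SoergelEnd n (k + 1)) (l m : FirstVee n k) :
    comp (psiMat a) l.1 m.1 = l.conj m (comp a l.ins m.ins) := by
  unfold psiMat
  rw [comp_ofComp, dif_pos ⟨l.2, m.2⟩]

theorem comp_psiMat_eq_zero {n k : ℕ} (a : SoergelEnd n (k + 1)) {l m : Vl n k}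
    (h : ¬((0 ∉ l.1 ∧ 0 < n) ∧ (0 ∉ m.1 ∧ 0 < n))) : comp (psiMat a) l m = 0 := by
  unfold psiMat
  rw [comp_ofComp, dif_neg h]

theorem psiMat_add {n k : ℕ} (a b : SoergelEnd n (k + 1)) :
    psiMat (a + b) = psiMat a + psiMat b := by
  refine SoergelEnd.ext_comp fun l m => ?_
  rw [comp_add]
  by_cases h : (0 ∉ l.1 ∧ 0 < n) ∧ (0 ∉ m.1 ∧ 0 < n)
  · have e := fun a : SoergelEnd n (k + 1) => comp_psiMat a ⟨l, h.1⟩ ⟨m, h.2⟩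
    rw [e, e, e, comp_add, map_add]
  · rw [comp_psiMat_eq_zero _ h, comp_psiMat_eq_zero _ h, comp_psiMat_eq_zero _ h, add_zero]

theorem psiMat_zero {n k : ℕ} : psiMat (0 : SoergelEnd n (k + 1)) = 0 := by
  have h := psiMat_add (0 : SoergelEnd n (k + 1)) 0
  rw [add_zero] at h
  exact left_eq_add.1 h

theorem sum_firstVee {n k : ℕ} {M : Type*} [AddCommMonoid M] (f : Vl n k → M)
    (h : ∀ x : Vl n k, ¬(0 ∉ x.1 ∧ 0 < n) → f x = 0) : ∑ x, f x = ∑ x : FirstVee n k, f x.1 := by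
  symm
  refine Fintype.sum_of_injective Subtype.val Subtype.val_injective _ _ (fun x hx => ?_) fun _ => rfl
  by_contra h'
  exact hx ⟨⟨x, not_not.1 fun h'' => h' (h x h'')⟩, rfl⟩

theorem sum_insV {n k : ℕ} {M : Type*} [AddCommMonoid M] (f : Vl n (k + 1) → M)
    (h : ∀ x : Vl n (k + 1), 0 ∉ x.1 → f x = 0) : ∑ x, f x = ∑ x : FirstVee n k, f x.ins := by
  symm
  refine Fintype.sum_of_injective FirstVee.ins FirstVee.ins_injective _ _ (fun x hx => ?_)
    fun _ => rfl
  by_contra h'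
  exact hx (FirstVee.exists_ins x (not_not.1 fun h'' => h' (h x h'')))

theorem psiMat_mul_sub_mem {n k : ℕ} (a b : SoergelEnd n (k + 1)) (l m : Vl n k) :
    comp (psiMat (a * b)) l m - comp (psiMat a * psiMat b) l m ∈ Wα n k l.1 m.1 := by
  by_cases h : (0 ∉ l.1 ∧ 0 < n) ∧ (0 ∉ m.1 ∧ 0 < n)
  · obtain ⟨l, rfl⟩ : ∃ l' : FirstVee n k, l'.1 = l := ⟨⟨l, h.1⟩, rfl⟩
    obtain ⟨m, rfl⟩ : ∃ m' : FirstVee n k, m'.1 = m := ⟨⟨m, h.2⟩, rfl⟩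
    rw [comp_psiMat, comp_mul, comp_mul, map_sum, sum_firstVee (fun v => comp (psiMat a) v m.1 ∘ₗ
      comp (psiMat b) l.1 v) fun v hv => by
        rw [comp_psiMat_eq_zero b fun h => hv h.2, LinearMap.comp_zero]]
    have e1 : ∀ v : FirstVee n k, comp (psiMat a) v.1 m.1 ∘ₗ comp (psiMat b) l.1 v.1 =
        l.conj m (comp a v.ins m.ins ∘ₗ comp b l.ins v.ins) := fun v => by
      rw [comp_psiMat, comp_psiMat]
      exact (FirstVee.conj_comp _ _).symm
    rw [Finset.sum_congr rfl fun v _ => e1 v,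
      ← Finset.sum_filter_add_sum_filter_not Finset.univ (fun w : Vl n (k + 1) => 0 ∈ w.1),
      Finset.sum_filter, sum_insV _ fun w hw => if_neg hw,
      Finset.sum_congr rfl fun (v : FirstVee n k) _ => if_pos v.zero_mem_ins, add_sub_cancel_left]
    refine sum_mem fun w hw => ?_
    have hw0 : 0 ∉ w.1 := (Finset.mem_filter.1 hw).2
    obtain ⟨p, hp⟩ := exists_smul_homMon (comp a w m.ins)
    obtain ⟨q, hq⟩ := exists_smul_homMon (comp b l.ins w)
    rw [hp, hq, LinearMap.comp_smul, LinearMap.smul_comp, homMon_comp, smul_smul, smul_smul]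
    rw [map_smul, FirstVee.conj_homMon]
    have hk : 0 < n - k := by
      have h1 := w.incl.hc_last
      have h2 := zero_lt_hc hw0 (n - 1)
      have h3 := hc_succ w.1 (n - 1)
      have h4 : n - 1 + 1 = n := by have := h.1.2; omega
      rw [h4, if_pos (show n ∉ w.1 from w.not_mem_incl)] at h3
      change hc w.1 n + _ = _ at h1
      omega
    refine smul_homMon_mem hk ?_
    rw [pInt_comm]
    exact (pInt_zero_dvd m.1.card w.card l.1.card hw0 n).trans (dvd_mul_left _ _)
  · rw [comp_psiMat_eq_zero _ h, comp_mul, Finset.sum_eq_zero, sub_zero]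
    · exact zero_mem _
    · intro v _
      by_cases hl : 0 ∉ l.1 ∧ 0 < n
      · rw [comp_psiMat_eq_zero a fun h' => h ⟨hl, h'.2⟩, LinearMap.zero_comp]
      · rw [comp_psiMat_eq_zero b fun h' => hl h'.1, LinearMap.comp_zero]

theorem pInt_insert_zero {x y : Finset ℕ} (hx : 0 ∉ x) (hy : 0 ∉ y) (n j : ℕ) :
    pInt n (insert 0 x) (insert 0 y) j = pInt n x y (j + 1) := by
  have h : ∀ x : Finset ℕ, 0 ∉ x → ∀ i, hc (insert 0 x) i + 1 = hc x i := fun x hx i => by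
    have h1 := hc_add x i
    have h2 := hc_add (insert 0 x) i
    rw [wt_insert_zero, Finset.card_insert_of_notMem hx] at h2
    omega
  rw [pInt_eq_mon, pInt_eq_mon]
  congr 1
  funext i
  rw [← h x hx, ← h y hy]
  simp only [Nat.add_right_cancel_iff]

theorem psiMat_illicit {n k : ℕ} {a : SoergelEnd n (k + 1)} (ha : SarAlg.mk n (k + 1) a = 0) :
    SarAlg.mk n k (psiMat a) = 0 := by
  rw [SarAlg.mk_eq_zero] at ha ⊢
  intro l m
  by_cases h : (0 ∉ l.1 ∧ 0 < n) ∧ (0 ∉ m.1 ∧ 0 < n)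
  · obtain ⟨l, rfl⟩ : ∃ l' : FirstVee n k, l'.1 = l := ⟨⟨l, h.1⟩, rfl⟩
    obtain ⟨m, rfl⟩ : ∃ m' : FirstVee n k, m'.1 = m := ⟨⟨m, h.2⟩, rfl⟩
    rw [comp_psiMat]
    have h1 := ha l.ins m.ins
    rw [Wα_eq] at h1
    have h2 : Submodule.span (Pol n) {f | ∃ j < n - (k + 1),
        f = pInt n l.ins.1 m.ins.1 j • homMon n l.ins.1 m.ins.1} ≤
          Submodule.comap (l.conj m) (Wα n k l.1.1 m.1.1) := by
      refine Submodule.span_le.2 ?_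
      rintro f ⟨j, hj, rfl⟩
      rw [SetLike.mem_coe, Submodule.mem_comap, map_smul, FirstVee.conj_homMon]
      refine smul_homMon_mem (show j + 1 < n - k by omega) ?_
      exact dvd_of_eq (pInt_insert_zero (x := l.1.1) (y := m.1.1) l.2.1 m.2.1 n j).symm
    exact Submodule.mem_comap.1 (h2 h1)
  · rw [comp_psiMat_eq_zero _ h]
    exact zero_mem _

theorem SarAlg.mk_surjective (n k : ℕ) : Function.Surjective (SarAlg.mk n k) :=
  Ideal.Quotient.mk_surjective

/-- The map `psiMat` modulo illicit morphisms. -/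
noncomputable def psiS1 (n k : ℕ) : SoergelEnd n (k + 1) →+ SarAlg n k where
  toFun a := SarAlg.mk n k (psiMat a)
  map_zero' := by rw [psiMat_zero, map_zero]
  map_add' a b := by rw [psiMat_add, map_add]

theorem psiS1_apply {n k : ℕ} (a : SoergelEnd n (k + 1)) :
    psiS1 n k a = SarAlg.mk n k (psiMat a) := rfl

theorem psiS1_mul {n k : ℕ} (a b : SoergelEnd n (k + 1)) :
    psiS1 n k (a * b) = psiS1 n k a * psiS1 n k b := by
  rw [psiS1_apply, psiS1_apply, psiS1_apply, ← map_mul, ← sub_eq_zero, ← map_sub,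
    SarAlg.mk_eq_zero]
  intro l m
  have h : ∀ a b : SoergelEnd n k, comp (a - b) l m = comp a l m - comp b l m := fun _ _ => rfl
  rw [h]
  exact psiMat_mul_sub_mem a b l m

/-- The additive map induced by `psiS1`. -/
noncomputable def psiS2 (n k : ℕ) : SarAlg n (k + 1) →+ SarAlg n k :=
  (SarAlg.mk n (k + 1)).toAddMonoidHom.liftOfSurjective (SarAlg.mk_surjective n (k + 1))
    ⟨psiS1 n k, fun _ ha => psiMat_illicit ha⟩

theorem psiS2_mk {n k : ℕ} (a : SoergelEnd n (k + 1)) :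
    psiS2 n k (SarAlg.mk n (k + 1) a) = psiS1 n k a :=
  (SarAlg.mk n (k + 1)).toAddMonoidHom.liftOfRightInverse_comp_apply _
    (Function.rightInverse_surjInv (SarAlg.mk_surjective n (k + 1)))
    ⟨psiS1 n k, fun _ ha => psiMat_illicit ha⟩ a

/-- The homomorphism `A_{n,k+1} → A_{n,k}`, `a ↦ Ψ(e^∧ a e^∧)`, with values in `e^∨ A_{n,k} e^∨`: the
class of a morphism `R_{∧λ} → R_{∧μ}` goes to the class of the same morphism `R_{∨λ} → R_{∨μ}`, and
the other components go to `0`. It is not unital: `1 ↦ e^∨` (see `PsiSar_one`). -/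
noncomputable def PsiSar (n k : ℕ) : SarAlg n (k + 1) →ₙ+* SarAlg n k where
  __ := psiS2 n k
  map_mul' a b := by
    obtain ⟨a, rfl⟩ := SarAlg.mk_surjective n (k + 1) a
    obtain ⟨b, rfl⟩ := SarAlg.mk_surjective n (k + 1) b
    change psiS2 n k _ = psiS2 n k _ * psiS2 n k _
    rw [← map_mul, psiS2_mk, psiS2_mk, psiS2_mk, psiS1_mul]

theorem PsiSar_mk {n k : ℕ} (a : SoergelEnd n (k + 1)) :
    PsiSar n k (SarAlg.mk n (k + 1) a) = SarAlg.mk n k (psiMat a) := psiS2_mk a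

/-! ### The idempotents -/

/-- The idempotent `e^∨` of `A_{n,k}`: the sum of the identities of the `R_λ` with first symbol `∨`. -/
noncomputable def veeSar (n k : ℕ) : SarAlg n k :=
  SarAlg.mk n k (ofComp fun l m => if l = m ∧ 0 ∉ l.1 then homMon n l.1 m.1 else 0)

/-- The idempotent `e^∨` of `B_l(n,k)`: the sum of the `I_x` with `0 ∉ x`. -/
noncomputable def veeOSz (n k : ℕ) : Bl n k := Bl.of (BAlg.mk n k (B0.diag fun x => 0 ∉ x))

theorem PsiSar_one {n k : ℕ} (hn : 0 < n) : PsiSar n k 1 = veeSar n k := by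
  rw [← map_one (SarAlg.mk n (k + 1)), PsiSar_mk]
  unfold veeSar
  congr 1
  refine SoergelEnd.ext_comp fun l m => ?_
  rw [comp_ofComp]
  by_cases h : (0 ∉ l.1 ∧ 0 < n) ∧ (0 ∉ m.1 ∧ 0 < n)
  · obtain ⟨l, rfl⟩ : ∃ l' : FirstVee n k, l'.1 = l := ⟨⟨l, h.1⟩, rfl⟩
    obtain ⟨m, rfl⟩ : ∃ m' : FirstVee n k, m'.1 = m := ⟨⟨m, h.2⟩, rfl⟩
    rw [comp_psiMat, comp_one]
    split_ifs with h1 h2 h2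
    · obtain rfl := FirstVee.ins_injective h1
      refine Eq.trans ?_ (FirstVee.conj_homMon l l)
      rw [homMon_self]
    · exact absurd ⟨congrArg _ (FirstVee.ins_injective h1), l.2.1⟩ h2
    · exact absurd (congrArg _ (Subtype.ext h2.1)) h1
    · rw [map_zero]
  · rw [comp_psiMat_eq_zero _ h, if_neg]
    rintro ⟨rfl, h'⟩
    exact h ⟨⟨h', hn⟩, ⟨h', hn⟩⟩

theorem PsiOSz_one {n k : ℕ} (hn : 0 < n) : PsiOSz n k 1 = veeOSz n k := by
  apply Bl.val_injective
  rw [PsiOSz_val, Bl.val_one]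
  unfold veeOSz
  rw [Bl.val_of]
  unfold leftIdem
  rw [psi2_mk, psi0_diag, ← map_mul, ← map_mul, B0.diag_mul_diag, B0.diag_mul_diag]
  congr 2
  funext x
  simp only [Finset.mem_insert]
  apply propext
  have : n ≠ 0 := by omega
  tauto

/-! ### Gradings -/

/-- The polynomials all of whose terms `m` satisfy `2 * deg m + c = d`. -/
noncomputable def polHomog (n : ℕ) (c d : ℤ) : AddSubgroup (Pol n) where
  carrier := {p | ∀ m : Fin n →₀ ℕ, p.coeff m ≠ 0 → 2 * (m.degree : ℤ) + c = d}
  zero_mem' m h := absurd (MvPolynomial.coeff_zero m) h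
  add_mem' {p q} hp hq m h := by
    rw [MvPolynomial.coeff_add] at h
    by_cases hp' : p.coeff m = 0
    · exact hq m (by rwa [hp', zero_add] at h)
    · exact hp m hp'
  neg_mem' {p} hp m h := hp m (by rwa [MvPolynomial.coeff_neg, neg_ne_zero] at h)

/-- The elements of degree `d`, where `f_{x,y}` has degree `∑ |v_i^x - v_i^y|` and `U_i` has degree `2`. -/
noncomputable def B0.homog (n k : ℕ) (d : ℤ) : AddSubgroup (B0 n k) where
  carrier := {a | ∀ x y : IState n k, a x y ∈
    polHomog n (∑ i ∈ Finset.range n, |(wt x.1 i : ℤ) - wt y.1 i|) d}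
  zero_mem' _ _ := zero_mem _
  add_mem' ha hb x y := add_mem (ha x y) (hb x y)
  neg_mem' {a} ha x y := (neg_mem (ha x y) : -(a x y) ∈ _)

/-- The elements of degree `d` of `B(n,k)`. -/
noncomputable def BAlg.homog (n k : ℕ) (d : ℤ) : AddSubgroup (BAlg n k) :=
  (B0.homog n k d).map (BAlg.mk n k : B0 n k →+ BAlg n k)

/-- The inclusion of `B_l(n,k)` into `B(n,k)` as additive homomorphism. -/
def Bl.valHom (n k : ℕ) : Bl n k →+ BAlg n k where
  toFun := Bl.val
  map_zero' := rfl
  map_add' _ _ := rfl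

/-- The elements of degree `d` of `B_l(n,k)`. -/
noncomputable def Bl.homog (n k : ℕ) (d : ℤ) : AddSubgroup (Bl n k) :=
  (BAlg.homog n k d).comap (Bl.valHom n k)

/-- The elements of degree `d`, where `1 ↦ p : R_λ → R_μ` has degree `2 * deg p + ∑ (b_i^λ - b_i^μ)`. -/
noncomputable def SoergelEnd.homog (n k : ℕ) (d : ℤ) : AddSubgroup (SoergelEnd n k) where
  carrier := {a | ∀ l m : Vl n k, ∃ p ∈
    polHomog n (∑ i ∈ Finset.range n, ((bseq l.1 i : ℤ) - bseq m.1 i)) d,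
      comp a l m 1 = Ideal.Quotient.mk _ p}
  zero_mem' l m := ⟨0, zero_mem _, rfl⟩
  add_mem' {a b} ha hb l m := by
    obtain ⟨p, hp, h⟩ := ha l m
    obtain ⟨q, hq, h'⟩ := hb l m
    exact ⟨p + q, add_mem hp hq, by rw [comp_add, LinearMap.add_apply, h, h', map_add]⟩
  neg_mem' {a} ha l m := by
    obtain ⟨p, hp, h⟩ := ha l m
    refine ⟨-p, neg_mem hp, ?_⟩
    have : comp (-a) l m 1 = -comp a l m 1 := rfl
    rw [this, h, map_neg]

/-- The elements of degree `d` of Sartori's algebra. -/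
noncomputable def SarAlg.homog (n k : ℕ) (d : ℤ) : AddSubgroup (SarAlg n k) :=
  (SoergelEnd.homog n k d).map (SarAlg.mk n k : SoergelEnd n k →+ SarAlg n k)

/-! ### Bimodules -/

/-- Graded `(S, T)`-bimodules, with the additive groups of the homogeneous elements. A right
`T`-module is a module over the opposite ring of `T`. -/
structure GrBimod (S T : Type) [Ring S] [Ring T] where
  carrier : Type
  [addCommGroup : AddCommGroup carrier]
  [left : Module S carrier]
  [right : Module Tᵐᵒᵖ carrier]
  [comm : SMulCommClass S Tᵐᵒᵖ carrier]
  homog : ℤ → AddSubgroup carrier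

namespace GrBimod

attribute [instance] GrBimod.addCommGroup GrBimod.left GrBimod.right GrBimod.comm

variable {R S T U : Type} [Ring R] [Ring S] [Ring T] [Ring U]

instance (M : GrBimod S T) : SMulCommClass Tᵐᵒᵖ S M.carrier := SMulCommClass.symm _ _ _

/-- Isomorphisms of graded bimodules: additive bijections that respect both actions and the degrees. -/
structure Iso (M N : GrBimod S T) where
  equiv : M.carrier ≃+ N.carrier
  map_left : ∀ (s : S) (x : M.carrier), equiv (s • x) = s • equiv x
  map_right : ∀ (t : T) (x : M.carrier), equiv (MulOpposite.op t • x) = MulOpposite.op t • equiv x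
  map_homog : ∀ (d : ℤ) (x : M.carrier), equiv x ∈ N.homog d ↔ x ∈ M.homog d

/-- The regular bimodule `S`. -/
def regular (gr : ℤ → AddSubgroup S) : GrBimod S S where
  carrier := S
  homog := gr

/-- The left ideal `S e`, where `e = ψ(1)`. -/
def IndCarrier (ψ : T →ₙ+* S) : Submodule S S := Submodule.span S {ψ 1}

theorem mul_mem_indCarrier (ψ : T →ₙ+* S) (p : S) (t : T) : p * ψ t ∈ IndCarrier ψ := by
  rw [IndCarrier, Submodule.mem_span_singleton]
  exact ⟨p * ψ t, by rw [smul_eq_mul, mul_assoc, ← map_mul, mul_one]⟩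

theorem mul_one_of_mem {ψ : T →ₙ+* S} {p : S} (h : p ∈ IndCarrier ψ) : p * ψ 1 = p := by
  rw [IndCarrier, Submodule.mem_span_singleton] at h
  obtain ⟨a, rfl⟩ := h
  rw [smul_eq_mul, mul_assoc, ← map_mul, mul_one]

/-- The right action `p · t = p ψ(t)` of `T` on `S e`. -/
@[reducible] def indModule (ψ : T →ₙ+* S) : Module Tᵐᵒᵖ (IndCarrier ψ) where
  smul t p := ⟨p.1 * ψ t.unop, mul_mem_indCarrier ψ _ _⟩
  one_smul p := Subtype.ext (mul_one_of_mem p.2)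
  mul_smul s t p := Subtype.ext <| by
    change p.1 * ψ (t.unop * s.unop) = p.1 * ψ t.unop * ψ s.unop
    rw [map_mul, mul_assoc]
  smul_zero t := Subtype.ext (zero_mul _)
  smul_add t p q := Subtype.ext (add_mul _ _ _)
  add_smul s t p := Subtype.ext <| by
    change p.1 * ψ (s.unop + t.unop) = p.1 * ψ s.unop + p.1 * ψ t.unop
    rw [map_add, mul_add]
  zero_smul p := Subtype.ext <| by
    change p.1 * ψ 0 = 0
    rw [map_zero, mul_zero]

/-- The bimodule `S e`, where `e = ψ(1)`, with right action through `ψ : T → e S e`. -/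
def ind (gr : ℤ → AddSubgroup S) (ψ : T →ₙ+* S) : GrBimod S T where
  carrier := IndCarrier ψ
  right := indModule ψ
  comm :=
    letI := indModule ψ
    ⟨fun s t p => Subtype.ext (mul_assoc s p.1 (ψ t.unop)).symm⟩
  homog d := (gr d).comap (IndCarrier ψ).subtype.toAddMonoidHom

/-- The left action `(t φ)(f) = φ(f t)` of `T` on `Hom_S(F, S)`. -/
@[reducible] def dualModule (F : GrBimod S T) : Module T (F.carrier →ₗ[S] S) where
  smul t φ :=
    { toFun := fun f => φ (MulOpposite.op t • f)
      map_add' := fun f g => by rw [smul_add, map_add]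
      map_smul' := fun s f => by rw [smul_comm, map_smul]; rfl }
  one_smul φ := LinearMap.ext fun f => congrArg φ (one_smul Tᵐᵒᵖ f)
  mul_smul s t φ := LinearMap.ext fun f => congrArg φ <| by
    rw [MulOpposite.op_mul, mul_smul]
  smul_zero t := LinearMap.ext fun f => rfl
  smul_add t φ χ := LinearMap.ext fun f => rfl
  add_smul s t φ := LinearMap.ext fun f => by
    change φ (MulOpposite.op (s + t) • f) = φ _ + φ _
    rw [MulOpposite.op_add, add_smul, map_add]
  zero_smul φ := LinearMap.ext fun f => by
    change φ (MulOpposite.op (0 : T) • f) = 0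
    rw [MulOpposite.op_zero, zero_smul, map_zero]

/-- The dual bimodule `Hom_S(F, S)`, with left action `(t φ)(f) = φ(f t)` and right action
`(φ s)(f) = φ(f) s`. Its elements of degree `d` are the homomorphisms that raise degrees by `d`. -/
def dual (gr : ℤ → AddSubgroup S) (F : GrBimod S T) : GrBimod T S where
  carrier := F.carrier →ₗ[S] S
  left := dualModule F
  comm :=
    letI := dualModule F
    ⟨fun _ _ _ => LinearMap.ext fun _ => rfl⟩
  homog d :=
    { carrier := {φ | ∀ i, ∀ f ∈ F.homog i, φ f ∈ gr (i + d)}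
      zero_mem' := fun _ _ _ => zero_mem _
      add_mem' := fun hφ hχ i f hf => add_mem (hφ i f hf) (hχ i f hf)
      neg_mem' := fun hφ i f hf => neg_mem (hφ i f hf) }

/-- Inflation of the left action: restriction along `φ`. -/
def infl (φ : R →+* S) (M : GrBimod S T) : GrBimod R T where
  carrier := M.carrier
  left := Module.compHom M.carrier φ
  comm :=
    letI := Module.compHom M.carrier φ
    ⟨fun r t m => smul_comm (φ r) t m⟩
  homog := M.homog

end GrBimod

/-- Inflation of left modules: the module `M`, with `R` acting through `φ : R → S`. -/
def Inflate {R S : Type} [Ring R] [Ring S] (_ : R →+* S) (M : Type*) : Type _ := M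

namespace Inflate

variable {R S : Type} [Ring R] [Ring S] (φ : R →+* S) (M : Type*) [AddCommGroup M] [Module S M]

instance : AddCommGroup (Inflate φ M) := inferInstanceAs (AddCommGroup M)

instance : Module R (Inflate φ M) := Module.compHom M φ

end Inflate

/-- Inflation of morphisms: the same map. -/
def Inflate.map {R S : Type} [Ring R] [Ring S] (φ : R →+* S) {M N : Type*} [AddCommGroup M]
    [Module S M] [AddCommGroup N] [Module S N] (f : M →ₗ[S] N) :
    Inflate φ M →ₗ[R] Inflate φ N where
  toFun := f
  map_add' := f.map_add
  map_smul' r m := f.map_smul (φ r) m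

namespace GrBimod

variable {R S T U : Type} [Ring R] [Ring S] [Ring T] [Ring U]

open TensorProduct

/-- The span of the elements `(m t) ⊗ n - m ⊗ (t n)`. These elements are closed under the action of
`S`, so this is also their additive span. -/
def balanced (M : GrBimod S T) (N : Type*) [AddCommGroup N] [Module T N] :
    Submodule S (M.carrier ⊗[ℤ] N) :=
  Submodule.span S {x | ∃ (m : M.carrier) (t : T) (n : N),
    x = (MulOpposite.op t • m) ⊗ₜ[ℤ] n - m ⊗ₜ[ℤ] (t • n)}

/-- The left `S`-module `M ⊗_T N`, a quotient of the tensor product of abelian groups. -/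
abbrev Tensor (M : GrBimod S T) (N : Type*) [AddCommGroup N] [Module T N] : Type _ :=
  (M.carrier ⊗[ℤ] N) ⧸ M.balanced N

/-- the class of `m ⊗ n` -/
def tmul (M : GrBimod S T) {N : Type*} [AddCommGroup N] [Module T N] (m : M.carrier) (n : N) :
    M.Tensor N := (M.balanced N).mkQ (m ⊗ₜ[ℤ] n)

theorem tmul_add (M : GrBimod S T) {N : Type*} [AddCommGroup N] [Module T N] (m : M.carrier)
    (n n' : N) : M.tmul m (n + n') = M.tmul m n + M.tmul m n' := by
  unfold tmul
  rw [TensorProduct.tmul_add, map_add]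

theorem tmul_zero (M : GrBimod S T) {N : Type*} [AddCommGroup N] [Module T N] (m : M.carrier) :
    M.tmul m (0 : N) = 0 := by
  unfold tmul
  rw [TensorProduct.tmul_zero, map_zero]

variable {N N' : Type*} [AddCommGroup N] [Module T N] [AddCommGroup N'] [Module T N']

/-- `M ⊗_T f` -/
def tensorMap (M : GrBimod S T) (f : N →ₗ[T] N') : M.Tensor N →ₗ[S] M.Tensor N' :=
  Submodule.mapQ _ _ (AlgebraTensorModule.map (LinearMap.id : M.carrier →ₗ[S] M.carrier)
    f.toAddMonoidHom.toIntLinearMap) <| by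
      refine Submodule.span_le.2 ?_
      rintro _ ⟨m, t, n, rfl⟩
      refine Submodule.subset_span ⟨m, t, f n, ?_⟩
      rw [map_sub, AlgebraTensorModule.map_tmul, AlgebraTensorModule.map_tmul]
      change _ ⊗ₜ[ℤ] f n - m ⊗ₜ[ℤ] f (t • n) = _
      rw [f.map_smul]
      rfl

theorem tensorMap_tmul (M : GrBimod S T) (f : N →ₗ[T] N') (m : M.carrier) (n : N) :
    M.tensorMap f (M.tmul m n) = M.tmul m (f n) := rfl

theorem tensor_induction (M : GrBimod S T) {p : M.Tensor N → Prop} (zero : p 0)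
    (tmul : ∀ m n, p (M.tmul m n)) (add : ∀ x y, p x → p y → p (x + y)) (x : M.Tensor N) : p x := by
  obtain ⟨x, rfl⟩ := Submodule.mkQ_surjective _ x
  induction x with
  | zero => rw [map_zero]; exact zero
  | tmul m n => exact tmul m n
  | add x y hx hy => rw [map_add]; exact add _ _ hx hy

theorem tensor_hom_ext (M : GrBimod S T) {Q : Type*} [AddCommGroup Q] {f g : M.Tensor N →+ Q}
    (h : ∀ m n, f (M.tmul m n) = g (M.tmul m n)) : f = g := by
  refine AddMonoidHom.ext fun x => M.tensor_induction (p := fun x => f x = g x) (by rw [map_zero, map_zero]) h ?_ x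
  intro x y hx hy
  rw [map_add, map_add, hx, hy]

/-- The elements of degree `d` of `M ⊗_T N`: the sums of elements `m ⊗ n` with `deg m + deg n = d`. -/
def tensorHomog (M : GrBimod S T) (gr : ℤ → AddSubgroup N) (d : ℤ) : AddSubgroup (M.Tensor N) :=
  AddSubgroup.closure {x | ∃ i, ∃ m ∈ M.homog i, ∃ j, ∃ n ∈ gr j, i + j = d ∧ x = M.tmul m n}

/-- the right action of `U` on `M ⊗_T N` -/
@[reducible] def tensorModule (M : GrBimod S T) (N : GrBimod T U) : Module Uᵐᵒᵖ (M.Tensor N.carrier) where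
  smul u x := M.tensorMap (DistribSMul.toLinearMap T N.carrier u) x
  one_smul x := by
    induction x using M.tensor_induction with
    | zero => exact map_zero _
    | tmul m n => exact congrArg (M.tmul m) (one_smul Uᵐᵒᵖ n)
    | add x y hx hy => exact (map_add _ _ _).trans (congrArg₂ _ hx hy)
  mul_smul s t x := by
    induction x using M.tensor_induction with
    | zero => exact (map_zero _).trans ((congrArg _ (map_zero _)).trans (map_zero _)).symm
    | tmul m n => exact congrArg (M.tmul m) (mul_smul s t n)
    | add x y hx hy =>
      refine (map_add _ _ _).trans ((congrArg₂ _ hx hy).trans ?_)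
      exact ((congrArg _ (map_add _ _ _)).trans (map_add _ _ _)).symm
  smul_zero t := map_zero _
  smul_add t x y := map_add _ x y
  add_smul s t x := by
    induction x using M.tensor_induction with
    | zero => exact (map_zero _).trans ((congrArg₂ _ (map_zero _) (map_zero _)).trans (add_zero _)).symm
    | tmul m n => exact (congrArg (M.tmul m) (add_smul s t n)).trans (M.tmul_add m _ _)
    | add x y hx hy =>
      refine (map_add _ _ _).trans ((congrArg₂ _ hx hy).trans ?_)
      refine (add_add_add_comm _ _ _ _).trans ?_
      exact (congrArg₂ _ (map_add _ _ _) (map_add _ _ _)).symm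
  zero_smul x := by
    induction x using M.tensor_induction with
    | zero => exact map_zero _
    | tmul m n => exact (congrArg (M.tmul m) (zero_smul Uᵐᵒᵖ n)).trans (M.tmul_zero m)
    | add x y hx hy => exact (map_add _ _ _).trans ((congrArg₂ _ hx hy).trans (add_zero _))

/-- The bimodule `M ⊗_T N`. -/
def tensor (M : GrBimod S T) (N : GrBimod T U) : GrBimod S U where
  carrier := M.Tensor N.carrier
  right := M.tensorModule N
  comm :=
    letI := M.tensorModule N
    ⟨fun s u x => (map_smul (M.tensorMap (DistribSMul.toLinearMap T N.carrier u)) s x).symm⟩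
  homog := M.tensorHomog N.homog

/-- Projection of the right action along `φ : R → S`: the bimodule `M ⊗_R S`. -/
def projRight (φ : R →+* S) (gr : ℤ → AddSubgroup S) (M : GrBimod T R) : GrBimod T S :=
  M.tensor ((regular gr).infl φ)

end GrBimod

/-- `ℳ` is a grading of the module `M` over the graded ring `S`. -/
structure IsGradedModule {S M : Type*} [Ring S] [AddCommGroup M] [Module S M]
    (gr : ℤ → AddSubgroup S) (ℳ : ℤ → AddSubgroup M) : Prop where
  internal : DirectSum.IsInternal ℳ
  smul_mem : ∀ i j, ∀ s ∈ gr i, ∀ m ∈ ℳ j, s • m ∈ ℳ (i + j)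

/-- The same grading on the inflated module. -/
def Inflate.grading {R S : Type} [Ring R] [Ring S] (φ : R →+* S) {M : Type*} [AddCommGroup M]
    [Module S M] (ℳ : ℤ → AddSubgroup M) : ℤ → AddSubgroup (Inflate φ M) := ℳ

/-- The bimodule `F_k = A_{n,k} e^∨` over `A_{n,k}` and `A_{n,k+1}`. -/
noncomputable def FSar (n k : ℕ) : GrBimod (SarAlg n k) (SarAlg n (k + 1)) :=
  GrBimod.ind (SarAlg.homog n k) (PsiSar n k)

/-- The bimodule `F_k = B_l(n,k) e^∨` over `B_l(n,k)` and `B_l(n,k+1)`. -/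
noncomputable def FOSz (n k : ℕ) : GrBimod (Bl n k) (Bl n (k + 1)) :=
  GrBimod.ind (Bl.homog n k) (PsiOSz n k)

/-- The dual bimodule `E'_k = Hom(F_k, A_{n,k})` over `A_{n,k+1}` and `A_{n,k}`. -/
noncomputable def ESar (n k : ℕ) : GrBimod (SarAlg n (k + 1)) (SarAlg n k) :=
  (FSar n k).dual (SarAlg.homog n k)

/-- The dual bimodule `E''_k = Hom(F_k, B_l(n,k))` over `B_l(n,k+1)` and `B_l(n,k)`. -/
noncomputable def EOSz (n k : ℕ) : GrBimod (Bl n (k + 1)) (Bl n k) :=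
  (FOSz n k).dual (Bl.homog n k)

end BordSart

open BordSart

universe u

/-! Both bimodules are duals of left ideals generated by idempotents. Let `ψ : T →ₙ+* S` and `e =
ψ(1)`. A left linear map `φ : S e → S` satisfies `φ(f) = f φ(e)` because `f = f e`, so it is
determined by `φ(e)`, which lies in `e S` (`dual_apply`, `one_mul_evalGen`). The inclusion `S e ⊂ S`
corresponds to `e` and generates the dual as a right `S`-module. Under this identification `t` in
`T` acts as left multiplication by `ψ(t)`, and `S` acts by right multiplication. For a left
`S`-module `N` it follows that `φ ⊗ n ↦ φ(e) n` identifies `Hom_S(S e, S) ⊗_S N` with `e N`: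
injectivity holds because `φ ⊗ n = incl ⊗ φ(e) n`, and `incl ⊗ n` goes to `e n`
(`tmul_indIncl_evTensor`, `evTensor_tmul_indIncl`).

The input from the two algebras is the commutative square `Ξ Ψ' = Ψ Ξ` (`Xi_PsiOSz`), with `Ψ` and
`Ψ'` regarded as non-unital homomorphisms on the whole rings. Evaluated at `1` it says that `Ξ`
carries the idempotent of the one side to that of the other. Hence, if `N` is the inflation of `M`,
the groups `e M` and `e N` coincide. Evaluated at `b` the square says that the two actions of `b` on
this group coincide: one is by `Ψ(Ξ(b))`, the other by `Ξ(Ψ'(b))`. This is the intertwining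
isomorphism `dualTensorEquiv`, and it is natural because it is the identity on `e M`.

The isomorphism of bimodules is the case `M = A`, combined with the right unit isomorphism `E' ≅ E'
⊗ A` (`dualTensorSelf`). The right action of `a` on `A` is an endomorphism of the left module `A`,
so naturality gives compatibility with it.

For the degrees: the idempotents and the inclusions have degree `0`, and `Ξ` preserves degrees, so
an element of either tensor product has degree `d` exactly if its image in `e M` has degree `d`
(`mem_tensorHomog_iff`). -/

namespace BordSart

/-! ### The dual of a left ideal generated by an idempotent -/

namespace GrBimod

variable {S T : Type} [Ring S] [Ring T]

/-- The generator `e = ψ(1)` of `S e`. -/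
def indGen (ψ : T →ₙ+* S) : IndCarrier ψ := ⟨ψ 1, Submodule.mem_span_singleton_self _⟩

/-- The inclusion of `S e` into `S`, as an element of the dual bimodule. -/
def indIncl (gr : ℤ → AddSubgroup S) (ψ : T →ₙ+* S) : ((ind gr ψ).dual gr).carrier :=
  (IndCarrier ψ).subtype

variable {gr : ℤ → AddSubgroup S} {ψ : T →ₙ+* S}

/-- An element of the dual of `S e` as a homomorphism. -/
def dualHom (φ : ((ind gr ψ).dual gr).carrier) : IndCarrier ψ →ₗ[S] S := φ

/-- The value at the generator `e` of an element of the dual of `S e`. -/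
def evalGen : ((ind gr ψ).dual gr).carrier →+ S where
  toFun φ := dualHom φ (indGen ψ)
  map_zero' := rfl
  map_add' _ _ := rfl

theorem eq_smul_indGen (f : IndCarrier ψ) : f = f.1 • indGen ψ :=
  Subtype.ext (mul_one_of_mem f.2).symm

theorem evalGen_indIncl : evalGen (indIncl gr ψ) = ψ 1 := rfl

/-- Linearity applied to `f = f e`. All computations in the dual are thereby reduced to products in
`S`. -/
theorem dual_apply (φ : ((ind gr ψ).dual gr).carrier) (f : IndCarrier ψ) :
    dualHom φ f = f.1 * evalGen φ := by
  conv_lhs => rw [eq_smul_indGen f]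
  exact (dualHom φ).map_smul _ _

theorem dual_ext {φ χ : ((ind gr ψ).dual gr).carrier} (h : evalGen φ = evalGen χ) : φ = χ :=
  LinearMap.ext (f := dualHom φ) (g := dualHom χ) fun f => by rw [dual_apply, dual_apply, h]

/-- The left action on the dual comes from the right action on `S e`, so `(t φ)(e) = φ(e ψ(t))`.
Since `e ψ(t) = ψ(t)`, this is `φ(ψ(t)) = ψ(t) φ(e)`. -/
theorem evalGen_smul (t : T) (φ : ((ind gr ψ).dual gr).carrier) :
    evalGen (t • φ) = ψ t * evalGen φ := by
  -- The element `e · t` of the right `T`-module `S e` is by definition the product `ψ(1) ψ(t)`.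
  refine (dual_apply φ ⟨ψ 1 * ψ t, mul_mem_indCarrier ψ _ _⟩).trans ?_
  change ψ 1 * ψ t * _ = _
  rw [← map_mul, one_mul]

theorem evalGen_op_smul (s : S) (φ : ((ind gr ψ).dual gr).carrier) :
    evalGen (MulOpposite.op s • φ) = evalGen φ * s := rfl

/-- The unit of `T` acts on the dual as the identity and on values as `e`. Thus the values at `e`
lie in `e S`. -/
theorem one_mul_evalGen (φ : ((ind gr ψ).dual gr).carrier) : ψ 1 * evalGen φ = evalGen φ := by
  rw [← evalGen_smul, one_smul]

/-- The formula `φ(f) = f φ(e)` exhibits `φ` as the inclusion followed by right multiplication by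
`φ(e)`; the inclusion therefore generates the dual over `S`. -/
theorem op_evalGen_smul_indIncl (φ : ((ind gr ψ).dual gr).carrier) :
    MulOpposite.op (evalGen φ) • indIncl gr ψ = φ :=
  dual_ext <| by rw [evalGen_op_smul, evalGen_indIncl, one_mul_evalGen]

theorem indIncl_mem_homog : indIncl gr ψ ∈ ((ind gr ψ).dual gr).homog 0 := by
  intro i f hf
  rw [add_zero]
  exact hf

theorem evalGen_mem (he : ψ 1 ∈ gr 0) {d : ℤ} {φ : ((ind gr ψ).dual gr).carrier}
    (h : φ ∈ ((ind gr ψ).dual gr).homog d) : evalGen φ ∈ gr d := by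
  have := h 0 (indGen ψ) he
  rwa [zero_add] at this

/-- Right multiplication by an element of degree `d` raises degrees by `d`. Together with
`evalGen_mem`, the degree of `φ` can be read off from `φ(e)`. -/
theorem mem_homog_of_evalGen_mem (hmul : ∀ i j, ∀ a ∈ gr i, ∀ b ∈ gr j, a * b ∈ gr (i + j)) {d : ℤ}
    {φ : ((ind gr ψ).dual gr).carrier} (h : evalGen φ ∈ gr d) :
    φ ∈ ((ind gr ψ).dual gr).homog d := by
  intro i f hf
  exact (dual_apply φ f).symm ▸ hmul i d _ hf _ h

/-! ### Tensor products with the dual, through evaluation at the idempotent -/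

section Tensor
open TensorProduct

variable {N N' : Type*} [AddCommGroup N] [Module S N] [AddCommGroup N'] [Module S N']

/-- The map `φ ⊗ n ↦ φ(e) n`, before passing to the balanced tensor product. -/
def evTensor₀ (gr : ℤ → AddSubgroup S) (ψ : T →ₙ+* S) (N : Type*) [AddCommGroup N] [Module S N] :
    ((ind gr ψ).dual gr).carrier ⊗[ℤ] N →ₗ[ℤ] N :=
  TensorProduct.lift <| LinearMap.mk₂ ℤ (fun φ n => evalGen φ • n)
    (fun φ χ n => by rw [map_add, add_smul])
    (fun c φ n => by rw [map_zsmul, smul_assoc])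
    (fun φ n n' => smul_add _ _ _)
    (fun c φ n => smul_comm _ _ _)

/-- The balancing relations are spanned over `T`, not over `ℤ`. This compatibility lets the
evaluation vanish on the whole span once it vanishes on the generators. -/
theorem evTensor₀_smul (t : T) (x : ((ind gr ψ).dual gr).carrier ⊗[ℤ] N) :
    evTensor₀ gr ψ N (t • x) = ψ t • evTensor₀ gr ψ N x := by
  induction x with
  | zero => rw [smul_zero, map_zero, smul_zero]
  | tmul φ n =>
    rw [TensorProduct.smul_tmul']
    change evalGen (t • φ) • n = ψ t • evalGen φ • n
    rw [evalGen_smul, mul_smul]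
  | add x y hx hy => rw [smul_add, map_add, map_add, smul_add, hx, hy]

theorem evTensor₀_eq_zero {x : ((ind gr ψ).dual gr).carrier ⊗[ℤ] N}
    (hx : x ∈ ((ind gr ψ).dual gr).balanced N) : evTensor₀ gr ψ N x = 0 := by
  unfold balanced at hx
  induction hx using Submodule.span_induction with
  | mem x hx =>
    obtain ⟨φ, s, n, rfl⟩ := hx
    rw [map_sub, sub_eq_zero]
    change evalGen (MulOpposite.op s • φ) • n = evalGen φ • s • n
    rw [evalGen_op_smul, mul_smul]
  | zero => exact map_zero _
  | add x y _ _ hx hy => rw [map_add, hx, hy, add_zero]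
  | smul t x _ hx => rw [evTensor₀_smul, hx, smul_zero]

/-- The map `φ ⊗ n ↦ φ(e) n`. -/
def evTensor : ((ind gr ψ).dual gr).Tensor N →+ N :=
  -- The quotient is taken as one of additive groups: `ψ` does not make `N` a `T`-module, as `1`
  -- would act by `e`.
  QuotientAddGroup.lift (((ind gr ψ).dual gr).balanced N).toAddSubgroup
    (evTensor₀ gr ψ N).toAddMonoidHom fun _ hx => evTensor₀_eq_zero hx

theorem evTensor_tmul (φ : ((ind gr ψ).dual gr).carrier) (n : N) :
    evTensor (((ind gr ψ).dual gr).tmul φ n) = evalGen φ • n := rfl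

theorem tmul_op_smul (M : GrBimod T S) (m : M.carrier) (s : S) (n : N) :
    M.tmul (MulOpposite.op s • m) n = M.tmul m (s • n) := by
  unfold tmul
  rw [← sub_eq_zero, ← map_sub]
  exact (Submodule.Quotient.mk_eq_zero _).2 (Submodule.subset_span ⟨m, s, n, rfl⟩)

/-- Since `φ = incl · φ(e)`, the factor `φ(e)` can be moved across: `φ ⊗ n = incl ⊗ φ(e) n`. -/
theorem tmul_indIncl_evTensor (x : ((ind gr ψ).dual gr).Tensor N) :
    ((ind gr ψ).dual gr).tmul (indIncl gr ψ) (evTensor x) = x := by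
  induction x using tensor_induction with
  | zero => rw [map_zero, tmul_zero]
  | tmul φ n => rw [evTensor_tmul, ← tmul_op_smul, op_evalGen_smul_indIncl]
  | add x y hx hy => rw [map_add, tmul_add, hx, hy]

/-- Makes evaluation a coordinate: every later identity in a tensor product is checked in the module
`N` itself, which avoids working with the subgroup `e N`. -/
theorem evTensor_injective :
    Function.Injective (evTensor : ((ind gr ψ).dual gr).Tensor N →+ N) :=
  Function.LeftInverse.injective (g := ((ind gr ψ).dual gr).tmul (indIncl gr ψ))
    tmul_indIncl_evTensor

/-- The composite in the other order is multiplication by `e`, not the identity; so the image of the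
evaluation contains `e N`. -/
theorem evTensor_tmul_indIncl (n : N) :
    evTensor (((ind gr ψ).dual gr).tmul (indIncl gr ψ) n) = ψ 1 • n := rfl

theorem evTensor_smul (t : T) (x : ((ind gr ψ).dual gr).Tensor N) :
    evTensor (t • x) = ψ t • evTensor x := by
  obtain ⟨x, rfl⟩ := Submodule.mkQ_surjective _ x
  exact evTensor₀_smul t x

/-- The unit of `T` acts trivially on the tensor product, so the image of the evaluation is
contained in `e N`. This is what removes the factors `e` that `evTensor_tmul_indIncl` produces. -/
theorem one_smul_evTensor (x : ((ind gr ψ).dual gr).Tensor N) :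
    ψ 1 • evTensor x = evTensor x := by
  rw [← evTensor_smul, one_smul]

theorem evTensor_tensorMap (f : N →ₗ[S] N') (x : ((ind gr ψ).dual gr).Tensor N) :
    evTensor (((ind gr ψ).dual gr).tensorMap f x) = f (evTensor x) := by
  induction x using tensor_induction with
  | zero => simp only [map_zero]
  | tmul φ n => rw [tensorMap_tmul, evTensor_tmul, evTensor_tmul, map_smul]
  | add x y hx hy => simp only [map_add, hx, hy]

/-- Evaluation preserves degrees because `e` has degree `0`, and its inverse `n ↦ incl ⊗ n` does
because the inclusion has degree `0`. A condition on sums of tensors turns into one on a single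
element of `N`. -/
theorem mem_tensorHomog_iff (he : ψ 1 ∈ gr 0) {𝒩 : ℤ → AddSubgroup N}
    (hsmul : ∀ i j, ∀ s ∈ gr i, ∀ n ∈ 𝒩 j, s • n ∈ 𝒩 (i + j)) (d : ℤ)
    (x : ((ind gr ψ).dual gr).Tensor N) :
    x ∈ ((ind gr ψ).dual gr).tensorHomog 𝒩 d ↔ evTensor x ∈ 𝒩 d := by
  constructor
  · intro h
    unfold tensorHomog at h
    induction h using AddSubgroup.closure_induction with
    | mem x hx =>
      obtain ⟨i, φ, hφ, j, n, hn, rfl, rfl⟩ := hx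
      exact hsmul i j _ (evalGen_mem he hφ) n hn
    | zero => rw [map_zero]; exact zero_mem _
    | add x y _ _ hx hy => rw [map_add]; exact add_mem hx hy
    | neg x _ hx => rw [map_neg]; exact neg_mem hx
  · intro h
    -- No sum is needed here: `x` is a single tensor, of the inclusion with an element of degree
    -- `d`.
    rw [← tmul_indIncl_evTensor x]
    exact AddSubgroup.subset_closure
      ⟨0, _, indIncl_mem_homog, d, _, h, zero_add d, rfl⟩

end Tensor

/-! ### Duals along a commutative square of rings -/

section Intertwine
open TensorProduct

variable {A B A' B' : Type} [Ring A] [Ring B] [Ring A'] [Ring B']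
  {grA : ℤ → AddSubgroup A} {grB : ℤ → AddSubgroup B} {ψ : A' →ₙ+* A} {χ : B' →ₙ+* B}
  {ξ : B →+* A} {ξ' : B' →+* A'}
  {M : Type*} [AddCommGroup M] [Module A M] {N : Type*} [AddCommGroup N] [Module B N]

/-- If `ξ χ = ψ ξ'` and `N` is the `A`-module `M` inflated along `ξ`, then the tensor products of the
duals of `A ψ(1)` and `B χ(1)` with `M` and `N` agree: both are identified with `ψ(1) M`. -/
def dualTensorEquiv (h : ∀ b, ξ (χ b) = ψ (ξ' b)) (grA : ℤ → AddSubgroup A)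
    (grB : ℤ → AddSubgroup B) (ι : M ≃+ N) (hι : ∀ b m, ι (ξ b • m) = b • ι m) :
    ((ind grA ψ).dual grA).Tensor M ≃+ ((ind grB χ).dual grB).Tensor N where
  -- Evaluate in `M`, rename the value as an element of `N`, and tensor it with the other inclusion.
  toFun x := ((ind grB χ).dual grB).tmul (indIncl grB χ) (ι (evTensor x))
  invFun y := ((ind grA ψ).dual grA).tmul (indIncl grA ψ) (ι.symm (evTensor y))
  map_add' x y := by rw [map_add, map_add, tmul_add]
  left_inv x := by
    refine evTensor_injective ?_
    -- Going around multiplies the value by `χ(1)` in `N` and then by `ψ(1)` in `M`. The former is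
    -- multiplication by `ξ(χ(1)) = ψ(ξ'(1)) = ψ(1)` in `M`, and both factors fix the value.
    rw [evTensor_tmul_indIncl, evTensor_tmul_indIncl, ← hι, ι.symm_apply_apply, h,
      map_one ξ', one_smul_evTensor, one_smul_evTensor]
  right_inv y := by
    refine evTensor_injective ?_
    -- The same identity backwards: `ψ(1)` is rewritten as `ξ(χ(1))`, which `ι` turns into the
    -- action of `χ(1)` on `N`.
    rw [evTensor_tmul_indIncl, evTensor_tmul_indIncl, ← map_one ξ', ← h, hι, ι.apply_symm_apply,
      one_smul_evTensor, one_smul_evTensor]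

variable (h : ∀ b, ξ (χ b) = ψ (ξ' b)) (ι : M ≃+ N) (hι : ∀ b m, ι (ξ b • m) = b • ι m)

/-- In the coordinates given by evaluation the equivalence is just `ι`: the factor `χ(1)` introduced
by its construction corresponds to `ψ(1)`, which fixes the value of `x`. Linearity, naturality and
degrees all follow from this. -/
theorem evTensor_dualTensorEquiv (x : ((ind grA ψ).dual grA).Tensor M) :
    evTensor (dualTensorEquiv h grA grB ι hι x) = ι (evTensor x) := by
  refine (evTensor_tmul_indIncl _).trans ?_
  rw [← hι, h, map_one, one_smul_evTensor]

/-- Here the square is needed at all `b`, not only at `1`: the values are multiplied by `ψ(ξ'(b))`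
in `M` and by `χ(b)` in `N`. -/
theorem dualTensorEquiv_smul (b : B') (x : ((ind grA ψ).dual grA).Tensor M) :
    dualTensorEquiv h grA grB ι hι (ξ' b • x) = b • dualTensorEquiv h grA grB ι hι x := by
  refine evTensor_injective ?_
  rw [evTensor_dualTensorEquiv, evTensor_smul, evTensor_smul, evTensor_dualTensorEquiv, ← h, hι]

/-- Evaluation is natural and the equivalence is `ι` on values. Keeping `f` and `g` separate covers
two uses: inflated morphisms, and right multiplications on the ring `A`. -/
theorem dualTensorEquiv_tensorMap {M' : Type*} [AddCommGroup M'] [Module A M'] {N' : Type*}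
    [AddCommGroup N'] [Module B N'] (ι' : M' ≃+ N') (hι' : ∀ b m, ι' (ξ b • m) = b • ι' m)
    (f : M →ₗ[A] M') (g : N →ₗ[B] N') (hfg : ∀ m, g (ι m) = ι' (f m))
    (x : ((ind grA ψ).dual grA).Tensor M) :
    dualTensorEquiv h grA grB ι' hι' (((ind grA ψ).dual grA).tensorMap f x) =
      ((ind grB χ).dual grB).tensorMap g (dualTensorEquiv h grA grB ι hι x) := by
  refine evTensor_injective ?_
  rw [evTensor_dualTensorEquiv, evTensor_tensorMap, evTensor_tensorMap, evTensor_dualTensorEquiv,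
    hfg]

-- The square at `1` gives `ψ(1) = ξ(χ(1))`, so the degree of one idempotent follows from that of
-- the other.
include h in
theorem map_one_mem_of_graded (hξ : ∀ d, ∀ b ∈ grB d, ξ b ∈ grA d) (he : χ 1 ∈ grB 0) :
    ψ 1 ∈ grA 0 := by
  rw [← map_one ξ', ← h]
  exact hξ 0 _ he

/-- By `mem_tensorHomog_iff` both sides speak of the degree of the value at the idempotent, in `N`
and in `M`, and `ι` matches the two. -/
theorem dualTensorEquiv_mem_tensorHomog_iff (hξ : ∀ d, ∀ b ∈ grB d, ξ b ∈ grA d)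
    (he : χ 1 ∈ grB 0) {ℳ : ℤ → AddSubgroup M} {𝒩 : ℤ → AddSubgroup N}
    (hM : ∀ i j, ∀ a ∈ grA i, ∀ m ∈ ℳ j, a • m ∈ ℳ (i + j))
    (hMN : ∀ d m, ι m ∈ 𝒩 d ↔ m ∈ ℳ d) (d : ℤ) (x : ((ind grA ψ).dual grA).Tensor M) :
    dualTensorEquiv h grA grB ι hι x ∈ ((ind grB χ).dual grB).tensorHomog 𝒩 d ↔
      x ∈ ((ind grA ψ).dual grA).tensorHomog ℳ d := by
  rw [mem_tensorHomog_iff he _, mem_tensorHomog_iff (map_one_mem_of_graded h hξ he) hM,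
    evTensor_dualTensorEquiv, hMN]
  -- What remains is that `N` is graded over `B`: the action of `s` on `N` is that of `ξ(s)` on `M`,
  -- and `ξ` preserves degrees.
  intro i j s hs n hn
  obtain ⟨m, rfl⟩ := ι.surjective n
  rw [← hι, hMN]
  exact hM i j _ (hξ i s hs) m ((hMN j m).1 hn)

/-! ### The isomorphism of bimodules, from the regular module -/

/-- The right unit isomorphism `φ ↦ φ ⊗ 1`, in the form `φ ↦ incl ⊗ φ(e)`. -/
def dualTensorSelf (grA : ℤ → AddSubgroup A) (ψ : A' →ₙ+* A) :
    ((ind grA ψ).dual grA).carrier ≃+ ((ind grA ψ).dual grA).Tensor A where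
  toFun φ := ((ind grA ψ).dual grA).tmul (indIncl grA ψ) (evalGen φ)
  invFun y := MulOpposite.op (evTensor y) • indIncl grA ψ
  left_inv φ := dual_ext <| by
    rw [evalGen_op_smul, evalGen_indIncl, evTensor_tmul_indIncl, smul_eq_mul, one_mul_evalGen,
      one_mul_evalGen]
  right_inv y := evTensor_injective <| by
    rw [evTensor_tmul_indIncl, evalGen_op_smul, evalGen_indIncl, ← smul_eq_mul (ψ 1),
      one_smul_evTensor, one_smul_evTensor]
  map_add' φ φ' := by rw [map_add, tmul_add]

theorem evTensor_dualTensorSelf (φ : ((ind grA ψ).dual grA).carrier) :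
    evTensor (dualTensorSelf grA ψ φ) = evalGen φ := by
  refine (evTensor_tmul_indIncl _).trans ?_
  rw [smul_eq_mul, one_mul_evalGen]

theorem dualTensorSelf_smul (t : A') (φ : ((ind grA ψ).dual grA).carrier) :
    dualTensorSelf grA ψ (t • φ) = t • dualTensorSelf grA ψ φ := by
  refine evTensor_injective ?_
  rw [evTensor_smul, evTensor_dualTensorSelf, evTensor_dualTensorSelf, evalGen_smul, smul_eq_mul]

/-- On values both sides are `φ(e) a`. The right action on the tensor product is expressed through
right multiplication by `a` as an endomorphism of the left module `A`, the form to which naturality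
applies. -/
theorem dualTensorSelf_op_smul (a : A) (φ : ((ind grA ψ).dual grA).carrier) :
    dualTensorSelf grA ψ (MulOpposite.op a • φ) = ((ind grA ψ).dual grA).tensorMap
      (DistribSMul.toLinearMap A A (MulOpposite.op a)) (dualTensorSelf grA ψ φ) := by
  refine evTensor_injective ?_
  rw [evTensor_tensorMap, evTensor_dualTensorSelf, evTensor_dualTensorSelf]
  rfl

/-- Both sides mean that `φ(e)` has degree `d`. -/
theorem dualTensorSelf_mem_tensorHomog_iff (he : ψ 1 ∈ grA 0)
    (hmul : ∀ i j, ∀ a ∈ grA i, ∀ b ∈ grA j, a * b ∈ grA (i + j)) (d : ℤ)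
    (φ : ((ind grA ψ).dual grA).carrier) :
    dualTensorSelf grA ψ φ ∈ ((ind grA ψ).dual grA).tensorHomog grA d ↔
      φ ∈ ((ind grA ψ).dual grA).homog d := by
  rw [mem_tensorHomog_iff he hmul, evTensor_dualTensorSelf]
  exact ⟨mem_homog_of_evalGen_mem hmul, evalGen_mem he⟩

/-- The ring `A` as the underlying group of the `(B, A)`-bimodule `A`. -/
def regularInflEquiv (ξ : B →+* A) (grA : ℤ → AddSubgroup A) :
    A ≃+ ((regular grA).infl ξ).carrier := AddEquiv.refl A

/-- If `ξ χ = ψ ξ'`, the inflated dual of `A ψ(1)` is isomorphic to the projected dual of `B χ(1)`. -/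
def inflDualIso (hξ : ∀ d, ∀ b ∈ grB d, ξ b ∈ grA d) (he : χ 1 ∈ grB 0)
    (hmul : ∀ i j, ∀ a ∈ grA i, ∀ b ∈ grA j, a * b ∈ grA (i + j)) :
    Iso (((ind grA ψ).dual grA).infl ξ') (((ind grB χ).dual grB).projRight ξ grA) where
  -- Take `M = A`, and for `N` the same group with `B` acting through `ξ`; the target is then the
  -- projection of the dual of `B χ(1)`.
  equiv := (dualTensorSelf grA ψ).trans
    (dualTensorEquiv h grA grB (regularInflEquiv ξ grA) fun _ _ => rfl)
  map_left b φ := (congrArg (dualTensorEquiv h grA grB (regularInflEquiv ξ grA) fun _ _ => rfl)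
    (dualTensorSelf_smul (ξ' b) φ)).trans (dualTensorEquiv_smul h _ _ b (dualTensorSelf grA ψ φ))
  map_right a φ := by
    have h1 := dualTensorSelf_op_smul (ψ := ψ) (grA := grA) a φ
    -- Right multiplication by `a` is linear for the left actions of both `A` and `B`, so the
    -- equivalence commutes with it by naturality.
    have h2 := dualTensorEquiv_tensorMap (grA := grA) (grB := grB) h (regularInflEquiv ξ grA)
      (fun _ _ => rfl) (regularInflEquiv ξ grA) (fun _ _ => rfl)
      (DistribSMul.toLinearMap A A (MulOpposite.op a))
      (DistribSMul.toLinearMap B ((regular grA).infl ξ).carrier (MulOpposite.op a))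
      (fun _ => rfl) (dualTensorSelf grA ψ φ)
    rw [← h1] at h2
    exact h2
  map_homog d φ := (dualTensorEquiv_mem_tensorHomog_iff h (regularInflEquiv ξ grA) (fun _ _ => rfl)
    hξ he hmul (fun _ _ => Iff.rfl) d (dualTensorSelf grA ψ φ)).trans <|
      dualTensorSelf_mem_tensorHomog_iff (map_one_mem_of_graded h hξ he) hmul d φ

/-! ### The intertwining isomorphism for modules -/

/-- A module as the underlying group of its inflation. -/
def inflateEquiv (ξ : B →+* A) (M : Type*) [AddCommGroup M] [Module A M] : M ≃+ Inflate ξ M :=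
  AddEquiv.refl M

/-- If `ξ χ = ψ ξ'`, tensoring with the duals of `A ψ(1)` and `B χ(1)` intertwines inflation. -/
def inflTensorEquiv (grA : ℤ → AddSubgroup A) (grB : ℤ → AddSubgroup B) (M : Type*)
    [AddCommGroup M] [Module A M] :
    Inflate ξ' (((ind grA ψ).dual grA).Tensor M) ≃ₗ[B']
      ((ind grB χ).dual grB).Tensor (Inflate ξ M) :=
  { (inflateEquiv ξ' (((ind grA ψ).dual grA).Tensor M)).symm.trans
      (dualTensorEquiv h grA grB (inflateEquiv ξ M) fun _ _ => rfl) with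
    map_smul' := dualTensorEquiv_smul h (inflateEquiv ξ M) fun _ _ => rfl }

end Intertwine

end GrBimod
end BordSart

/-! ### The commutative square and the degrees for the two algebras -/

namespace BordSart

open MvPolynomial

/-- `Ψ'` and `Ψ` both remove the element `0` from the two states. The numbers `v_i` count elements
strictly to the right of position `0`, so they do not change, and neither do the exponents in the
monomial that `Ξ` assigns to an arrow. -/
theorem Xi_PsiOSz {n k : ℕ} (hn : 0 < n) (b : Bl n (k + 1)) :
    Xi n k (PsiOSz n k b) = PsiSar n k (Xi n (k + 1) b) := by
  obtain ⟨a, ha⟩ := BAlg.mk_surjective n (k + 1) b.val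
  rw [Xi_apply b a ha.symm, PsiSar_mk, Xi_apply _ (psi0 a) (by rw [PsiOSz_val, ← ha, psi2_mk])]
  -- For a fixed lift `a` of `b` the two families of homomorphisms agree already before the illicit
  -- morphisms are divided out.
  congr 1
  refine SoergelEnd.ext_comp fun l m => ?_
  rw [comp_xiMat]
  by_cases h : (0 ∉ l.1 ∧ 0 < n) ∧ (0 ∉ m.1 ∧ 0 < n)
  · refine Eq.trans ?_ (comp_psiMat (xiMat a) ⟨l, h.1⟩ ⟨m, h.2⟩).symm
    rw [comp_xiMat, map_smul, FirstVee.conj_homMon]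
    -- The states appear in reverse order because `f_{x,y}` goes to a map from `R_y` to `R_x`.
    exact congrArg (· • homMon n l.1 m.1) (psi0_apply a ⟨m.incl, h.2.1⟩ ⟨l.incl, h.1.1⟩)
  -- For sequences, having a first symbol `∨` includes `0 < n`, whereas for I-states only `0 ∉ x` is
  -- asked; `hn` makes the two conditions agree.
  · rw [comp_psiMat_eq_zero _ h, psi0_apply_eq_zero a fun h' => h ⟨⟨h'.2, hn⟩, h'.1, hn⟩, zero_smul]

theorem mul_mem_polHomog {n : ℕ} {c c' d d' : ℤ} {p q : Pol n} (hp : p ∈ polHomog n c d)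
    (hq : q ∈ polHomog n c' d') : p * q ∈ polHomog n (c + c') (d + d') := by
  classical
  intro m hm
  rw [coeff_mul] at hm
  obtain ⟨⟨s, t⟩, hst, h⟩ := Finset.exists_ne_zero_of_sum_ne_zero hm
  have h1 := hp s (left_ne_zero_of_mul h)
  have h2 := hq t (right_ne_zero_of_mul h)
  rw [← Finset.HasAntidiagonal.mem_antidiagonal.1 hst, map_add]
  push_cast
  linarith

theorem one_mem_polHomog (n : ℕ) : (1 : Pol n) ∈ polHomog n 0 0 := by
  classical
  intro m hm
  rw [coeff_one] at hm
  obtain rfl : 0 = m := by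
    by_contra h
    exact hm (if_neg h)
  simp

/-- The offset cancels twice the degree of the monomial. In this form, `mul_mem_polHomog` shows that
multiplying by the monomial shifts the offset and keeps the total degree. -/
theorem mon_mem_polHomog (n : ℕ) (e : ℕ → ℕ) :
    mon n e ∈ polHomog n (-(2 * ∑ i ∈ Finset.range n, (e i : ℤ))) 0 := by
  intro m hm
  have h : (mon n e).IsHomogeneous (∑ i : Fin n, e i) := by
    refine IsHomogeneous.prod _ _ _ fun i _ => ?_
    simpa using (isHomogeneous_X ℤ i).pow (e i)
  have h1 : m.degree = ∑ i : Fin n, e i := by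
    by_contra h'
    exact hm (h.coeff_eq_zero h')
  rw [h1, Finset.sum_range]
  push_cast
  ring

theorem smul_homMon_one {n : ℕ} {l m : Finset ℕ} (p : Pol n) :
    (p • homMon n l m) 1 = Ideal.Quotient.mk _ (p * mon n (cexp m l)) := by
  rw [LinearMap.smul_apply, homMon_one, Rb_smul, ← map_mul]

/-- Representing polynomials multiply under composition, and the offsets telescope: `(b^λ - b^ν) +
(b^ν - b^μ) = b^λ - b^μ`. Hence each summand `R_λ → R_ν → R_μ` has degree `i + j`. -/
theorem SoergelEnd.mul_mem_homog {n k : ℕ} {i j : ℤ} {a b : SoergelEnd n k}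
    (ha : a ∈ SoergelEnd.homog n k i) (hb : b ∈ SoergelEnd.homog n k j) :
    a * b ∈ SoergelEnd.homog n k (i + j) := by
  intro l m
  have key : ∀ v : Vl n k, ∃ p ∈
      polHomog n (∑ i ∈ Finset.range n, ((bseq l.1 i : ℤ) - bseq m.1 i)) (i + j),
      (comp a v m ∘ₗ comp b l v) 1 = Ideal.Quotient.mk _ p := fun v => by
    obtain ⟨p, hp, h⟩ := ha v m
    obtain ⟨q, hq, h'⟩ := hb l v
    refine ⟨p * q, ?_, ?_⟩
    · convert mul_mem_polHomog hp hq using 2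
      rw [← Finset.sum_add_distrib]
      exact Finset.sum_congr rfl fun _ _ => by ring
    -- The class of `q` is written as a multiple of `1`, so that linearity reduces the composite to
    -- the value at `1`.
    · have e : (Ideal.Quotient.mk (Ib n (bseq v.1)) q) = q • (1 : Rb n v.1) := by
        rw [Rb_smul, mul_one]
      rw [LinearMap.comp_apply, h', e, map_smul, h, Rb_smul, ← map_mul, mul_comm]
  choose p hp h using key
  refine ⟨∑ v, p v, sum_mem fun v _ => hp v, ?_⟩
  rw [comp_mul, LinearMap.sum_apply, map_sum]
  exact Finset.sum_congr rfl fun v _ => h v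

theorem SarAlg.mul_mem_homog {n k : ℕ} (i j : ℤ) :
    ∀ a ∈ SarAlg.homog n k i, ∀ b ∈ SarAlg.homog n k j, a * b ∈ SarAlg.homog n k (i + j) := by
  rintro _ ⟨a, ha, rfl⟩ _ ⟨b, hb, rfl⟩
  exact ⟨a * b, SoergelEnd.mul_mem_homog ha hb, map_mul (SarAlg.mk n k) a b⟩

/-- At each line the degrees match by `|v^μ - v^λ| - 2 max(v^μ - v^λ, 0) = v^λ - v^μ = b^λ - b^μ`:
the left side is the degree of the arrow less that of the monomial, the right side the shift of `R_λ
→ R_μ`. -/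
theorem Xi_mem_homog {n k : ℕ} (d : ℤ) :
    ∀ b ∈ Bl.homog n k d, Xi n k b ∈ SarAlg.homog n k d := by
  rintro b ⟨a, ha, h⟩
  rw [Xi_apply b a h.symm]
  refine ⟨xiMat a, fun l m => ⟨_, ?_, by rw [comp_xiMat, smul_homMon_one]⟩, rfl⟩
  convert mul_mem_polHomog (ha m.incl l.incl) (mon_mem_polHomog n (cexp m.1 l.1)) using 2
  · rw [← sub_eq_add_neg, Finset.mul_sum, ← Finset.sum_sub_distrib]
    refine Finset.sum_congr rfl fun i _ => ?_
    -- The second difference is the truncated one of natural numbers, that is, the maximum with `0`.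
    change _ = |(wt m.1 i : ℤ) - wt l.1 i| - 2 * ((wt m.1 i - wt l.1 i : ℕ) : ℤ)
    unfold bseq
    rcases abs_cases ((wt m.1 i : ℤ) - wt l.1 i) with h | h <;> omega
  · exact (add_zero d).symm

/-- The image of `1` is represented by a sum of idempotents `f_{x,x}`: the coefficients are
constants and the offsets `∑ |v_i^x - v_i^x|` vanish. -/
theorem PsiOSz_one_mem_homog (n k : ℕ) : PsiOSz n k 1 ∈ Bl.homog n k 0 := by
  refine ⟨psi0 (B0.diag fun x => n ∉ x), ?_, ?_⟩
  · rw [psi0_diag]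
    intro x y
    unfold B0.diag
    split_ifs with h
    · rw [h.1]
      simpa using one_mem_polHomog n
    · exact zero_mem _
  · change _ = (PsiOSz n k 1).val
    rw [PsiOSz_val, Bl.val_one]
    exact (psi2_mk _).symm

end BordSart

/-! ### The theorem -/

theorem mainTheorem11 (n k : ℕ) (hn : 1 ≤ n) :
    Nonempty (GrBimod.Iso ((ESar n k).infl (Xi n (k + 1)))
      ((EOSz n k).projRight (Xi n k) (SarAlg.homog n k))) ∧
    ∃ η : ∀ (M : Type u) [AddCommGroup M] [Module (SarAlg n k) M],
        Inflate (Xi n (k + 1)) ((ESar n k).Tensor M) ≃ₗ[Bl n (k + 1)]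
          (EOSz n k).Tensor (Inflate (Xi n k) M),
      (∀ (M N : Type u) [AddCommGroup M] [Module (SarAlg n k) M] [AddCommGroup N]
        [Module (SarAlg n k) N] (f : M →ₗ[SarAlg n k] N)
        (x : Inflate (Xi n (k + 1)) ((ESar n k).Tensor M)),
        η N (Inflate.map (Xi n (k + 1)) ((ESar n k).tensorMap f) x) =
          (EOSz n k).tensorMap (Inflate.map (Xi n k) f) (η M x)) ∧
      ∀ (M : Type u) [AddCommGroup M] [Module (SarAlg n k) M] (ℳ : ℤ → AddSubgroup M),
        IsGradedModule (SarAlg.homog n k) ℳ →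
        ∀ (d : ℤ) (x : Inflate (Xi n (k + 1)) ((ESar n k).Tensor M)),
          η M x ∈ (EOSz n k).tensorHomog (Inflate.grading (Xi n k) ℳ) d ↔
            x ∈ Inflate.grading (Xi n (k + 1)) ((ESar n k).tensorHomog ℳ) d := by
  have h := Xi_PsiOSz (k := k) hn
  refine ⟨⟨GrBimod.inflDualIso h Xi_mem_homog (PsiOSz_one_mem_homog n k) SarAlg.mul_mem_homog⟩,
    fun M _ _ => GrBimod.inflTensorEquiv h (SarAlg.homog n k) (Bl.homog n k) M, ?_, ?_⟩
  -- An inflated morphism is the same map of underlying groups, so the required compatibility with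
  -- the identifications holds by definition.
  · exact fun M N _ _ _ _ f x => GrBimod.dualTensorEquiv_tensorMap h
      (GrBimod.inflateEquiv (Xi n k) M) (fun _ _ => rfl) (GrBimod.inflateEquiv (Xi n k) N)
      (fun _ _ => rfl) f (Inflate.map (Xi n k) f) (fun _ => rfl) x
  · exact fun M _ _ ℳ hM d x => GrBimod.dualTensorEquiv_mem_tensorHomog_iff h
      (GrBimod.inflateEquiv (Xi n k) M) (fun _ _ => rfl) Xi_mem_homog (PsiOSz_one_mem_homog n k)
      hM.smul_mem (fun _ _ => Iff.rfl) d x
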